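/- Let $\Sigma$ be a closed (compact, without boundary) smooth surface, smoothly embedded in $\mathbb{R}^m$ for some $m\ge 3$, let $\mathcal{U}\subset\mathbb{R}^m$ be a tubular neighborhood of $\Sigma$, i.e. an open neighborhood of $\Sigma$ in which every point has a unique nearest point on $\Sigma$ and the nearest point projection $P\colon\mathcal{U}\to\Sigma$ is smooth, and let $\psi\in C_c^\infty(\mathbb{R}^m)$ be a radial mollifier, i.e. $\psi\ge 0$ is radially symmetric, supported in the closed unit ball, and $\int\psi=1$; put $\psi_\varepsilon(x)=\varepsilon^{-m}\psi(x/\varepsilon)$. Let $g_0$ be a smooth Riemannian metric on $\Sigma$, and let $F\in W^{2,2}\cap W^{1,\infty}((\Sigma,g_0);\mathbb{R}^n)$ be a Lipschitz immersion, i.e. there is $c>0$ such that for almost every $p\in\Sigma$ $$|\mathrm{d}F_p(X)|^2\ge c\,|X|^2_{g_0(p)}\qquad\text{for all }X\in T_p\Sigma .$$ For $\varepsilon>0$ and $p\in\Sigma$ set $$\bar F_\varepsilon(p)=\int_{\mathcal{U}}\psi_\varepsilon(p-y)\,F(P(y))\,\mathrm{d}y .$$ Then for all sufficiently small $\varepsilon>0$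 the map $\bar F_\varepsilon\colon\Sigma\to\mathbb{R}^n$ is of class $C^\infty$ and an immersion, and $\bar F_\varepsilon\to F$ strongly in $W^{2,2}(\Sigma;\mathbb{R}^n)$ as $\varepsilon\to 0$. -/

import Mathlib

open MeasureTheory Set Filter
open scoped Manifold ContDiff Topology ENNReal

noncomputable section

/-- The model space of surfaces, the Euclidean plane. -/
abbrev Plane : Type := EuclideanSpace ℝ (Fin 2)

/-! ### Weak derivatives and local Sobolev spaces on open subsets of the plane -/

section Euclidean

variable {V : Type*} [NormedAddCommGroup V] [NormedSpace ℝ V]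

/-- `G` is a weak (distributional) total derivative of `u` on the open set `Ω`: both are locally
integrable on `Ω`, and `∫ (∂_v η) u = - ∫ η (G v)` for every test function `η ∈ C_c^∞(Ω)` and
every direction `v`. -/
structure HasWeakFDeriv (Ω : Set Plane) (u : Plane → V) (G : Plane → Plane →L[ℝ] V) : Prop where
  locallyIntegrableOn : LocallyIntegrableOn u Ω volume
  locallyIntegrableOn_deriv : LocallyIntegrableOn G Ω volume
  integral_eq : ∀ η : Plane → ℝ, ContDiff ℝ ∞ η → HasCompactSupport η → tsupport η ⊆ Ω →
    ∀ v : Plane, ∫ x, (fderiv ℝ η x v) • u x = - ∫ x, η x • G x v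

/-- `u ∈ W^{2,2}_loc(Ω)`: `u` has weak derivatives of first and second order on `Ω`, and these
and `u` are square integrable on every compact subset of `Ω`. -/
def MemW22Loc (Ω : Set Plane) (u : Plane → V) : Prop :=
  ∃ (G : Plane → Plane →L[ℝ] V) (H : Plane → Plane →L[ℝ] Plane →L[ℝ] V),
    HasWeakFDeriv Ω u G ∧ HasWeakFDeriv Ω G H ∧
    ∀ K : Set Plane, IsCompact K → K ⊆ Ω →
      MemLp u 2 (volume.restrict K) ∧ MemLp G 2 (volume.restrict K) ∧
        MemLp H 2 (volume.restrict K)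

/-- The norm `‖u‖_{L²(K)} + ‖Du‖_{L²(K)} + ‖D²u‖_{L²(K)}` for `K ⊆ Ω`, where `Du`, `D²u` are the
weak derivatives of `u` on `Ω`. These are unique up to null sets, so that the infimum is over
representatives with one and the same value; it is `∞` if `u` is not twice weakly
differentiable on `Ω`. -/
def w22Seminorm (Ω K : Set Plane) (u : Plane → V) : ℝ≥0∞ :=
  ⨅ (G : Plane → Plane →L[ℝ] V) (H : Plane → Plane →L[ℝ] Plane →L[ℝ] V)
    (_ : HasWeakFDeriv Ω u G ∧ HasWeakFDeriv Ω G H),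
    eLpNorm u 2 (volume.restrict K) + eLpNorm G 2 (volume.restrict K)
      + eLpNorm H 2 (volume.restrict K)

end Euclidean

/-! ### Sobolev maps and Lipschitz immersions on a compact surface -/

section Surface

variable {S : Type*} [TopologicalSpace S] [ChartedSpace Plane S]
  {V : Type*} [NormedAddCommGroup V] [NormedSpace ℝ V]

/-- `F ∈ W^{2,2}(S; V)` for a compact smooth surface `S`: in every smooth chart `φ` the local
representative `F ∘ φ⁻¹` is in `W^{2,2}_loc`. -/
def MemW22 (F : S → V) : Prop :=
  ∀ φ ∈ IsManifold.maximalAtlas 𝓘(ℝ, Plane) ∞ S, MemW22Loc φ.target (F ∘ φ.symm)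

/-- Strong convergence `F_i → F` in `W^{2,2}(S; V)` along the filter `l`, for a compact smooth
surface `S`: for every smooth chart `φ` and every compact subset `K` of its image, the
`W^{2,2}(K)`-norm of `(F_i - F) ∘ φ⁻¹` tends to zero. As `S` is covered by the interiors of
finitely many such coordinate compacta, this is convergence in the `W^{2,2}(S)`-norm. -/
def TendstoW22 {ι : Type*} (Fs : ι → S → V) (l : Filter ι) (F : S → V) : Prop :=
  ∀ φ ∈ IsManifold.maximalAtlas 𝓘(ℝ, Plane) ∞ S, ∀ K : Set Plane, IsCompact K → K ⊆ φ.target →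
    Tendsto (fun i => w22Seminorm φ.target K (fun x => Fs i (φ.symm x) - F (φ.symm x))) l (𝓝 0)

/-- A smooth Riemannian metric on the surface `S`. -/
abbrev SurfaceMetric (S : Type*) [TopologicalSpace S] [ChartedSpace Plane S]
    [IsManifold 𝓘(ℝ, Plane) ∞ S] : Type _ :=
  Bundle.ContMDiffRiemannianMetric (B := S) 𝓘(ℝ, Plane) ∞ Plane
    (fun p : S => TangentSpace 𝓘(ℝ, Plane) p)

variable [IsManifold 𝓘(ℝ, Plane) ∞ S]

/-- The squared length `|X|²_{g₀}` of the tangent vector `X = d(φ⁻¹)_x(v)` at `φ⁻¹(x)` which the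
vector `v` represents in the chart `φ`. -/
def chartSqNorm (g₀ : SurfaceMetric S) (φ : OpenPartialHomeomorph S Plane) (x v : Plane) : ℝ :=
  let X : TangentSpace 𝓘(ℝ, Plane) (φ.symm x) :=
    mfderiv 𝓘(ℝ, Plane) 𝓘(ℝ, Plane) φ.symm x v
  g₀.inner (φ.symm x) X X

/-- `F ∈ W^{1,∞}((S, g₀); V)`: `F` is weakly differentiable, and `F` and `|dF|_{g₀}` are
essentially bounded. -/
def MemW1Infty (g₀ : SurfaceMetric S) (F : S → V) : Prop :=
  ∃ C : ℝ, ∀ φ ∈ IsManifold.maximalAtlas 𝓘(ℝ, Plane) ∞ S,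
    ∃ G : Plane → Plane →L[ℝ] V, HasWeakFDeriv φ.target (F ∘ φ.symm) G ∧
      ∀ᵐ x ∂(volume.restrict φ.target),
        ‖F (φ.symm x)‖ ≤ C ∧ ∀ v : Plane, ‖G x v‖ ≤ C * √(chartSqNorm g₀ φ x v)

/-- `F` is a `W^{2,2}`-Lipschitz immersion of `(S, g₀)`: `F ∈ W^{2,2} ∩ W^{1,∞}`, and there is
`c > 0` with `|dF_p(X)|² ≥ c |X|²_{g₀}` for almost every `p` and all tangent vectors `X` at `p`. -/
structure IsW22LipschitzImmersion (g₀ : SurfaceMetric S) (F : S → V) : Prop where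
  memW22 : MemW22 F
  memW1Infty : MemW1Infty g₀ F
  lower_bound : ∃ c : ℝ, 0 < c ∧ ∀ φ ∈ IsManifold.maximalAtlas 𝓘(ℝ, Plane) ∞ S,
    ∀ G : Plane → Plane →L[ℝ] V, HasWeakFDeriv φ.target (F ∘ φ.symm) G →
      ∀ᵐ x ∂(volume.restrict φ.target), ∀ v : Plane, c * chartSqNorm g₀ φ x v ≤ ‖G x v‖ ^ 2

/-- A smooth immersion of the surface `S`: a smooth map with injective differentials. -/
structure IsSmoothImmersion (f : S → V) : Prop where
  contMDiff : ContMDiff 𝓘(ℝ, Plane) 𝓘(ℝ, V) ∞ f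
  injective_mfderiv : ∀ p : S, Function.Injective (mfderiv 𝓘(ℝ, Plane) 𝓘(ℝ, V) f p)

/-- A smooth embedding of the surface `S`: a smooth immersion which is a homeomorphism onto its
image. -/
structure IsSmoothSurfaceEmbedding (f : S → V) : Prop extends IsSmoothImmersion f where
  isEmbedding : Topology.IsEmbedding f

/-! ### Mollification in a tubular neighborhood -/

/-- `U` is a tubular neighborhood of the embedded surface `j(S)` in `V` with nearest point
projection `P` (a map to `S`, only its values on `U` matter): `U` is an open neighborhood of
`j(S)`, every `y ∈ U` has `j(P(y))` as its unique nearest point on `j(S)`, and `P` is smooth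
on `U`. -/
structure IsTubularNeighborhood (j : S → V) (U : Set V) (P : V → S) : Prop where
  isOpen : IsOpen U
  range_subset : range j ⊆ U
  nearest : ∀ y ∈ U, ∀ q : S, q ≠ P y → dist y (j (P y)) < dist y (j q)
  contMDiffOn : ContMDiffOn 𝓘(ℝ, V) 𝓘(ℝ, Plane) ∞ P U

end Surface

/-- A smooth radial mollifier on the unit ball of `ℝ^m`. -/
structure IsRadialMollifier {m : ℕ} (ψ : EuclideanSpace ℝ (Fin m) → ℝ) : Prop where
  contDiff : ContDiff ℝ ∞ ψ
  nonneg : ∀ x, 0 ≤ ψ x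
  tsupport_subset : tsupport ψ ⊆ Metric.closedBall 0 1
  integral_eq_one : ∫ x, ψ x = 1
  radial : ∀ x y, ‖x‖ = ‖y‖ → ψ x = ψ y

/-- The mollification `F̄_ε(x) = ∫_U ψ_ε(x - y) F(P(y)) dy` of `F̄ = F ∘ P : U → W`, where
`ψ_ε(z) = ε^{-m} ψ(z / ε)`. -/
def tubularMollification {S W : Type*} [NormedAddCommGroup W] [NormedSpace ℝ W] {m : ℕ}
    (ψ : EuclideanSpace ℝ (Fin m) → ℝ) (U : Set (EuclideanSpace ℝ (Fin m)))
    (P : EuclideanSpace ℝ (Fin m) → S) (F : S → W) (ε : ℝ)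
    (x : EuclideanSpace ℝ (Fin m)) : W :=
  ∫ y in U, ((ε ^ m)⁻¹ * ψ (ε⁻¹ • (x - y))) • F (P y)

end

/-!
In a chart `φ` with local representative `f = F ∘ φ⁻¹`, the mollified map is
`u_ε(x) = ∫ f(Θ_v(x)) dν_ε(v)`, where `ν_ε` is the probability measure with density
`v ↦ ψ_ε(-v)` and `Θ_v(x) = Q(p(x) + v)`; here `p` is the embedding and `Q` the nearest point
projection, both read in the chart. Since `Θ_0` is the identity, the maps `Θ_v` are for small `v` a
smooth family of local diffeomorphisms of the plane close to the identity (`IsNearIdentity`), and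
`ν_ε` concentrates at `v = 0`.

*Convergence.* Composition with `Θ_v` is bounded on `L²` with a constant independent of `v` and
depends continuously on `v` in the strong sense, so that averages `∫ a(v, x) A(Θ_v(x)) dν_ε(v)` with
a smooth coefficient `a` converge in `L²` to `a(0, x) A(x)`
(`IsNearIdentity.exists_eLpNorm_integral_sub_le`). The first and second derivatives of `u_ε` are
averages of this kind, with `A` a weak derivative of `f`, by a chain rule
(`IsNearIdentity.hasWeakFDeriv_integral_apply_comp`); applied twice, it gives convergence in
`W^{2,2}` on small balls (`IsNearIdentity.exists_eLpNorm_fderiv_sub_le`), and finitely many of them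
cover a given compact set.

*Immersion.* The weak differential `G` of `f` is in `W^{1,2}` in two dimensions, hence has vanishing
mean oscillation: by the translation estimate for `W^{1,2}` maps, its mean square deviation on a
ball of radius of order `ε` from one of its values `L` on that ball is controlled by the energy of
the second derivatives on a comparable ball, which is small uniformly in the centre. The value `L`
can be chosen to satisfy the lower bound `|L e| ≥ c |e|`. The distribution of `Θ_v(x)` under `ν_ε`
has a density of order at most `ε⁻²` on such a ball
(`IsNearIdentity.exists_lintegral_kernelMeasure_le`), so that
`du_ε(x) = ∫ G(Θ_v(x)) DΘ_v(x) dν_ε(v)` differs from `L ∘ ∫ DΘ_v(x) dν_ε(v)` by little, uniformly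
in `x`. As `DΘ_v` is close to the identity, `|du_ε(x) e| ≥ (c / 4) |e|`
(`IsNearIdentity.exists_le_norm_integral_derivCoeffOne`). The constant `c` in the Euclidean norm
comes from the local comparison of `g₀` with the Euclidean metric of the chart
(`exists_mul_sq_norm_le_chartSqNorm`).
-/

noncomputable section

/-! ### Calculus of weak derivatives -/

section WeakDerivative

variable {V : Type*} [NormedAddCommGroup V] [NormedSpace ℝ V]

theorem integrable_smul_of_tsupport_subset {Ω : Set Plane} {c : Plane → ℝ} {u : Plane → V}
    (hc : Continuous c) (hcs : HasCompactSupport c) (hcΩ : tsupport c ⊆ Ω)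
    (hu : LocallyIntegrableOn u Ω) : Integrable (fun x => c x • u x) := by
  have h1 : IntegrableOn u (tsupport c) := hu.integrableOn_compact_subset hcΩ hcs
  have h2 : IntegrableOn (fun x => c x • u x) (tsupport c) :=
    h1.continuousOn_smul hc.continuousOn hcs
  refine (integrableOn_iff_integrable_of_support_subset ?_).1 h2
  intro x hx
  exact subset_tsupport _ (fun h => hx (by simp [h]))

theorem continuous_fderiv_apply {η : Plane → ℝ} (h : ContDiff ℝ ∞ η) (v : Plane) :
    Continuous (fun x => fderiv ℝ η x v) :=
  (h.continuous_fderiv (by simp)).clm_apply continuous_const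

theorem HasWeakFDeriv.mono {Ω Ω' : Set Plane} {u : Plane → V} {G : Plane → Plane →L[ℝ] V}
    (h : HasWeakFDeriv Ω u G) (hs : Ω' ⊆ Ω) : HasWeakFDeriv Ω' u G :=
  ⟨h.1.mono_set hs, h.2.mono_set hs, fun η h1 h2 h3 => h.3 η h1 h2 (h3.trans hs)⟩

theorem HasWeakFDeriv.congr {Ω : Set Plane} (hΩ : MeasurableSet Ω)
    {u u' : Plane → V} {G G' : Plane → Plane →L[ℝ] V}
    (h : HasWeakFDeriv Ω u G) (hu : u =ᵐ[volume.restrict Ω] u')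
    (hG : G =ᵐ[volume.restrict Ω] G') : HasWeakFDeriv Ω u' G' := by
  have key : ∀ {X : Type _} [NormedAddCommGroup X] {f g : Plane → X},
      f =ᵐ[volume.restrict Ω] g → LocallyIntegrableOn f Ω → LocallyIntegrableOn g Ω := by
    intro X _ f g hfg hf x hx
    obtain ⟨U, hU, hUf⟩ := hf x hx
    refine ⟨U ∩ Ω, inter_mem hU self_mem_nhdsWithin, ?_⟩
    exact (hUf.mono_set inter_subset_left).congr
      (ae_restrict_of_ae_restrict_of_subset inter_subset_right hfg)
  have key2 : ∀ {X : Type _} [NormedAddCommGroup X] [NormedSpace ℝ X] {f g : Plane → X}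
      {c : Plane → ℝ}, f =ᵐ[volume.restrict Ω] g → tsupport c ⊆ Ω →
      ∫ x, c x • f x = ∫ x, c x • g x := by
    intro X _ _ f g c hfg hc
    refine integral_congr_ae ?_
    filter_upwards [(ae_restrict_iff' hΩ).1 hfg] with x hx
    by_cases h : x ∈ Ω
    · rw [hx h]
    · rw [image_eq_zero_of_notMem_tsupport (fun h' => h (hc h')), zero_smul, zero_smul]
  refine ⟨key hu h.1, key hG h.2, fun η h1 h2 h3 v => ?_⟩
  rw [← key2 hu ((tsupport_fderiv_apply_subset ℝ v).trans h3),
    ← key2 (f := fun x => G x v) (g := fun x => G' x v) (hG.mono fun x hx => by simp [hx]) h3]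
  exact h.3 η h1 h2 h3 v

theorem HasWeakFDeriv.sub {Ω : Set Plane} {u u' : Plane → V} {G G' : Plane → Plane →L[ℝ] V}
    (h : HasWeakFDeriv Ω u G) (h' : HasWeakFDeriv Ω u' G') :
    HasWeakFDeriv Ω (fun x => u x - u' x) (fun x => G x - G' x) := by
  refine ⟨h.1.sub h'.1, h.2.sub h'.2, fun η h1 h2 h3 v => ?_⟩
  have i1 := continuous_fderiv_apply h1 v
  have i2 := h2.fderiv_apply ℝ v
  have i3 := (tsupport_fderiv_apply_subset ℝ v).trans h3
  have l : ∀ {G : Plane → Plane →L[ℝ] V}, LocallyIntegrableOn G Ω →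
      Integrable (fun x => η x • G x v) := fun {G} hG =>
    (ContinuousLinearMap.apply ℝ V v).integrable_comp
      (integrable_smul_of_tsupport_subset h1.continuous h2 h3 hG)
  simp only [smul_sub, sub_apply]
  rw [integral_sub (integrable_smul_of_tsupport_subset i1 i2 i3 h.1)
    (integrable_smul_of_tsupport_subset i1 i2 i3 h'.1), integral_sub (l h.2) (l h'.2),
    h.3 η h1 h2 h3 v, h'.3 η h1 h2 h3 v]
  abel

/-- A classically differentiable map is weakly differentiable. -/
theorem hasWeakFDeriv_of_contDiffOn {Ω : Set Plane} (hΩ : IsOpen Ω) {u : Plane → V}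
    (hu : ContDiffOn ℝ 1 u Ω) : HasWeakFDeriv Ω u (fderiv ℝ u) := by
  have l1 : LocallyIntegrableOn u Ω :=
    hu.continuousOn.locallyIntegrableOn hΩ.measurableSet
  have l2 : LocallyIntegrableOn (fderiv ℝ u) Ω :=
    (hu.continuousOn_fderiv_of_isOpen hΩ le_rfl).locallyIntegrableOn hΩ.measurableSet
  refine ⟨l1, l2, fun η h1 h2 h3 v => ?_⟩
  have := integral_smul_fderiv_eq_neg_fderiv_smul_of_integrable (μ := (volume : Measure Plane))
    (f := η) (g := u) (v := v)
    (integrable_smul_of_tsupport_subset (continuous_fderiv_apply h1 v)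
      (h2.fderiv_apply ℝ v) ((tsupport_fderiv_apply_subset ℝ v).trans h3) l1)
    ((ContinuousLinearMap.apply ℝ V v).integrable_comp
      (integrable_smul_of_tsupport_subset h1.continuous h2 h3 l2))
    (integrable_smul_of_tsupport_subset h1.continuous h2 h3 l1)
    (fun x _ => (h1.differentiable (by simp)).differentiableAt)
    (fun x hx => (hu.differentiableOn one_ne_zero).differentiableAt (hΩ.mem_nhds (h3 hx)))
  rw [this, neg_neg]

/-- Weak derivatives are unique up to null sets. -/
theorem HasWeakFDeriv.ae_eq [CompleteSpace V] {Ω : Set Plane} (hΩ : IsOpen Ω) {u : Plane → V}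
    {G G' : Plane → Plane →L[ℝ] V} (h : HasWeakFDeriv Ω u G) (h' : HasWeakFDeriv Ω u G') :
    G =ᵐ[volume.restrict Ω] G' := by
  have key : ∀ᵐ x ∂(volume : Measure Plane), x ∈ Ω → G x - G' x = 0 := by
    refine hΩ.ae_eq_zero_of_integral_contDiff_smul_eq_zero (h.2.sub h'.2) ?_
    intro η h1 h2 h3
    have l : ∀ {G : Plane → Plane →L[ℝ] V}, LocallyIntegrableOn G Ω →
        Integrable (fun x => η x • G x) := fun {G} hG =>
      integrable_smul_of_tsupport_subset h1.continuous h2 h3 hG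
    ext1 v
    rw [← ContinuousLinearMap.apply_apply v, ← ContinuousLinearMap.integral_comp_comm]
    · have e1 := h.3 η h1 h2 h3 v
      have e2 := h'.3 η h1 h2 h3 v
      have a : ∀ {G : Plane → Plane →L[ℝ] V}, LocallyIntegrableOn G Ω →
        Integrable (fun x => η x • G x v) := fun {G} hG =>
          (ContinuousLinearMap.apply ℝ V v).integrable_comp (l hG)
      simp only [ContinuousLinearMap.apply_apply, smul_sub, sub_apply,
        smul_apply]
      rw [integral_sub (a h.2) (a h'.2)]
      rw [e1, neg_inj] at e2
      rw [e2, sub_self]; simp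
    · exact l (h.2.sub h'.2)
  rw [EventuallyEq, ae_restrict_iff' hΩ.measurableSet]
  filter_upwards [key] with x hx hxΩ using sub_eq_zero.1 (hx hxΩ)

theorem tendsto_integral_smul_of_tendsto_lintegral {Ω : Set Plane} (hΩ : MeasurableSet Ω)
    {c : Plane → ℝ} (hc : Continuous c) (hcs : HasCompactSupport c) (hcΩ : tsupport c ⊆ Ω)
    {u : ℕ → Plane → V} {u₀ : Plane → V} (h0 : LocallyIntegrableOn u₀ Ω)
    (h : ∀ k, LocallyIntegrableOn (u k) Ω)
    (hlim : Tendsto (fun k => ∫⁻ x in Ω, ‖u k x - u₀ x‖ₑ) atTop (𝓝 0)) :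
    Tendsto (fun k => ∫ x, c x • u k x) atTop (𝓝 (∫ x, c x • u₀ x)) := by
  obtain ⟨C, hC⟩ := hcs.exists_bound_of_continuous hc
  refine tendsto_integral_of_L1 _
    (integrable_smul_of_tsupport_subset hc hcs hcΩ h0).aestronglyMeasurable
    (Eventually.of_forall fun k => integrable_smul_of_tsupport_subset hc hcs hcΩ (h k)) ?_
  have hb : ∀ k, ∫⁻ x, ‖c x • u k x - c x • u₀ x‖ₑ
      ≤ ENNReal.ofReal C * ∫⁻ x in Ω, ‖u k x - u₀ x‖ₑ := by
    intro k
    rw [← lintegral_const_mul' _ _ ENNReal.ofReal_ne_top, ← lintegral_indicator hΩ]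
    refine lintegral_mono fun x => ?_
    by_cases hx : x ∈ Ω
    · rw [indicator_of_mem hx, ← smul_sub, enorm_smul]
      gcongr
      rw [← ofReal_norm]
      exact ENNReal.ofReal_le_ofReal (hC x)
    · have : c x = 0 := image_eq_zero_of_notMem_tsupport (fun h' => hx (hcΩ h'))
      simp [this]
  refine tendsto_of_tendsto_of_tendsto_of_le_of_le tendsto_const_nhds ?_ (fun _ => zero_le) hb
  simpa using ENNReal.Tendsto.const_mul hlim (Or.inr ENNReal.ofReal_ne_top)

/-- Weak derivatives are closed under `L¹` convergence of the map and of the derivative. -/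
theorem hasWeakFDeriv_of_tendsto [CompleteSpace V] {Ω : Set Plane} (hΩ : MeasurableSet Ω)
    {u : ℕ → Plane → V} {G : ℕ → Plane → Plane →L[ℝ] V}
    {u₀ : Plane → V} {G₀ : Plane → Plane →L[ℝ] V}
    (h : ∀ k, HasWeakFDeriv Ω (u k) (G k))
    (hu0 : LocallyIntegrableOn u₀ Ω) (hG0 : LocallyIntegrableOn G₀ Ω)
    (hu : Tendsto (fun k => ∫⁻ x in Ω, ‖u k x - u₀ x‖ₑ) atTop (𝓝 0))
    (hG : Tendsto (fun k => ∫⁻ x in Ω, ‖G k x - G₀ x‖ₑ) atTop (𝓝 0)) :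
    HasWeakFDeriv Ω u₀ G₀ := by
  refine ⟨hu0, hG0, fun η h1 h2 h3 v => ?_⟩
  have t1 := tendsto_integral_smul_of_tendsto_lintegral hΩ (continuous_fderiv_apply h1 v)
    (h2.fderiv_apply ℝ v) ((tsupport_fderiv_apply_subset ℝ v).trans h3) hu0
    (fun k => (h k).1) hu
  have t2 := tendsto_integral_smul_of_tendsto_lintegral hΩ h1.continuous h2 h3 hG0
    (fun k => (h k).2) hG
  have e : ∀ {G : Plane → Plane →L[ℝ] V}, LocallyIntegrableOn G Ω →
      (∫ x, η x • G x) v = ∫ x, η x • G x v := by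
    intro G hG
    rw [← ContinuousLinearMap.apply_apply v, ← ContinuousLinearMap.integral_comp_comm _
      (integrable_smul_of_tsupport_subset h1.continuous h2 h3 hG)]
    simp
  have t3 := ((ContinuousLinearMap.apply ℝ V v).continuous.tendsto _).comp t2
  simp only [Function.comp_def, ContinuousLinearMap.apply_apply] at t3
  rw [e hG0] at t3
  refine tendsto_nhds_unique t1 (t3.neg.congr fun k => ?_)
  rw [e (h k).2, (h k).3 η h1 h2 h3 v]

end WeakDerivative

/-! ### Averages of families of maps -/

section Averages

variable {V : Type*} [NormedAddCommGroup V] [NormedSpace ℝ V]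
  {X Y : Type*} [MeasurableSpace X] [MeasurableSpace Y]

theorem eLpNorm_two_sq {V : Type*} [NormedAddCommGroup V] (f : X → V) (μ : Measure X) :
    eLpNorm f 2 μ ^ 2 = ∫⁻ x, ‖f x‖ₑ ^ 2 ∂μ := by
  have := eLpNorm_nnreal_pow_eq_lintegral (μ := μ) (f := f) (p := 2) two_ne_zero
  simpa using this

theorem ENNReal.le_of_sq_le_sq {a b : ℝ≥0∞} (h : a ^ 2 ≤ b ^ 2) : a ≤ b :=
  (ENNReal.pow_le_pow_left_iff two_ne_zero).1 h

theorem sq_lintegral_enorm_le {V : Type*} [NormedAddCommGroup V] {ν : Measure X}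
    [IsProbabilityMeasure ν] {f : X → V} (hf : AEStronglyMeasurable f ν) :
    (∫⁻ x, ‖f x‖ₑ ∂ν) ^ 2 ≤ ∫⁻ x, ‖f x‖ₑ ^ 2 ∂ν := by
  rw [← eLpNorm_two_sq, ← eLpNorm_one_eq_lintegral_enorm]
  gcongr
  exact eLpNorm_le_eLpNorm_of_exponent_le one_le_two hf

theorem eLpNorm_uncurry_le {V : Type*} [NormedAddCommGroup V] {ν : Measure X}
    [IsProbabilityMeasure ν] {κ : Measure Y} [SFinite κ] {g : X → Y → V}
    (hg : AEStronglyMeasurable (Function.uncurry g) (ν.prod κ)) {C : ℝ≥0∞}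
    (hC : ∀ᵐ v ∂ν, eLpNorm (g v) 2 κ ≤ C) :
    eLpNorm (Function.uncurry g) 2 (ν.prod κ) ≤ C := by
  refine ENNReal.le_of_sq_le_sq ?_
  rw [eLpNorm_two_sq, lintegral_prod _ (hg.enorm.pow_const 2)]
  calc ∫⁻ v, ∫⁻ y, ‖Function.uncurry g (v, y)‖ₑ ^ 2 ∂κ ∂ν ≤ ∫⁻ _, C ^ 2 ∂ν := by
        refine lintegral_mono_ae (hC.mono fun v hv => ?_)
        simp only [Function.uncurry_apply_pair]
        rw [← eLpNorm_two_sq]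
        gcongr
    _ = C ^ 2 := by simp

/-- Minkowski's integral inequality for the average of a family of maps in `L²`. -/
theorem eLpNorm_integral_le {ν : Measure X} [IsProbabilityMeasure ν]
    {κ : Measure Y} [SFinite κ] {g : X → Y → V}
    (hg : AEStronglyMeasurable (Function.uncurry g) (ν.prod κ)) {C : ℝ≥0∞}
    (hC : ∀ᵐ v ∂ν, eLpNorm (g v) 2 κ ≤ C) :
    eLpNorm (fun y => ∫ v, g v y ∂ν) 2 κ ≤ C := by
  refine le_trans (ENNReal.le_of_sq_le_sq ?_) (eLpNorm_uncurry_le hg hC)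
  rw [eLpNorm_two_sq, eLpNorm_two_sq, lintegral_prod_symm _ (hg.enorm.pow_const 2)]
  refine lintegral_mono_ae ?_
  have := hg.prod_swap.prodMk_left
  filter_upwards [this] with y hy
  refine le_trans ?_ (sq_lintegral_enorm_le (f := fun v => g v y) hy)
  gcongr
  exact enorm_integral_le_lintegral_enorm _

/-- Averages of weakly differentiable maps are weakly differentiable. -/
theorem hasWeakFDeriv_integral [CompleteSpace V] {ν : Measure X} [IsFiniteMeasure ν]
    {Ω : Set Plane} (hΩ : MeasurableSet Ω)
    {g : X → Plane → V} {g' : X → Plane → Plane →L[ℝ] V}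
    (h : ∀ᵐ v ∂ν, HasWeakFDeriv Ω (g v) (g' v))
    (hg : Integrable (Function.uncurry g) (ν.prod (volume.restrict Ω)))
    (hg' : Integrable (Function.uncurry g') (ν.prod (volume.restrict Ω))) :
    HasWeakFDeriv Ω (fun x => ∫ v, g v x ∂ν) (fun x => ∫ v, g' v x ∂ν) := by
  have l1 : IntegrableOn (fun x => ∫ v, g v x ∂ν) Ω := hg.integral_prod_right
  have l2 : IntegrableOn (fun x => ∫ v, g' v x ∂ν) Ω := hg'.integral_prod_right
  refine ⟨l1.locallyIntegrableOn, l2.locallyIntegrableOn, fun η h1 h2 h3 e => ?_⟩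
  -- Fubini for the pairing of the family with a continuous weight supported in `Ω`
  have key : ∀ {c : Plane → ℝ} {f : X → Plane → V}, Continuous c → HasCompactSupport c →
      tsupport c ⊆ Ω → Integrable (Function.uncurry f) (ν.prod (volume.restrict Ω)) →
      ∫ x, c x • (∫ v, f v x ∂ν) = ∫ v, (∫ x, c x • f v x) ∂ν := by
    intro c f hc hcs hcΩ hf
    have out : ∀ x, x ∉ Ω → c x = 0 := fun x hx =>
      image_eq_zero_of_notMem_tsupport (fun h' => hx (hcΩ h'))
    have e1 : ∀ u : Plane → V, ∫ x, c x • u x = ∫ x in Ω, c x • u x := fun u =>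
      (setIntegral_eq_integral_of_forall_compl_eq_zero fun x hx => by simp [out x hx]).symm
    rw [e1, integral_congr_ae (Eventually.of_forall fun v => e1 (f v))]
    simp only [← integral_smul]
    obtain ⟨C, hC⟩ := hcs.exists_bound_of_continuous hc
    refine integral_integral_swap (f := fun x v => c x • f v x) ?_
    have := hf.swap
    exact this.bdd_smul (φ := fun z : Plane × X => c z.1) C
      (hc.measurable.comp measurable_fst).aestronglyMeasurable
      (Eventually.of_forall fun z => hC z.1)
  have e2 : ∀ᵐ x ∂(volume.restrict Ω), (∫ v, g' v x ∂ν) e = ∫ v, g' v x e ∂ν := by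
    filter_upwards [hg'.prod_left_ae] with x hx
    exact (ContinuousLinearMap.integral_comp_comm (ContinuousLinearMap.apply ℝ V e) hx).symm
  have e3 : ∫ x, η x • (∫ v, g' v x ∂ν) e = ∫ x, η x • (∫ v, g' v x e ∂ν) := by
    refine integral_congr_ae ?_
    filter_upwards [(ae_restrict_iff' hΩ).1 e2] with x hx
    by_cases hxΩ : x ∈ Ω
    · rw [hx hxΩ]
    · rw [image_eq_zero_of_notMem_tsupport (fun h' => hxΩ (h3 h')), zero_smul, zero_smul]
  rw [e3, key (continuous_fderiv_apply h1 e) (h2.fderiv_apply ℝ e)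
    ((tsupport_fderiv_apply_subset ℝ e).trans h3) hg,
    key (f := fun v x => g' v x e) h1.continuous h2 h3
      ((ContinuousLinearMap.apply ℝ V e).integrable_comp hg'), ← integral_neg]
  exact integral_congr_ae (h.mono fun v hv => hv.3 η h1 h2 h3 e)

end Averages

/-! ### Families of maps close to the identity -/

section NearIdentity

variable {V W : Type*} [NormedAddCommGroup V] [NormedSpace ℝ V]
  [NormedAddCommGroup W] [NormedSpace ℝ W]
  {E : Type*} [NormedAddCommGroup E] [NormedSpace ℝ E]

theorem exists_norm_le_of_continuous [FiniteDimensional ℝ E] (a : E → Plane → V →L[ℝ] W)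
    (ha : Continuous (Function.uncurry a)) (x₀ : Plane) (r δ : ℝ) :
    ∃ M : ℝ, 0 ≤ M ∧ ∀ v, ‖v‖ ≤ δ → ∀ x ∈ Metric.ball x₀ r, ‖a v x‖ ≤ M := by
  have hK : IsCompact (Metric.closedBall (0 : E) δ ×ˢ Metric.closedBall x₀ r) :=
    (isCompact_closedBall _ _).prod (isCompact_closedBall _ _)
  obtain ⟨C, hC⟩ := hK.exists_bound_of_continuousOn ha.continuousOn
  refine ⟨max C 0, le_max_right _ _, fun v hv x hx => ?_⟩
  exact (hC (v, x) ⟨by simpa using hv, Metric.ball_subset_closedBall hx⟩).trans (le_max_left _ _)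

theorem isFiniteMeasure_restrict_ball (x : Plane) (r : ℝ) :
    IsFiniteMeasure (volume.restrict (Metric.ball x r)) :=
  isFiniteMeasure_restrict.2 measure_ball_lt_top.ne

/-- A smooth family `Θ v` of maps of the plane, parametrized by the vectors `v` of a normed space,
which on the ball of radius `r` about `x₀` is the identity for `v = 0` and close to it for
`‖v‖ < δ`: each `Θ v` moves points by at most `Λ ‖v‖ ≤ r`, its differential differs from the
identity by at most `1 / 2`, and its Jacobian is at least `1 / 2`. -/
structure IsNearIdentity (Θ : E → Plane → Plane) (x₀ : Plane) (r δ Λ : ℝ) : Prop where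
  contDiff : ContDiff ℝ ∞ (Function.uncurry Θ)
  r_pos : 0 < r
  δ_pos : 0 < δ
  Λ_nonneg : 0 ≤ Λ
  mul_le : Λ * δ ≤ r
  zero : ∀ x ∈ Metric.ball x₀ r, Θ 0 x = x
  dist_le : ∀ v, ‖v‖ < δ → ∀ x ∈ Metric.ball x₀ r, dist (Θ v x) x ≤ Λ * ‖v‖
  fderiv_close : ∀ v, ‖v‖ < δ → ∀ x ∈ Metric.ball x₀ r,
    ‖fderiv ℝ (Θ v) x - ContinuousLinearMap.id ℝ Plane‖ ≤ 1 / 2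
  det_ge : ∀ v, ‖v‖ < δ → ∀ x ∈ Metric.ball x₀ r, 1 / 2 ≤ |(fderiv ℝ (Θ v) x).det|

namespace IsNearIdentity

variable {Θ : E → Plane → Plane} {x₀ : Plane} {r δ Λ : ℝ}

theorem contDiff_apply (h : IsNearIdentity Θ x₀ r δ Λ) (v : E) : ContDiff ℝ ∞ (Θ v) :=
  h.contDiff.comp (contDiff_const.prodMk contDiff_id)

theorem mapsTo (h : IsNearIdentity Θ x₀ r δ Λ) {v : E} (hv : ‖v‖ < δ) :
    MapsTo (Θ v) (Metric.ball x₀ r) (Metric.ball x₀ (2 * r)) := by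
  intro x hx
  have h1 := h.dist_le v hv x hx
  have h2 : Λ * ‖v‖ ≤ r := (mul_le_mul_of_nonneg_left hv.le h.Λ_nonneg).trans h.mul_le
  have h3 := dist_triangle (Θ v x) x x₀
  rw [Metric.mem_ball] at hx ⊢
  linarith

theorem injOn (h : IsNearIdentity Θ x₀ r δ Λ) {v : E} (hv : ‖v‖ < δ) :
    InjOn (Θ v) (Metric.ball x₀ r) := by
  intro x hx y hy hxy
  have hd : ∀ z, DifferentiableAt ℝ (Θ v) z := fun z =>
    (h.contDiff_apply v).differentiable (by simp) z
  have := (convex_ball x₀ r).norm_image_sub_le_of_norm_hasFDerivWithin_le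
    (f := fun z => Θ v z - z) (f' := fun z => fderiv ℝ (Θ v) z - ContinuousLinearMap.id ℝ Plane)
    (fun z _ => ((hd z).hasFDerivAt.sub (hasFDerivAt_id z)).hasFDerivWithinAt)
    (h.fderiv_close v hv) hx hy
  simp only [hxy] at this
  have e : Θ v y - y - (Θ v y - x) = -(y - x) := by abel
  rw [e, norm_neg] at this
  have h0 : ‖y - x‖ = 0 := by linarith [norm_nonneg (y - x)]
  exact (sub_eq_zero.1 (norm_eq_zero.1 h0)).symm

/-- Composition with a map of the family at most doubles integrals. -/
theorem lintegral_comp_le (h : IsNearIdentity Θ x₀ r δ Λ) {v : E} (hv : ‖v‖ < δ)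
    {s t : Set Plane} (hs : MeasurableSet s) (hsr : s ⊆ Metric.ball x₀ r)
    (hst : MapsTo (Θ v) s t) (f : Plane → ℝ≥0∞) :
    ∫⁻ x in s, f (Θ v x) ≤ 2 * ∫⁻ y in t, f y := by
  have hd : ∀ z, DifferentiableAt ℝ (Θ v) z := fun z =>
    (h.contDiff_apply v).differentiable (by simp) z
  have key := lintegral_image_eq_lintegral_abs_det_fderiv_mul volume hs
    (f := Θ v) (f' := fderiv ℝ (Θ v)) (fun x _ => (hd x).hasFDerivAt.hasFDerivWithinAt)
    ((h.injOn hv).mono hsr) f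
  calc ∫⁻ x in s, f (Θ v x)
      ≤ ∫⁻ x in s, 2 * (ENNReal.ofReal |(fderiv ℝ (Θ v) x).det| * f (Θ v x)) := by
        refine setLIntegral_mono' hs fun x hx => ?_
        rw [← mul_assoc]
        refine le_mul_of_one_le_left zero_le ?_
        have h2 := ENNReal.ofReal_le_ofReal
          (by linarith [h.det_ge v hv x (hsr hx)] : 1 ≤ 2 * |(fderiv ℝ (Θ v) x).det|)
        rwa [ENNReal.ofReal_mul (by norm_num), ENNReal.ofReal_one, ENNReal.ofReal_ofNat] at h2
    _ = 2 * ∫⁻ y in Θ v '' s, f y := by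
        rw [key, lintegral_const_mul' _ _ (by simp)]
    _ ≤ 2 * ∫⁻ y in t, f y := by
        gcongr
        exact hst.image_subset

theorem eLpNorm_comp_le {V : Type*} [NormedAddCommGroup V] (h : IsNearIdentity Θ x₀ r δ Λ) {v : E}
    (hv : ‖v‖ < δ) (A : Plane → V) :
    eLpNorm (fun x => A (Θ v x)) 2 (volume.restrict (Metric.ball x₀ r)) ≤
      2 * eLpNorm A 2 (volume.restrict (Metric.ball x₀ (2 * r))) := by
  refine ENNReal.le_of_sq_le_sq ?_
  rw [mul_pow, eLpNorm_two_sq, eLpNorm_two_sq]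
  refine (h.lintegral_comp_le hv Metric.isOpen_ball.measurableSet subset_rfl (h.mapsTo hv)
    (fun y => ‖A y‖ₑ ^ 2)).trans ?_
  gcongr
  norm_num

theorem quasiMeasurePreserving (h : IsNearIdentity Θ x₀ r δ Λ) {v : E} (hv : ‖v‖ < δ) :
    Measure.QuasiMeasurePreserving (Θ v) (volume.restrict (Metric.ball x₀ r))
      (volume.restrict (Metric.ball x₀ (2 * r))) := by
  have hm : Measurable (Θ v) := (h.contDiff_apply v).continuous.measurable
  refine ⟨hm, Measure.AbsolutelyContinuous.mk fun s hs h0 => ?_⟩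
  rw [Measure.map_apply hm hs]
  have := h.lintegral_comp_le hv Metric.isOpen_ball.measurableSet subset_rfl (h.mapsTo hv)
    (s.indicator 1)
  rw [lintegral_indicator_one hs, h0, mul_zero] at this
  have e : (fun x => s.indicator (1 : Plane → ℝ≥0∞) (Θ v x))
    = (Θ v ⁻¹' s).indicator 1 := by
    rfl
  rw [e, lintegral_indicator_one (hm hs)] at this
  exact le_antisymm this zero_le

theorem eLpNorm_apply_comp_le (h : IsNearIdentity Θ x₀ r δ Λ) {a : E → Plane → V →L[ℝ] W}
    {M : ℝ} {v : E} (hv : ‖v‖ < δ) (hM : ∀ x ∈ Metric.ball x₀ r, ‖a v x‖ ≤ M) (A : Plane → V) :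
    eLpNorm (fun x => a v x (A (Θ v x))) 2 (volume.restrict (Metric.ball x₀ r)) ≤
      ENNReal.ofReal M * (2 * eLpNorm A 2 (volume.restrict (Metric.ball x₀ (2 * r)))) := by
  refine le_trans (eLpNorm_le_mul_eLpNorm_of_ae_le_mul (g := fun x => A (Θ v x)) (c := M) ?_ 2) ?_
  · filter_upwards [ae_restrict_mem Metric.isOpen_ball.measurableSet] with x hx
    exact (ContinuousLinearMap.le_opNorm _ _).trans
      (mul_le_mul_of_nonneg_right (hM x hx) (norm_nonneg _))
  · gcongr
    exact h.eLpNorm_comp_le hv A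

/-- The maps `a v · (A ∘ Θ v)` tend to `a 0 · A` in `L²` as `v → 0`. -/
theorem tendsto_eLpNorm_apply_comp_sub [FiniteDimensional ℝ E] (h : IsNearIdentity Θ x₀ r δ Λ)
    {a : E → Plane → V →L[ℝ] W} (ha : Continuous (Function.uncurry a))
    {A : Plane → V} (hA : MemLp A 2 (volume.restrict (Metric.ball x₀ (2 * r)))) :
    Tendsto (fun v => eLpNorm (fun x => a v x (A (Θ v x)) - a 0 x (A x)) 2
      (volume.restrict (Metric.ball x₀ r))) (𝓝 0) (𝓝 0) := by
  set κ := volume.restrict (Metric.ball x₀ r) with hκ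
  have hδ2 : δ / 2 < δ := half_lt_self h.δ_pos
  obtain ⟨M, hM0, hM⟩ := exists_norm_le_of_continuous a ha x₀ r (δ / 2)
  have hfin : κ univ ≠ ⊤ := by
    rw [hκ, Measure.restrict_apply_univ]; exact measure_ball_lt_top.ne
  rw [ENNReal.tendsto_nhds_zero]
  intro η hη
  -- the three error terms each contribute a third of `η`
  obtain ⟨η₁, hη₁, hη₁'⟩ : ∃ η₁ : ℝ≥0∞, η₁ ≠ 0 ∧ ENNReal.ofReal M * (2 * η₁) ≤ η / 3 := by
    refine ⟨(η / 3) / (2 * (ENNReal.ofReal M + 1)), ?_, ?_⟩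
    · exact (ENNReal.div_pos (ENNReal.div_pos hη.ne' (by simp)).ne'
        (ENNReal.mul_ne_top (by simp) (by simp))).ne'
    · calc ENNReal.ofReal M * (2 * ((η / 3) / (2 * (ENNReal.ofReal M + 1))))
          ≤ (ENNReal.ofReal M + 1) * (2 * ((η / 3) / (2 * (ENNReal.ofReal M + 1)))) := by
            gcongr; exact le_self_add
        _ = (2 * (ENNReal.ofReal M + 1)) * ((η / 3) / (2 * (ENNReal.ofReal M + 1))) := by ring
        _ = η / 3 := ENNReal.mul_div_cancel (by simp) (ENNReal.mul_ne_top (by simp) (by simp))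
  have hreg : (volume.restrict (Metric.ball x₀ (2 * r))).Regular :=
    Measure.Regular.restrict_of_measure_ne_top measure_ball_lt_top.ne
  obtain ⟨g, -, hg1, hgc, hg2⟩ := hA.exists_hasCompactSupport_eLpNorm_sub_le (by simp) hη₁
  -- for a continuous map the convergence is uniform
  have hunif : ∀ s > 0, ∀ᶠ v in 𝓝 (0 : E), ∀ x ∈ Metric.closedBall x₀ r,
      ‖a v x (g (Θ v x)) - a 0 x (g (Θ 0 x))‖ < s := by
    intro s hs
    refine (isCompact_closedBall x₀ r).eventually_forall_of_forall_eventually fun y _ => ?_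
    have c1 : Continuous fun z : E × Plane => a z.1 z.2 (g (Θ z.1 z.2)) :=
      ha.clm_apply (hgc.comp h.contDiff.continuous)
    have c2 : Continuous fun z : E × Plane => a 0 z.2 (g (Θ 0 z.2)) :=
      c1.comp (continuous_const.prodMk continuous_snd)
    have : Tendsto (fun z : E × Plane =>
        ‖a z.1 z.2 (g (Θ z.1 z.2)) - a 0 z.2 (g (Θ 0 z.2))‖) (𝓝 (0, y)) (𝓝 0) := by
      have := (c1.sub c2).norm.tendsto (0, y)
      simpa using this
    exact this.eventually_lt_const hs
  obtain ⟨s, hs0, hs⟩ : ∃ s : ℝ, 0 < s ∧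
      κ univ ^ (1 / (2 : ℝ≥0∞).toReal) * ENNReal.ofReal s ≤ η / 3 := by
    have : Tendsto (fun s : ℝ => κ univ ^ (1 / (2 : ℝ≥0∞).toReal) * ENNReal.ofReal s)
        (𝓝[>] 0) (𝓝 0) := by
      have h1 : Tendsto (fun s : ℝ => ENNReal.ofReal s) (𝓝[>] 0) (𝓝 0) := by
        have := ENNReal.continuous_ofReal.tendsto 0
        simp only [ENNReal.ofReal_zero] at this
        exact this.mono_left nhdsWithin_le_nhds
      simpa using ENNReal.Tendsto.const_mul (a := κ univ ^ (1 / (2 : ℝ≥0∞).toReal)) h1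
        (Or.inr (ENNReal.rpow_ne_top_of_nonneg (by positivity) hfin))
    obtain ⟨s, h1, h2⟩ := ((this.eventually_le_const
      (ENNReal.div_pos hη.ne' (ENNReal.ofNat_ne_top (n := 3)))).and self_mem_nhdsWithin).exists
    exact ⟨s, h2, h1⟩
  have hball : ∀ᶠ v in 𝓝 (0 : E), ‖v‖ < δ / 2 := by
    filter_upwards [Metric.ball_mem_nhds (0 : E) (half_pos h.δ_pos)] with v hv
    simpa using hv
  filter_upwards [hunif s hs0, hball] with v hv1 hv2
  have hmeas : ∀ {w : E}, ‖w‖ < δ → ∀ {B : Plane → V},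
      AEStronglyMeasurable B (volume.restrict (Metric.ball x₀ (2 * r))) →
      AEStronglyMeasurable (fun x => a w x (B (Θ w x))) κ := by
    intro w hw B hB
    have h1 := hB.comp_quasiMeasurePreserving (h.quasiMeasurePreserving hw)
    have h2 : AEStronglyMeasurable (a w) κ :=
      (ha.comp (continuous_const.prodMk continuous_id)).aestronglyMeasurable
    exact (isBoundedBilinearMap_apply (𝕜 := ℝ) (E := V) (F := W)).continuous
      |>.comp_aestronglyMeasurable₂ h2 h1
  have hv2' := hv2.trans hδ2
  have h0δ : ‖(0 : E)‖ < δ := by simpa using h.δ_pos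
  have split : (fun x => a v x (A (Θ v x)) - a 0 x (A x)) =ᵐ[κ]
      ((fun x => a v x ((A - g) (Θ v x))) +
        fun x => a v x (g (Θ v x)) - a 0 x (g (Θ 0 x))) - fun x => a 0 x ((A - g) (Θ 0 x)) := by
    filter_upwards [ae_restrict_mem Metric.isOpen_ball.measurableSet] with x hx
    simp [h.zero x hx]
  have m1 := hmeas hv2' (hA.1.sub hg2.1)
  have m2 : AEStronglyMeasurable (fun x => a v x (g (Θ v x)) - a 0 x (g (Θ 0 x))) κ :=
    (hmeas hv2' hg2.1).sub (hmeas h0δ hg2.1)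
  have m3 := hmeas h0δ (hA.1.sub hg2.1)
  have b1 : ∀ w, ‖w‖ ≤ δ / 2 → eLpNorm (fun x => a w x ((A - g) (Θ w x))) 2 κ ≤ η / 3 := by
    intro w hw
    refine (h.eLpNorm_apply_comp_le (hw.trans_lt hδ2) (hM w hw) (A - g)).trans ?_
    refine le_trans ?_ hη₁'
    gcongr
  have b2 : eLpNorm (fun x => a v x (g (Θ v x)) - a 0 x (g (Θ 0 x))) 2 κ ≤ η / 3 := by
    refine (eLpNorm_le_of_ae_bound (C := s) ?_).trans ?_
    · filter_upwards [ae_restrict_mem Metric.isOpen_ball.measurableSet] with x hx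
      exact (hv1 x (Metric.ball_subset_closedBall hx)).le
    · simpa using hs
  rw [eLpNorm_congr_ae split]
  calc _ ≤ eLpNorm ((fun x => a v x ((A - g) (Θ v x))) +
        fun x => a v x (g (Θ v x)) - a 0 x (g (Θ 0 x))) 2 κ
        + eLpNorm (fun x => a 0 x ((A - g) (Θ 0 x))) 2 κ :=
        eLpNorm_sub_le (m1.add m2) m3 one_le_two
    _ ≤ (eLpNorm (fun x => a v x ((A - g) (Θ v x))) 2 κ
        + eLpNorm (fun x => a v x (g (Θ v x)) - a 0 x (g (Θ 0 x))) 2 κ)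
        + eLpNorm (fun x => a 0 x ((A - g) (Θ 0 x))) 2 κ := by
        gcongr
        exact eLpNorm_add_le m1 m2 one_le_two
    _ ≤ (η / 3 + η / 3) + η / 3 := by
        gcongr
        · exact b1 v hv2.le
        · exact b1 0 (by simpa using (half_pos h.δ_pos).le)
    _ = η := ENNReal.add_thirds η

variable [MeasurableSpace E] [BorelSpace E]

theorem measurable_uncurry (h : IsNearIdentity Θ x₀ r δ Λ) : Measurable (Function.uncurry Θ) :=
  h.contDiff.continuous.measurable

theorem quasiMeasurePreserving_prod (h : IsNearIdentity Θ x₀ r δ Λ) {ν : Measure E} [SFinite ν]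
    (hν : ∀ᵐ v ∂ν, ‖v‖ < δ) :
    Measure.QuasiMeasurePreserving (Function.uncurry Θ)
      (ν.prod (volume.restrict (Metric.ball x₀ r)))
      (volume.restrict (Metric.ball x₀ (2 * r))) := by
  refine ⟨h.measurable_uncurry, Measure.AbsolutelyContinuous.mk fun s hs h0 => ?_⟩
  rw [Measure.map_apply h.measurable_uncurry hs,
    Measure.measure_prod_null (h.measurable_uncurry hs)]
  filter_upwards [hν] with v hv
  exact (h.quasiMeasurePreserving hv).preimage_null h0

theorem aestronglyMeasurable_prod [FiniteDimensional ℝ E] (h : IsNearIdentity Θ x₀ r δ Λ)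
    {ν : Measure E} [SFinite ν] (hν : ∀ᵐ v ∂ν, ‖v‖ < δ)
    {a : E → Plane → V →L[ℝ] W} (ha : Continuous (Function.uncurry a)) {A : Plane → V}
    (hA : AEStronglyMeasurable A (volume.restrict (Metric.ball x₀ (2 * r)))) :
    AEStronglyMeasurable (Function.uncurry fun v x => a v x (A (Θ v x)))
      (ν.prod (volume.restrict (Metric.ball x₀ r))) := by
  have := FiniteDimensional.proper ℝ E
  have h1 := hA.comp_quasiMeasurePreserving (h.quasiMeasurePreserving_prod hν)
  have h2 : AEStronglyMeasurable (Function.uncurry a)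
    (ν.prod (volume.restrict (Metric.ball x₀ r))) := ha.aestronglyMeasurable
  have := (isBoundedBilinearMap_apply (𝕜 := ℝ) (E := V) (F := W)).continuous
    |>.comp_aestronglyMeasurable₂ h2 h1
  exact this

theorem memLp_uncurry [FiniteDimensional ℝ E] (h : IsNearIdentity Θ x₀ r δ Λ) {ν : Measure E}
    [IsProbabilityMeasure ν] {δ' : ℝ} (hδ : δ' < δ)
    (hν : ∀ᵐ v ∂ν, ‖v‖ ≤ δ') {a : E → Plane → V →L[ℝ] W} (ha : Continuous (Function.uncurry a))
    {A : Plane → V} (hA : MemLp A 2 (volume.restrict (Metric.ball x₀ (2 * r)))) :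
    MemLp (Function.uncurry fun v x => a v x (A (Θ v x))) 2
      (ν.prod (volume.restrict (Metric.ball x₀ r))) := by
  obtain ⟨M, hM0, hM⟩ := exists_norm_le_of_continuous a ha x₀ r δ'
  have hm := h.aestronglyMeasurable_prod (hν.mono fun v hv => hv.trans_lt hδ) ha hA.1
  refine ⟨hm, (eLpNorm_uncurry_le hm
    (C := ENNReal.ofReal M * (2 * eLpNorm A 2 (volume.restrict (Metric.ball x₀ (2 * r)))))
    ?_).trans_lt ?_⟩
  · filter_upwards [hν] with v hv
    exact h.eLpNorm_apply_comp_le (hv.trans_lt hδ) (hM v hv) A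
  · exact ENNReal.mul_lt_top ENNReal.ofReal_lt_top (ENNReal.mul_lt_top (by simp) hA.2)

/-- Averages of the maps `a v · (A ∘ Θ v)` over probability measures concentrated near `0` are
close to `a 0 · A` in `L²`. -/
theorem exists_eLpNorm_integral_sub_le [FiniteDimensional ℝ E] (h : IsNearIdentity Θ x₀ r δ Λ)
    {a : E → Plane → V →L[ℝ] W} (ha : Continuous (Function.uncurry a)) [CompleteSpace W]
    {A : Plane → V} (hA : MemLp A 2 (volume.restrict (Metric.ball x₀ (2 * r))))
    {η : ℝ≥0∞} (hη : 0 < η) :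
    ∃ ε₀ > 0, ∀ ν : Measure E, IsProbabilityMeasure ν → (∀ᵐ v ∂ν, ‖v‖ ≤ ε₀) →
      eLpNorm (fun x => (∫ v, a v x (A (Θ v x)) ∂ν) - a 0 x (A x)) 2
        (volume.restrict (Metric.ball x₀ r)) ≤ η := by
  have := (ENNReal.tendsto_nhds_zero.1 (h.tendsto_eLpNorm_apply_comp_sub ha hA)) η hη
  obtain ⟨ε, hε, hεη⟩ := Metric.eventually_nhds_iff_ball.1 this
  have hδ := h.δ_pos
  refine ⟨min (ε / 2) (δ / 2), by positivity, fun ν _ hν => ?_⟩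
  have hlt : min (ε / 2) (δ / 2) < δ := (min_le_right _ _).trans_lt (half_lt_self hδ)
  have hL2 := h.memLp_uncurry hlt hν ha hA
  have := isFiniteMeasure_restrict_ball x₀ r
  have hint := (hL2.integrable one_le_two).prod_left_ae
  have hA2 : AEStronglyMeasurable A (volume.restrict (Metric.ball x₀ r)) :=
    hA.1.mono_measure
      (Measure.restrict_mono (Metric.ball_subset_ball (by linarith [h.r_pos])) le_rfl)
  have hm0 : AEStronglyMeasurable (fun x => a 0 x (A x)) (volume.restrict (Metric.ball x₀ r)) :=
    (isBoundedBilinearMap_apply (𝕜 := ℝ) (E := V) (F := W)).continuous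
      |>.comp_aestronglyMeasurable₂
        ((ha.comp (continuous_const.prodMk continuous_id)).aestronglyMeasurable) hA2
  have e : (fun x => (∫ v, a v x (A (Θ v x)) ∂ν) - a 0 x (A x))
      =ᵐ[volume.restrict (Metric.ball x₀ r)]
      fun x => ∫ v, (a v x (A (Θ v x)) - a 0 x (A x)) ∂ν := by
    filter_upwards [hint] with x hx
    have hx' : Integrable (fun v => a v x (A (Θ v x))) ν := hx
    rw [integral_sub hx' (integrable_const _)]
    simp
  rw [eLpNorm_congr_ae e]
  refine eLpNorm_integral_le (g := fun v x => a v x (A (Θ v x)) - a 0 x (A x)) ?_ ?_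
  · have := hL2.1.sub hm0.comp_snd
    exact this
  · filter_upwards [hν] with v hv
    refine hεη v ?_
    rw [mem_ball_zero_iff]
    exact hv.trans_lt ((min_le_left _ _).trans_lt (half_lt_self hε))

end IsNearIdentity
end NearIdentity

/-! ### Measures given by kernels -/

section MollifierMeasure

variable {E : Type*} [NormedAddCommGroup E] [MeasureSpace E] [BorelSpace E]
  {V : Type*} [NormedAddCommGroup V] [NormedSpace ℝ V]

/-- The measure with density `k` with respect to Lebesgue measure, for a nonnegative kernel `k`. -/
def kernelMeasure {E : Type*} [MeasureSpace E] (k : E → ℝ) : Measure E :=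
  volume.withDensity fun v => ENNReal.ofReal (k v)

theorem isProbabilityMeasure_kernelMeasure {E : Type*} [MeasureSpace E] {k : E → ℝ}
    (h0 : ∀ v, 0 ≤ k v) (h1 : ∫ v, k v = 1) : IsProbabilityMeasure (kernelMeasure k) := by
  have hi : Integrable k := by
    by_contra h
    rw [integral_undef h] at h1
    exact zero_ne_one h1
  refine ⟨?_⟩
  rw [kernelMeasure, withDensity_apply _ MeasurableSet.univ, Measure.restrict_univ,
    ← ofReal_integral_eq_lintegral_ofReal hi (Eventually.of_forall h0), h1, ENNReal.ofReal_one]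

theorem integral_kernelMeasure {k : E → ℝ} (hk : Continuous k) (h0 : ∀ v, 0 ≤ k v) (f : E → V) :
    ∫ v, f v ∂(kernelMeasure k) = ∫ v, k v • f v := by
  rw [kernelMeasure, integral_withDensity_eq_integral_toReal_smul
    hk.measurable.ennreal_ofReal (Eventually.of_forall fun _ => by simp)]
  simp [ENNReal.toReal_ofReal (h0 _)]

theorem ae_kernelMeasure {k : E → ℝ} (hk : Continuous k) {p : E → Prop}
    (h : ∀ v, k v ≠ 0 → p v) : ∀ᵐ v ∂(kernelMeasure k), p v := by
  rw [kernelMeasure, ae_withDensity_iff hk.measurable.ennreal_ofReal]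
  refine Eventually.of_forall fun v hv => h v fun h' => hv ?_
  simp [h']

end MollifierMeasure

/-! ### Approximation and translations in W^{1,2} -/

section Approximation

variable {V : Type*} [NormedAddCommGroup V] [NormedSpace ℝ V]

/-- The family of translations, for which the averages over the parameter are ordinary
mollifications. -/
theorem isNearIdentity_add (x₀ : Plane) {r : ℝ} (hr : 0 < r) :
    IsNearIdentity (fun v x : Plane => x + v) x₀ r r 1 where
  contDiff := contDiff_snd.add contDiff_fst
  r_pos := hr
  δ_pos := hr
  Λ_nonneg := zero_le_one
  mul_le := by simp
  zero x _ := add_zero x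
  dist_le v _ x _ := by simp [dist_eq_norm]
  fderiv_close v _ x _ := by
    rw [fderiv_add_const, fderiv_fun_id]; simp
  det_ge v _ x _ := by
    rw [fderiv_add_const, fderiv_fun_id]
    simp only [ContinuousLinearMap.det, ContinuousLinearMap.coe_id, LinearMap.det_id]
    norm_num

theorem lintegral_add_le (f : Plane → ℝ≥0∞) {s t : Set Plane} (hs : MeasurableSet s)
    (ht : MeasurableSet t) (c : Plane) (h : ∀ z ∈ s, z + c ∈ t) :
    ∫⁻ z in s, f (z + c) ≤ ∫⁻ z in t, f z := by
  rw [← lintegral_indicator hs, ← lintegral_indicator ht,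
    ← lintegral_add_right_eq_self (t.indicator f) c]
  refine lintegral_mono fun z => ?_
  by_cases hz : z ∈ s
  · rw [indicator_of_mem hz, indicator_of_mem (h z hz)]
  · rw [indicator_of_notMem hz]; exact zero_le

theorem eLpNorm_add_le_of_mapsTo {V : Type*} [NormedAddCommGroup V] (f : Plane → V)
    {s t : Set Plane} (hs : MeasurableSet s) (ht : MeasurableSet t) (c : Plane)
    (h : ∀ z ∈ s, z + c ∈ t) :
    eLpNorm (fun z => f (z + c)) 2 (volume.restrict s) ≤ eLpNorm f 2 (volume.restrict t) := by
  refine ENNReal.le_of_sq_le_sq ?_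
  rw [eLpNorm_two_sq, eLpNorm_two_sq]
  exact lintegral_add_le (fun z => ‖f z‖ₑ ^ 2) hs ht c h

theorem locallyIntegrableOn_add {V : Type*} [NormedAddCommGroup V] {A : Plane → V}
    {Ω Ω' : Set Plane} (hA : LocallyIntegrableOn A Ω) (c : Plane) (hc : ∀ z ∈ Ω', z + c ∈ Ω)
    (hΩ' : IsOpen Ω') : LocallyIntegrableOn (fun x => A (x + c)) Ω' := by
  rw [locallyIntegrableOn_iff hΩ'.isLocallyClosed]
  intro K hK hKc
  have hK2 : IsCompact ((fun z => z + c) '' K) := hKc.image (by fun_prop)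
  have h2 : IntegrableOn A ((fun z => z + c) '' K) :=
    hA.integrableOn_compact_subset (by rintro _ ⟨z, hz, rfl⟩; exact hc z (hK hz)) hK2
  have := ((measurePreserving_add_right (volume : Measure Plane) c).integrableOn_comp_preimage
    (f := A) (s := (fun z => z + c) '' K) (Homeomorph.addRight c).measurableEmbedding).2 h2
  rwa [preimage_image_eq _ (add_left_injective c)] at this

theorem HasWeakFDeriv.comp_add {A : Plane → V} {A' : Plane → Plane →L[ℝ] V} {Ω Ω' : Set Plane}
    (hA : HasWeakFDeriv Ω A A') (c : Plane) (hc : ∀ z ∈ Ω', z + c ∈ Ω)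
    (hΩ' : IsOpen Ω') : HasWeakFDeriv Ω' (fun x => A (x + c)) (fun x => A' (x + c)) := by
  refine ⟨locallyIntegrableOn_add hA.1 c hc hΩ', locallyIntegrableOn_add hA.2 c hc hΩ',
    fun η h1 h2 h3 v => ?_⟩
  have hts : tsupport (fun x => η (x - c)) ⊆ (fun z => z + c) '' tsupport η := by
    refine closure_minimal ?_ (h2.image (by fun_prop : Continuous fun z => z + c)).isClosed
    intro x hx
    exact ⟨x - c, subset_tsupport _ hx, by simp⟩
  have e := hA.3 (fun x => η (x - c)) (h1.comp (contDiff_id.sub contDiff_const))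
    (h2.comp_homeomorph (Homeomorph.subRight c))
    (hts.trans (by rintro _ ⟨z, hz, rfl⟩; exact hc z (h3 hz))) v
  rw [← integral_add_right_eq_self _ c,
    ← integral_add_right_eq_self (fun x => η (x - c) • A' x v) c] at e
  simpa [fderiv_comp_sub] using e

/-- Smooth maps are dense in `W^{1,2}`, locally. -/
theorem HasWeakFDeriv.exists_contDiff_approx [CompleteSpace V] {A : Plane → V}
    {A' : Plane → Plane →L[ℝ] V} {x₀ : Plane} {r : ℝ} (hr : 0 < r)
    (hA : HasWeakFDeriv (Metric.ball x₀ (2 * r)) A A')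
    (hA2 : MemLp A 2 (volume.restrict (Metric.ball x₀ (2 * r))))
    (hA'2 : MemLp A' 2 (volume.restrict (Metric.ball x₀ (2 * r)))) {η : ℝ≥0∞} (hη : 0 < η) :
    ∃ g : Plane → V, ContDiff ℝ ∞ g ∧
      eLpNorm (fun x => g x - A x) 2 (volume.restrict (Metric.ball x₀ r)) ≤ η ∧
      eLpNorm (fun x => fderiv ℝ g x - A' x) 2 (volume.restrict (Metric.ball x₀ r)) ≤ η := by
  have hΘ := isNearIdentity_add x₀ hr
  have := isFiniteMeasure_restrict_ball x₀ r
  have := isFiniteMeasure_restrict_ball x₀ (2 * r)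
  obtain ⟨ε₁, hε₁, h₁⟩ := hΘ.exists_eLpNorm_integral_sub_le
    (a := fun _ _ => ContinuousLinearMap.id ℝ V) continuous_const hA2 hη
  obtain ⟨ε₂, hε₂, h₂⟩ := hΘ.exists_eLpNorm_integral_sub_le
    (a := fun _ _ => ContinuousLinearMap.id ℝ (Plane →L[ℝ] V)) continuous_const hA'2 hη
  simp only [ContinuousLinearMap.id_apply] at h₁ h₂
  set ε := min (min ε₁ ε₂) (r / 2) with hε
  have hε0 : 0 < ε := by positivity
  have hεr : ε < r := (min_le_right _ _).trans_lt (half_lt_self hr)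
  let φ : ContDiffBump (0 : Plane) := ⟨ε / 2, ε, half_pos hε0, half_lt_self hε0⟩
  set ρ : Plane → ℝ := φ.normed volume with hρ
  have ρc : Continuous ρ := φ.continuous_normed
  have ρ0 : ∀ v, 0 ≤ ρ v := φ.nonneg_normed
  have hcs : HasCompactSupport ρ := φ.hasCompactSupport_normed
  have hsupp : ∀ v, ρ v ≠ 0 → ‖v‖ ≤ ε := by
    intro v hv
    have : v ∈ tsupport ρ := subset_tsupport _ hv
    rw [hρ, φ.tsupport_normed_eq] at this
    simpa using this
  have hprob := isProbabilityMeasure_kernelMeasure ρ0 φ.integral_normed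
  set ν := kernelMeasure ρ
  have hν : ∀ᵐ v ∂ν, ‖v‖ ≤ ε := ae_kernelMeasure ρc hsupp
  set B : Plane → V := (Metric.ball x₀ (2 * r)).indicator A with hB
  have hBi : Integrable B :=
    (integrable_indicator_iff Metric.isOpen_ball.measurableSet).2 (hA2.integrable one_le_two)
  set g := convolution ρ B (ContinuousLinearMap.lsmul ℝ ℝ) volume with hg
  have hgs : ContDiff ℝ ∞ g :=
    hcs.contDiff_convolution_left (n := ⊤) _ φ.contDiff_normed hBi.locallyIntegrable
  have hgA : ∀ x ∈ Metric.ball x₀ r, g x = ∫ v, A (x + v) ∂ν := by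
    intro x hx
    rw [integral_kernelMeasure ρc ρ0, hg, convolution_def,
      ← integral_neg_eq_self]
    refine integral_congr_ae (Eventually.of_forall fun v => ?_)
    simp only [sub_neg_eq_add, ContinuousLinearMap.lsmul_apply, hρ, φ.normed_neg]
    by_cases hv : ρ v = 0
    · rw [← hρ, hv, zero_smul, zero_smul]
    · rw [hB, indicator_of_mem]
      have h1 := hsupp v hv
      have h2 := norm_add_le (x - x₀) v
      rw [Metric.mem_ball, dist_eq_norm] at hx ⊢
      rw [show x + v - x₀ = x - x₀ + v by abel]
      linarith
  have hrest : ∀ {p : Plane → Prop}, (∀ x ∈ Metric.ball x₀ r, p x) →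
      ∀ᵐ x ∂(volume.restrict (Metric.ball x₀ r)), p x := fun h =>
    (ae_restrict_mem Metric.isOpen_ball.measurableSet).mono h
  have hw : HasWeakFDeriv (Metric.ball x₀ r) (fun x => ∫ v, A (x + v) ∂ν)
      (fun x => ∫ v, A' (x + v) ∂ν) := by
    refine hasWeakFDeriv_integral (g := fun v x => A (x + v)) (g' := fun v x => A' (x + v))
      Metric.isOpen_ball.measurableSet ?_ ?_ ?_
    · filter_upwards [hν] with v hv
      exact hA.comp_add v (fun z hz => hΘ.mapsTo (hv.trans_lt hεr) hz)
        Metric.isOpen_ball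
    · exact (hΘ.memLp_uncurry hεr hν (a := fun _ _ => ContinuousLinearMap.id ℝ V)
        continuous_const hA2).integrable one_le_two
    · exact (hΘ.memLp_uncurry hεr hν (a := fun _ _ => ContinuousLinearMap.id ℝ (Plane →L[ℝ] V))
        continuous_const hA'2).integrable one_le_two
  have hw' := hasWeakFDeriv_of_contDiffOn (Metric.isOpen_ball (x := x₀) (ε := r))
    (hgs.of_le (by simp)).contDiffOn
  have hfd := (hw'.congr Metric.isOpen_ball.measurableSet (hrest hgA) ae_eq_rfl).ae_eq
    Metric.isOpen_ball hw
  refine ⟨g, hgs, ?_, ?_⟩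
  · rw [eLpNorm_congr_ae (g := fun x => (∫ v, A (x + v) ∂ν) - A x)
      (hrest fun x hx => by simp only [hgA x hx])]
    exact h₁ ν hprob (hν.mono fun v hv => hv.trans ((min_le_left _ _).trans (min_le_left _ _)))
  · rw [eLpNorm_congr_ae (g := fun x => (∫ v, A' (x + v) ∂ν) - A' x)
      (hfd.mono fun x hx => by simp only [hx])]
    exact h₂ ν hprob (hν.mono fun v hv => hv.trans ((min_le_left _ _).trans (min_le_right _ _)))

/-- The difference quotient estimate in `W^{1,2}`. -/
theorem HasWeakFDeriv.eLpNorm_add_sub_le [CompleteSpace V] {A : Plane → V}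
    {A' : Plane → Plane →L[ℝ] V} {x₀ : Plane} {r : ℝ} (hr : 0 < r)
    (hA : HasWeakFDeriv (Metric.ball x₀ (2 * r)) A A')
    (hA2 : MemLp A 2 (volume.restrict (Metric.ball x₀ (2 * r))))
    (hA'2 : MemLp A' 2 (volume.restrict (Metric.ball x₀ (2 * r))))
    {x : Plane} {s : ℝ} {c : Plane} {t : Set Plane} (ht : MeasurableSet t)
    (htr : t ⊆ Metric.ball x₀ r)
    (hst : Metric.ball x (s + ‖c‖) ⊆ t) :
    eLpNorm (fun z => A (z + c) - A z) 2 (volume.restrict (Metric.ball x s)) ≤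
      ‖c‖ₑ * eLpNorm A' 2 (volume.restrict t) := by
  have hbm : ∀ y : Plane, ∀ q : ℝ, MeasurableSet (Metric.ball y q) :=
    fun y q => Metric.isOpen_ball.measurableSet
  have hmem : ∀ τ ∈ Icc (0 : ℝ) 1, ∀ z ∈ Metric.ball x s, z + τ • c ∈ t := by
    intro τ hτ z hz
    refine hst ?_
    rw [Metric.mem_ball, dist_eq_norm] at hz ⊢
    have h1 := norm_add_le (z - x) (τ • c)
    have h2 : ‖τ • c‖ ≤ ‖c‖ := by
      rw [norm_smul, Real.norm_of_nonneg hτ.1]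
      exact mul_le_of_le_one_left (norm_nonneg _) hτ.2
    rw [show z + τ • c - x = z - x + τ • c by abel]
    linarith
  have hmem1 : ∀ z ∈ Metric.ball x s, z + c ∈ t := fun z hz => by
    simpa using hmem 1 (by simp) z hz
  have hmem0 : Metric.ball x s ⊆ t := fun z hz => by simpa using hmem 0 (by simp) z hz
  -- the estimate for smooth maps, by averaging the derivative along segments
  have smooth : ∀ g : Plane → V, ContDiff ℝ ∞ g →
      eLpNorm (fun z => g (z + c) - g z) 2 (volume.restrict (Metric.ball x s)) ≤
        ‖c‖ₑ * eLpNorm (fderiv ℝ g) 2 (volume.restrict t) := by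
    intro g hg
    let ν : Measure ℝ := volume.restrict (Ioc 0 1)
    have : IsProbabilityMeasure ν := ⟨by simp [ν]⟩
    have hfc : Continuous (fderiv ℝ g) := hg.continuous_fderiv (by simp)
    have hc : Continuous (Function.uncurry fun (τ : ℝ) (z : Plane) =>
        fderiv ℝ g (z + τ • c) c) := by
      refine Continuous.clm_apply (hfc.comp ?_) continuous_const
      fun_prop
    have e : (fun z => g (z + c) - g z) = fun z => ∫ τ, fderiv ℝ g (z + τ • c) c ∂ν := by
      ext z
      have hd : ∀ τ ∈ uIcc (0 : ℝ) 1,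
          HasDerivAt (fun τ : ℝ => g (z + τ • c)) (fderiv ℝ g (z + τ • c) c) τ := by
        intro τ _
        have h1 := ((hg.differentiable (by simp)) (z + τ • c)).hasFDerivAt
        have h2 : HasDerivAt (fun τ : ℝ => z + τ • c) c τ := by
          simpa using ((hasDerivAt_id τ).smul_const c).const_add z
        exact h1.comp_hasDerivAt τ h2
      have hcz : Continuous fun τ : ℝ => fderiv ℝ g (z + τ • c) c :=
        hc.comp (continuous_id.prodMk continuous_const)
      have := intervalIntegral.integral_eq_sub_of_hasDerivAt hd
        (hcz.intervalIntegrable 0 1)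
      rw [intervalIntegral.integral_of_le zero_le_one] at this
      simp only [one_smul, zero_smul, add_zero] at this
      exact this.symm
    rw [e]
    refine eLpNorm_integral_le hc.aestronglyMeasurable ?_
    filter_upwards [ae_restrict_mem measurableSet_Ioc] with τ hτ
    have h1 : eLpNorm (fun z => fderiv ℝ g (z + τ • c) c) 2 (volume.restrict (Metric.ball x s)) ≤
        ENNReal.ofReal ‖c‖ * eLpNorm (fun z => fderiv ℝ g (z + τ • c)) 2
          (volume.restrict (Metric.ball x s)) := by
      refine eLpNorm_le_mul_eLpNorm_of_ae_le_mul (Eventually.of_forall fun z => ?_) 2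
      rw [mul_comm]
      exact ContinuousLinearMap.le_opNorm _ _
    refine h1.trans ?_
    rw [ofReal_norm]
    gcongr
    exact eLpNorm_add_le_of_mapsTo (fderiv ℝ g) (hbm _ _) ht _
      (hmem τ (Ioc_subset_Icc_self hτ))
  refine ENNReal.le_of_forall_pos_le_add fun η hη _ => ?_
  have hK : (0 : ℝ≥0∞) < (η : ℝ≥0∞) / (‖c‖ₑ + 2) :=
    ENNReal.div_pos (by simpa using hη.ne') (by simp)
  obtain ⟨g, hg, hg1, hg2⟩ := hA.exists_contDiff_approx hr hA2 hA'2 hK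
  set ζ := (η : ℝ≥0∞) / (‖c‖ₑ + 2) with hζ
  have hball : Metric.ball x₀ r ⊆ Metric.ball x₀ (2 * r) := Metric.ball_subset_ball (by linarith)
  have mt : ∀ {X : Type _} [NormedAddCommGroup X] {f : Plane → X},
      AEStronglyMeasurable f (volume.restrict (Metric.ball x₀ (2 * r))) →
      AEStronglyMeasurable f (volume.restrict t) := fun hf =>
    hf.mono_measure (Measure.restrict_mono (htr.trans hball) le_rfl)
  have mr : AEStronglyMeasurable (fun x => g x - A x) (volume.restrict t) :=
    hg.continuous.aestronglyMeasurable.sub (mt hA2.1)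
  have mA' : AEStronglyMeasurable A' (volume.restrict t) := mt hA'2.1
  have mg' : AEStronglyMeasurable (fun x => fderiv ℝ g x - A' x) (volume.restrict t) :=
    (hg.continuous_fderiv (by simp)).aestronglyMeasurable.sub mA'
  have bt : eLpNorm (fun x => g x - A x) 2 (volume.restrict t) ≤ ζ :=
    (eLpNorm_mono_measure _ (Measure.restrict_mono htr le_rfl)).trans hg1
  have b1 : eLpNorm (fun z => g (z + c) - A (z + c)) 2 (volume.restrict (Metric.ball x s)) ≤ ζ :=
    (eLpNorm_add_le_of_mapsTo (fun z => g z - A z) (hbm _ _) ht c hmem1).trans bt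
  have b2 : eLpNorm (fun z => g z - A z) 2 (volume.restrict (Metric.ball x s)) ≤ ζ :=
    (eLpNorm_mono_measure _ (Measure.restrict_mono hmem0 le_rfl)).trans bt
  have m1 : AEStronglyMeasurable (fun z => g (z + c) - A (z + c))
      (volume.restrict (Metric.ball x s)) := by
    have hqmp : Measure.QuasiMeasurePreserving (fun z : Plane => z + c)
        (volume.restrict (Metric.ball x s)) (volume.restrict t) := by
      refine ⟨(by fun_prop : Continuous fun z : Plane => z + c).measurable,
        Measure.AbsolutelyContinuous.mk fun u hu h0 => ?_⟩
      rw [Measure.map_apply (by fun_prop : Continuous fun z : Plane => z + c).measurable hu]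
      have := lintegral_add_le (u.indicator 1) (hbm x s) ht c hmem1
      rw [lintegral_indicator_one hu, h0] at this
      have e : (fun z => u.indicator (1 : Plane → ℝ≥0∞) (z + c))
        = ((fun z => z + c) ⁻¹' u).indicator 1 := rfl
      rw [e, lintegral_indicator_one
        ((by fun_prop : Continuous fun z : Plane => z + c).measurable hu)] at this
      exact le_antisymm this zero_le
    exact mr.comp_quasiMeasurePreserving hqmp
  have m2 : AEStronglyMeasurable (fun z => g z - A z) (volume.restrict (Metric.ball x s)) :=
    mr.mono_measure (Measure.restrict_mono hmem0 le_rfl)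
  have mg : AEStronglyMeasurable (fun z => g (z + c) - g z)
      (volume.restrict (Metric.ball x s)) :=
    ((hg.continuous.comp (by fun_prop)).sub hg.continuous).aestronglyMeasurable
  have split : (fun z => A (z + c) - A z) =
      ((fun z => g (z + c) - g z) - fun z => g (z + c) - A (z + c)) + fun z => g z - A z := by
    ext z; simp
  have split' : fderiv ℝ g = (fun z => fderiv ℝ g z - A' z) + A' := by
    ext1 z; simp
  have bg : eLpNorm (fderiv ℝ g) 2 (volume.restrict t) ≤ ζ + eLpNorm A' 2 (volume.restrict t) := by
    rw [split']
    refine (eLpNorm_add_le mg' mA' one_le_two).trans ?_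
    gcongr
    exact (eLpNorm_mono_measure _ (Measure.restrict_mono htr le_rfl)).trans hg2
  calc eLpNorm (fun z => A (z + c) - A z) 2 (volume.restrict (Metric.ball x s))
      ≤ (eLpNorm (fun z => g (z + c) - g z) 2 (volume.restrict (Metric.ball x s)) + ζ) + ζ := by
        rw [split]
        refine (eLpNorm_add_le (mg.sub m1) m2 one_le_two).trans ?_
        gcongr
        refine (eLpNorm_sub_le mg m1 one_le_two).trans ?_
        gcongr
    _ ≤ (‖c‖ₑ * (ζ + eLpNorm A' 2 (volume.restrict t)) + ζ) + ζ := by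
        gcongr
        exact (smooth g hg).trans (by gcongr)
    _ = ‖c‖ₑ * eLpNorm A' 2 (volume.restrict t) + (‖c‖ₑ + 2) * ζ := by ring
    _ ≤ ‖c‖ₑ * eLpNorm A' 2 (volume.restrict t) + η := by
        gcongr
        rw [hζ]
        exact ENNReal.mul_div_le

end Approximation

/-! ### The chain rule for averages -/

section ChainRule

variable {V W : Type*} [NormedAddCommGroup V] [NormedSpace ℝ V]
  [NormedAddCommGroup W] [NormedSpace ℝ W]
  {E : Type*} [NormedAddCommGroup E] [NormedSpace ℝ E]

/-- The coefficient of `A (Θ v x)` in the derivative of `x ↦ a v x (A (Θ v x))`. -/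
def derivCoeffZero (a : E → Plane → V →L[ℝ] W) (v : E) (x : Plane) : V →L[ℝ] Plane →L[ℝ] W :=
  (fderiv ℝ (a v) x).flip

/-- The coefficient of the derivative of `A` at `Θ v x` in the derivative of
`x ↦ a v x (A (Θ v x))`, as a linear operator on differentials. -/
def derivCoeffOne (a : E → Plane → V →L[ℝ] W) (Θ : E → Plane → Plane) (v : E) (x : Plane) :
    (Plane →L[ℝ] V) →L[ℝ] Plane →L[ℝ] W :=
  (ContinuousLinearMap.compL ℝ Plane V W (a v x)).comp
    ((ContinuousLinearMap.compL ℝ Plane Plane V).flip (fderiv ℝ (Θ v) x))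

theorem derivCoeffZero_apply {E : Type*} (a : E → Plane → V →L[ℝ] W) (v : E) (x : Plane) (y : V)
    (e : Plane) : derivCoeffZero a v x y e = fderiv ℝ (a v) x e y := rfl

theorem derivCoeffOne_apply {E : Type*} (a : E → Plane → V →L[ℝ] W) (Θ : E → Plane → Plane) (v : E)
    (x : Plane) (B : Plane →L[ℝ] V) :
    derivCoeffOne a Θ v x B = (a v x).comp (B.comp (fderiv ℝ (Θ v) x)) := rfl

theorem contDiff_fderiv_uncurry {F : Type*} [NormedAddCommGroup F] [NormedSpace ℝ F]
    {b : E → Plane → F} (hb : ContDiff ℝ ∞ (Function.uncurry b)) :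
    ContDiff ℝ ∞ (Function.uncurry fun v x => fderiv ℝ (b v) x) :=
  ContDiff.fderiv (𝕜 := ℝ) (f := fun z : E × Plane => b z.1) (g := fun z => z.2) (n := ∞) (m := ∞)
    (hb.comp ((contDiff_fst.comp contDiff_fst).prodMk contDiff_snd)) contDiff_snd (by simp)

theorem contDiff_derivCoeffZero {a : E → Plane → V →L[ℝ] W}
    (ha : ContDiff ℝ ∞ (Function.uncurry a)) :
    ContDiff ℝ ∞ (Function.uncurry (derivCoeffZero a)) :=
  have h : ContDiff ℝ ∞ fun B : Plane →L[ℝ] V →L[ℝ] W => B.flip :=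
    LinearIsometryEquiv.contDiff (𝕜 := ℝ) (E := Plane →L[ℝ] V →L[ℝ] W)
      (F := V →L[ℝ] Plane →L[ℝ] W) (ContinuousLinearMap.flipₗᵢ ℝ Plane V W)
  h.comp (contDiff_fderiv_uncurry ha)

theorem contDiff_derivCoeffOne {a : E → Plane → V →L[ℝ] W} {Θ : E → Plane → Plane}
    (ha : ContDiff ℝ ∞ (Function.uncurry a)) (hΘ : ContDiff ℝ ∞ (Function.uncurry Θ)) :
    ContDiff ℝ ∞ (Function.uncurry (derivCoeffOne a Θ)) := by
  have h1 : ContDiff ℝ ∞ fun B : V →L[ℝ] W => ContinuousLinearMap.compL ℝ Plane V W B := by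
    fun_prop
  have h2 : ContDiff ℝ ∞ fun B : Plane →L[ℝ] Plane =>
      (ContinuousLinearMap.compL ℝ Plane Plane V).flip B := by
    fun_prop
  exact (h1.comp ha).clm_comp (h2.comp (contDiff_fderiv_uncurry hΘ))

theorem lintegral_enorm_le_eLpNorm_two {V : Type*} [NormedAddCommGroup V] {f : Plane → V}
    {s : Set Plane} (hf : AEStronglyMeasurable f (volume.restrict s)) :
    ∫⁻ x in s, ‖f x‖ₑ ≤ eLpNorm f 2 (volume.restrict s) * volume s ^ (1 / 2 : ℝ) := by
  rw [← eLpNorm_one_eq_lintegral_enorm]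
  refine (eLpNorm_le_eLpNorm_mul_rpow_measure_univ one_le_two hf).trans (le_of_eq ?_)
  rw [Measure.restrict_apply_univ]
  congr 2
  norm_num

namespace IsNearIdentity

variable {Θ : E → Plane → Plane} {x₀ : Plane} {r δ Λ : ℝ}

theorem memLp_apply_comp (h : IsNearIdentity Θ x₀ r δ Λ) {v : E} (hv : ‖v‖ < δ)
    {a : E → Plane → V →L[ℝ] W} (ha : Continuous (Function.uncurry a)) {A : Plane → V}
    (hA : MemLp A 2 (volume.restrict (Metric.ball x₀ (2 * r)))) :
    MemLp (fun x => a v x (A (Θ v x))) 2 (volume.restrict (Metric.ball x₀ r)) := by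
  have hav : Continuous (a v) := ha.comp (continuous_const.prodMk continuous_id)
  obtain ⟨M, hM⟩ := (isCompact_closedBall x₀ r).exists_bound_of_continuousOn hav.continuousOn
  refine ⟨?_, (h.eLpNorm_apply_comp_le hv
    (fun x hx => hM x (Metric.ball_subset_closedBall hx)) A).trans_lt
    (ENNReal.mul_lt_top ENNReal.ofReal_lt_top (ENNReal.mul_lt_top (by simp) hA.2))⟩
  exact (isBoundedBilinearMap_apply (𝕜 := ℝ) (E := V) (F := W)).continuous
    |>.comp_aestronglyMeasurable₂ hav.aestronglyMeasurable
      (hA.1.comp_quasiMeasurePreserving (h.quasiMeasurePreserving hv))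

/-- The chain rule for the weak derivative of `x ↦ a v x (A (Θ v x))`, by approximation of `A` with
smooth maps. -/
theorem hasWeakFDeriv_apply_comp [CompleteSpace V] [CompleteSpace W]
    (h : IsNearIdentity Θ x₀ r δ Λ) {v : E} (hv : ‖v‖ < δ)
    {a : E → Plane → V →L[ℝ] W} (ha : ContDiff ℝ ∞ (Function.uncurry a))
    {A : Plane → V} {A' : Plane → Plane →L[ℝ] V}
    (hA : HasWeakFDeriv (Metric.ball x₀ (4 * r)) A A')
    (hA2 : MemLp A 2 (volume.restrict (Metric.ball x₀ (4 * r))))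
    (hA'2 : MemLp A' 2 (volume.restrict (Metric.ball x₀ (4 * r)))) :
    HasWeakFDeriv (Metric.ball x₀ r) (fun x => a v x (A (Θ v x)))
      (fun x => derivCoeffZero a v x (A (Θ v x)) + derivCoeffOne a Θ v x (A' (Θ v x))) := by
  have hr := h.r_pos
  have hsub : Metric.ball x₀ (2 * r) ⊆ Metric.ball x₀ (4 * r) :=
    Metric.ball_subset_ball (by linarith)
  have := isFiniteMeasure_restrict_ball x₀ r
  have hA2' : MemLp A 2 (volume.restrict (Metric.ball x₀ (2 * r))) :=
    hA2.mono_measure (Measure.restrict_mono hsub le_rfl)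
  have hA'2' : MemLp A' 2 (volume.restrict (Metric.ball x₀ (2 * r))) :=
    hA'2.mono_measure (Measure.restrict_mono hsub le_rfl)
  have ha0 := contDiff_derivCoeffZero ha
  have ha1 := contDiff_derivCoeffOne ha h.contDiff
  rw [show 4 * r = 2 * (2 * r) by ring] at hA hA2 hA'2
  choose g hg hg1 hg2 using fun k : ℕ => hA.exists_contDiff_approx (by positivity : 0 < 2 * r)
    hA2 hA'2 (η := ((k : ℝ≥0∞) + 1)⁻¹) (by simp)
  have hζ : Tendsto (fun k : ℕ => ((k : ℝ≥0∞) + 1)⁻¹) atTop (𝓝 0) := by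
    have := (tendsto_add_atTop_iff_nat 1).2 ENNReal.tendsto_inv_nat_nhds_zero
    simpa using this
  -- `L²` convergence of the approximations passes to the composed maps
  have lim : ∀ {X Y : Type _} [NormedAddCommGroup X] [NormedSpace ℝ X] [NormedAddCommGroup Y]
      [NormedSpace ℝ Y] {b : E → Plane → X →L[ℝ] Y} {B : Plane → X} {f : ℕ → Plane → X},
      Continuous (Function.uncurry b) → MemLp B 2 (volume.restrict (Metric.ball x₀ (2 * r))) →
      (∀ k, Continuous (f k)) →
      (∀ k : ℕ, eLpNorm (fun x => f k x - B x) 2 (volume.restrict (Metric.ball x₀ (2 * r))) ≤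
        ((k : ℝ≥0∞) + 1)⁻¹) →
      Tendsto (fun k => ∫⁻ x in Metric.ball x₀ r, ‖b v x (f k (Θ v x)) - b v x (B (Θ v x))‖ₑ)
        atTop (𝓝 0) := by
    intro X Y _ _ _ _ b B f hb hB hf hfB
    have hbv : Continuous (b v) := hb.comp (continuous_const.prodMk continuous_id)
    obtain ⟨M, hM⟩ := (isCompact_closedBall x₀ r).exists_bound_of_continuousOn hbv.continuousOn
    have hmem : ∀ k, AEStronglyMeasurable
        (fun x => b v x (f k (Θ v x)) - b v x (B (Θ v x))) (volume.restrict (Metric.ball x₀ r)) :=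
      fun k => ((hbv.clm_apply
        ((hf k).comp (h.contDiff_apply v).continuous)).aestronglyMeasurable).sub
        (h.memLp_apply_comp hv hb hB).1
    have hb : ∀ k, ∫⁻ x in Metric.ball x₀ r, ‖b v x (f k (Θ v x)) - b v x (B (Θ v x))‖ₑ ≤
        ENNReal.ofReal M * (2 * ((k : ℝ≥0∞) + 1)⁻¹) *
          volume (Metric.ball x₀ r) ^ (1 / 2 : ℝ) := by
      intro k
      refine (lintegral_enorm_le_eLpNorm_two (hmem k)).trans ?_
      gcongr
      have := h.eLpNorm_apply_comp_le hv
        (fun x hx => hM x (Metric.ball_subset_closedBall hx)) (fun x => f k x - B x)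
      simp only [map_sub] at this
      refine this.trans ?_
      gcongr
      exact hfB k
    refine tendsto_of_tendsto_of_tendsto_of_le_of_le tendsto_const_nhds ?_ (fun _ => zero_le) hb
    have h2 := ENNReal.Tendsto.const_mul (a := 2) hζ (Or.inr (by simp))
    have h3 := ENNReal.Tendsto.const_mul (a := ENNReal.ofReal M) h2 (Or.inr (by simp))
    have h4 := ENNReal.Tendsto.mul_const (b := volume (Metric.ball x₀ r) ^ (1 / 2 : ℝ)) h3
      (Or.inr (ENNReal.rpow_ne_top_of_nonneg (by positivity) measure_ball_lt_top.ne))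
    simpa using h4
  have i1 := (h.memLp_apply_comp hv ha.continuous hA2').integrable one_le_two
  have i2 := (h.memLp_apply_comp hv ha0.continuous hA2').integrable one_le_two
  have i3 := (h.memLp_apply_comp hv ha1.continuous hA'2').integrable one_le_two
  have i23 : IntegrableOn
      (fun x => derivCoeffZero a v x (A (Θ v x)) + derivCoeffOne a Θ v x (A' (Θ v x)))
      (Metric.ball x₀ r) := i2.add i3
  have i1' : IntegrableOn (fun x => a v x (A (Θ v x))) (Metric.ball x₀ r) := i1
  have hfd : ∀ k, Continuous (fderiv ℝ (g k)) := fun k => (hg k).continuous_fderiv (by simp)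
  refine hasWeakFDeriv_of_tendsto Metric.isOpen_ball.measurableSet
    (u := fun k x => a v x (g k (Θ v x)))
    (G := fun k x => derivCoeffZero a v x (g k (Θ v x)) +
      derivCoeffOne a Θ v x (fderiv ℝ (g k) (Θ v x)))
    (fun k => ?_) i1'.locallyIntegrableOn i23.locallyIntegrableOn
    (lim ha.continuous hA2' (fun k => (hg k).continuous) hg1) ?_
  · have hav : ContDiff ℝ ∞ (a v) := ha.comp (contDiff_const.prodMk contDiff_id)
    have hcd : ContDiff ℝ ∞ fun x => a v x (g k (Θ v x)) :=
      hav.clm_apply ((hg k).comp (h.contDiff_apply v))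
    have e : (fun x => derivCoeffZero a v x (g k (Θ v x)) +
        derivCoeffOne a Θ v x (fderiv ℝ (g k) (Θ v x)))
        = fderiv ℝ fun x => a v x (g k (Θ v x)) := by
      ext1 x
      have d1 := (hav.differentiable (by simp) x).hasFDerivAt
      have d2 := ((hg k).differentiable (by simp) (Θ v x)).hasFDerivAt.comp x
        ((h.contDiff_apply v).differentiable (by simp) x).hasFDerivAt
      have d3 : HasFDerivAt (fun x => a v x (g k (Θ v x))) _ x := d1.clm_apply d2
      rw [d3.fderiv, add_comm]
      rfl
    rw [e]
    exact hasWeakFDeriv_of_contDiffOn Metric.isOpen_ball (hcd.of_le (by simp)).contDiffOn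
  · have l2 := lim ha0.continuous hA2' (fun k => (hg k).continuous) hg1
    have l3 := lim ha1.continuous hA'2' hfd hg2
    have l23 := l2.add l3
    rw [add_zero] at l23
    refine tendsto_of_tendsto_of_tendsto_of_le_of_le tendsto_const_nhds l23
      (fun _ => zero_le) fun k => ?_
    rw [← lintegral_add_left']
    · refine lintegral_mono fun x => ?_
      rw [add_sub_add_comm]
      exact enorm_add_le _ _
    · refine AEStronglyMeasurable.enorm (AEStronglyMeasurable.sub ?_ i2.1)
      exact Continuous.aestronglyMeasurable
        ((ha0.continuous.comp (continuous_const.prodMk continuous_id)).clm_apply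
          ((hg k).continuous.comp (h.contDiff_apply v).continuous))

/-- The weak derivative of the averages of `x ↦ a v x (A (Θ v x))`. -/
theorem hasWeakFDeriv_integral_apply_comp [CompleteSpace V] [CompleteSpace W]
    [FiniteDimensional ℝ E] [MeasurableSpace E] [BorelSpace E]
    (h : IsNearIdentity Θ x₀ r δ Λ) {ν : Measure E} [IsProbabilityMeasure ν] {δ' : ℝ}
    (hδ : δ' < δ) (hν : ∀ᵐ v ∂ν, ‖v‖ ≤ δ')
    {a : E → Plane → V →L[ℝ] W} (ha : ContDiff ℝ ∞ (Function.uncurry a))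
    {A : Plane → V} {A' : Plane → Plane →L[ℝ] V}
    (hA : HasWeakFDeriv (Metric.ball x₀ (4 * r)) A A')
    (hA2 : MemLp A 2 (volume.restrict (Metric.ball x₀ (4 * r))))
    (hA'2 : MemLp A' 2 (volume.restrict (Metric.ball x₀ (4 * r)))) :
    HasWeakFDeriv (Metric.ball x₀ r) (fun x => ∫ v, a v x (A (Θ v x)) ∂ν)
      (fun x => (∫ v, derivCoeffZero a v x (A (Θ v x)) ∂ν) +
        ∫ v, derivCoeffOne a Θ v x (A' (Θ v x)) ∂ν) := by
  have hr := h.r_pos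
  have hsub : Metric.ball x₀ (2 * r) ⊆ Metric.ball x₀ (4 * r) :=
    Metric.ball_subset_ball (by linarith)
  have := isFiniteMeasure_restrict_ball x₀ r
  have hA2' : MemLp A 2 (volume.restrict (Metric.ball x₀ (2 * r))) :=
    hA2.mono_measure (Measure.restrict_mono hsub le_rfl)
  have hA'2' : MemLp A' 2 (volume.restrict (Metric.ball x₀ (2 * r))) :=
    hA'2.mono_measure (Measure.restrict_mono hsub le_rfl)
  have i1 := (h.memLp_uncurry hδ hν ha.continuous hA2').integrable one_le_two
  have i2 := (h.memLp_uncurry hδ hν (contDiff_derivCoeffZero ha).continuous hA2').integrable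
    one_le_two
  have i3 := (h.memLp_uncurry hδ hν (contDiff_derivCoeffOne ha h.contDiff).continuous
    hA'2').integrable one_le_two
  have key := hasWeakFDeriv_integral (ν := ν) (Ω := Metric.ball x₀ r)
    (g := fun v x => a v x (A (Θ v x)))
    (g' := fun v x => derivCoeffZero a v x (A (Θ v x)) + derivCoeffOne a Θ v x (A' (Θ v x)))
    Metric.isOpen_ball.measurableSet
    (hν.mono fun v hv => h.hasWeakFDeriv_apply_comp (hv.trans_lt hδ) ha hA hA2 hA'2)
    i1 (i2.add i3)
  refine key.congr Metric.isOpen_ball.measurableSet ae_eq_rfl ?_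
  filter_upwards [i2.prod_left_ae, i3.prod_left_ae] with x h2 h3
  exact integral_add h2 h3

end IsNearIdentity
end ChainRule

/-! ### Families of the form Q(p(x) + v) -/

section LocalParametrization

variable {E : Type*} [NormedAddCommGroup E] [NormedSpace ℝ E]

/-- A smooth family of maps which is the identity near `x₀` for the parameter `0` is close to the
identity on small balls. -/
theorem exists_isNearIdentity {Θ : E → Plane → Plane} (hΘ : ContDiff ℝ ∞ (Function.uncurry Θ))
    {x₀ : Plane} (h0 : ∀ᶠ x in 𝓝 x₀, Θ 0 x = x) :
    ∃ r₀ > 0, ∃ Λ, ∀ r, 0 < r → r ≤ r₀ → ∃ δ, IsNearIdentity Θ x₀ r δ Λ := by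
  have hD := (contDiff_fderiv_uncurry hΘ).continuous
  have hD0 : fderiv ℝ (Θ 0) x₀ = ContinuousLinearMap.id ℝ Plane := by
    have : Θ 0 =ᶠ[𝓝 x₀] id := h0
    rw [this.fderiv_eq, fderiv_id]
  have e1 : ∀ᶠ z : E × Plane in 𝓝 (0, x₀),
      ‖fderiv ℝ (Θ z.1) z.2 - ContinuousLinearMap.id ℝ Plane‖ < 1 / 2 := by
    have c : Continuous fun z : E × Plane =>
        ‖fderiv ℝ (Θ z.1) z.2 - ContinuousLinearMap.id ℝ Plane‖ :=
      (hD.sub continuous_const).norm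
    refine (c.tendsto _).eventually_lt_const ?_
    simp [hD0]
  have e2 : ∀ᶠ z : E × Plane in 𝓝 (0, x₀), 1 / 2 < |(fderiv ℝ (Θ z.1) z.2).det| := by
    have c : Continuous fun z : E × Plane => |(fderiv ℝ (Θ z.1) z.2).det| :=
      (ContinuousLinearMap.continuous_det.comp hD).abs
    refine (c.tendsto _).eventually_const_lt ?_
    simp only [hD0, ContinuousLinearMap.det, ContinuousLinearMap.coe_id, LinearMap.det_id]
    norm_num
  obtain ⟨K, t, ht, hK⟩ :=
    ((hΘ.of_le (by simp)).contDiffAt (x := ((0 : E), x₀))).exists_lipschitzOnWith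
  obtain ⟨ρ, hρ, hball⟩ := Metric.eventually_nhds_iff_ball.1 ((e1.and e2).and ht)
  obtain ⟨ρ', hρ', hball'⟩ := Metric.eventually_nhds_iff_ball.1 h0
  have hmem : ∀ v : E, ‖v‖ < ρ → ∀ x ∈ Metric.ball x₀ ρ, (v, x) ∈ Metric.ball ((0 : E), x₀) ρ := by
    intro v hv x hx
    rw [← ball_prod_same]
    exact ⟨by simpa using hv, hx⟩
  refine ⟨min ρ ρ', lt_min hρ hρ', K, fun r hr hr0 => ?_⟩
  have hrρ : Metric.ball x₀ r ⊆ Metric.ball x₀ ρ :=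
    Metric.ball_subset_ball (hr0.trans (min_le_left _ _))
  have hrρ' : Metric.ball x₀ r ⊆ Metric.ball x₀ ρ' :=
    Metric.ball_subset_ball (hr0.trans (min_le_right _ _))
  have hK1 : (0 : ℝ) < K + 1 := by positivity
  have hlt : ∀ v : E, ‖v‖ < min ρ (r / (K + 1)) → ‖v‖ < ρ := fun v hv =>
    hv.trans_le (min_le_left _ _)
  refine ⟨min ρ (r / (K + 1)), hΘ, hr, lt_min hρ (div_pos hr hK1), K.2, ?_,
    fun x hx => hball' x (hrρ' hx), ?_, ?_, ?_⟩
  · calc (K : ℝ) * min ρ (r / (K + 1)) ≤ (K + 1) * (r / (K + 1)) := by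
          gcongr
          · linarith
          · exact min_le_right _ _
      _ = r := by field_simp
  · intro v hv x hx
    have h1 := hK.dist_le_mul _ (hball _ (hmem v (hlt v hv) x (hrρ hx))).2 _
      (hball _ (hmem 0 (by simpa using hρ) x (hrρ hx))).2
    simp only [Function.uncurry_apply_pair] at h1
    rw [hball' x (hrρ' hx)] at h1
    simpa [Prod.dist_eq] using h1
  · intro v hv x hx
    exact (hball _ (hmem v (hlt v hv) x (hrρ hx))).1.1.le
  · intro v hv x hx
    exact (hball _ (hmem v (hlt v hv) x (hrρ hx))).1.2.le

theorem exists_dist_le_mul_of_contDiff {p : Plane → E} (hp : ContDiff ℝ ∞ p) (x₀ : Plane) (r : ℝ) :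
    ∃ L : ℝ, 1 ≤ L ∧ ∀ x ∈ Metric.ball x₀ r, ∀ y ∈ Metric.ball x₀ r,
      dist (p x) (p y) ≤ L * dist x y := by
  obtain ⟨K, hK⟩ := (isCompact_closedBall x₀ r).exists_bound_of_continuousOn
    (hp.continuous_fderiv (by simp)).continuousOn
  refine ⟨max K 1, le_max_right _ _, fun x hx y hy => ?_⟩
  rw [dist_eq_norm, dist_eq_norm]
  exact (convex_ball x₀ r).norm_image_sub_le_of_norm_fderiv_le
    (fun z _ => hp.differentiable (by simp) z)
    (fun z hz => (hK z (Metric.ball_subset_closedBall hz)).trans (le_max_left _ _)) hy hx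

variable [FiniteDimensional ℝ E] [MeasureSpace E] [BorelSpace E]
  [(volume : Measure E).IsAddHaarMeasure]

/-- A substitute for the coarea formula. If `Θ v x = Q (p x + v)`, the integral of `f (Θ v x)` over
a ball of parameters is controlled by the integral of `f` over a ball of the plane: the ball of
radius `ε` about `p x` lies in the ball of radius `2 ε` about `p x'` for all `x'` near `x`, and for
each fixed `v` the average over `x'` is estimated by a change of variables in the plane. -/
theorem IsNearIdentity.lintegral_parameter_le {p : Plane → E} {Q : E → Plane} {x₀ : Plane}
    {r δ Λ L : ℝ} (h : IsNearIdentity (fun v x => Q (p x + v)) x₀ r δ Λ) (hL : 1 ≤ L)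
    (hp : ∀ x ∈ Metric.ball x₀ r, ∀ y ∈ Metric.ball x₀ r, dist (p x) (p y) ≤ L * dist x y)
    {ε : ℝ} (hε : 0 < ε) (hεδ : 2 * ε ≤ δ) (hεr : ε ≤ r / 2) {x : Plane}
    (hx : x ∈ Metric.ball x₀ (r / 2)) {f : Plane → ℝ≥0∞} (hf : Measurable f) :
    volume (Metric.ball x (ε / L)) * ∫⁻ v in Metric.ball (0 : E) ε, f (Q (p x + v)) ≤
      volume (Metric.ball (0 : E) (2 * ε)) *
        (2 * ∫⁻ y in Metric.ball x ((1 + 2 * Λ) * ε), f y) := by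
  have := FiniteDimensional.proper ℝ E
  have hL0 : 0 < L := by linarith
  have hεL : ε / L ≤ ε := div_le_self hε.le hL
  have hsub : Metric.ball x (ε / L) ⊆ Metric.ball x₀ r := by
    refine Metric.ball_subset_ball' ?_
    rw [Metric.mem_ball] at hx
    linarith
  have hxr : x ∈ Metric.ball x₀ r := Metric.ball_subset_ball (by linarith [h.r_pos]) hx
  have hmeas : Measurable fun z : E × Plane => f (Q (p z.2 + z.1)) :=
    hf.comp h.contDiff.continuous.measurable
  have step1 : ∀ x' ∈ Metric.ball x (ε / L),
      ∫⁻ v in Metric.ball (0 : E) ε, f (Q (p x + v)) ≤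
        ∫⁻ v in Metric.ball (0 : E) (2 * ε), f (Q (p x' + v)) := by
    intro x' hx'
    have hb : ∀ (s : ℝ) (y : Plane), ∫⁻ v in Metric.ball (0 : E) s, f (Q (p y + v)) =
        ∫⁻ w, (Metric.ball (p y) s).indicator (fun w => f (Q w)) w := by
      intro s y
      rw [← lintegral_indicator Metric.isOpen_ball.measurableSet,
        ← lintegral_add_left_eq_self
          (fun w => (Metric.ball (p y) s).indicator (fun w => f (Q w)) w) (p y)]
      refine lintegral_congr fun v => ?_
      simp [indicator]
    rw [hb, hb]
    refine lintegral_mono fun w => indicator_le_indicator_of_subset ?_ (fun _ => zero_le) w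
    refine Metric.ball_subset_ball' ?_
    have h1 := hp x hxr x' (hsub hx')
    rw [dist_comm x x'] at h1
    have h2 : L * dist x' x ≤ ε := by
      rw [Metric.mem_ball, lt_div_iff₀ hL0] at hx'
      linarith
    linarith
  calc volume (Metric.ball x (ε / L)) * ∫⁻ v in Metric.ball (0 : E) ε, f (Q (p x + v))
      = ∫⁻ _ in Metric.ball x (ε / L), ∫⁻ v in Metric.ball (0 : E) ε, f (Q (p x + v)) := by
        rw [setLIntegral_const, mul_comm]
    _ ≤ ∫⁻ x' in Metric.ball x (ε / L), ∫⁻ v in Metric.ball (0 : E) (2 * ε),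
          f (Q (p x' + v)) :=
        setLIntegral_mono' Metric.isOpen_ball.measurableSet step1
    _ = ∫⁻ v in Metric.ball (0 : E) (2 * ε), ∫⁻ x' in Metric.ball x (ε / L),
          f (Q (p x' + v)) :=
        lintegral_lintegral_swap (hmeas.comp measurable_swap).aemeasurable
    _ ≤ ∫⁻ _ in Metric.ball (0 : E) (2 * ε),
          2 * ∫⁻ y in Metric.ball x ((1 + 2 * Λ) * ε), f y := by
        refine setLIntegral_mono' Metric.isOpen_ball.measurableSet fun v hv => ?_
        have hv' : ‖v‖ < 2 * ε := by simpa using hv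
        refine h.lintegral_comp_le (hv'.trans_le hεδ) Metric.isOpen_ball.measurableSet hsub ?_ f
        intro y hy
        have h1 := h.dist_le v (hv'.trans_le hεδ) y (hsub hy)
        have h2 : Λ * ‖v‖ ≤ Λ * (2 * ε) := mul_le_mul_of_nonneg_left hv'.le h.Λ_nonneg
        have h3 := dist_triangle (Q (p y + v)) y x
        rw [Metric.mem_ball] at hy ⊢
        linarith
    _ = _ := by rw [setLIntegral_const, mul_comm]

/-- The distribution of `Θ v x = Q (p x + v)` has a density of order at most `ε⁻²` on a ball of
radius of order `ε`, if `v` is distributed according to a kernel at scale `ε`. -/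
theorem IsNearIdentity.exists_lintegral_kernelMeasure_le {p : Plane → E} {Q : E → Plane}
    {x₀ : Plane} {r δ Λ : ℝ} (h : IsNearIdentity (fun v x => Q (p x + v)) x₀ r δ Λ)
    (hp : ContDiff ℝ ∞ p) (M : ℝ) :
    ∃ C : ℝ≥0∞, C ≠ ⊤ ∧ ∃ κ > 0, ∃ ε₀ > 0, ∀ ε, 0 < ε → ε ≤ ε₀ → ∀ k : E → ℝ, Continuous k →
      (∀ v, k v ≤ M * (ε ^ Module.finrank ℝ E)⁻¹) → (∀ v, k v ≠ 0 → ‖v‖ ≤ ε) →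
      ∀ x ∈ Metric.ball x₀ (r / 2), ∀ f : Plane → ℝ≥0∞, Measurable f →
        ∫⁻ v, f (Q (p x + v)) ∂(kernelMeasure k) ≤
          C * (ENNReal.ofReal (ε ^ 2))⁻¹ * ∫⁻ y in Metric.ball x (κ * ε), f y := by
  have := FiniteDimensional.proper ℝ E
  have hr := h.r_pos
  have hδ := h.δ_pos
  have hΛ := h.Λ_nonneg
  set m := Module.finrank ℝ E with hm
  obtain ⟨L, hL1, hL⟩ := exists_dist_le_mul_of_contDiff hp x₀ r
  have hL0 : 0 < L := by linarith
  set c₂ := volume (Metric.ball (0 : Plane) 1) with hc₂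
  set cm := volume (Metric.ball (0 : E) 1) with hcm
  have hc₂0 : c₂ ≠ 0 := (Metric.measure_ball_pos _ _ one_pos).ne'
  have hc₂t : c₂ ≠ ⊤ := measure_ball_lt_top.ne
  have hcmt : cm ≠ ⊤ := measure_ball_lt_top.ne
  have hfr : Module.finrank ℝ Plane = 2 := by simp
  set a := ENNReal.ofReal ((2 / L) ^ 2) * c₂ with ha
  have ha0 : a ≠ 0 := mul_ne_zero (by simpa using by positivity) hc₂0
  have hat : a ≠ ⊤ := ENNReal.mul_ne_top ENNReal.ofReal_ne_top hc₂t
  refine ⟨a⁻¹ * (ENNReal.ofReal (M * 4 ^ m) * cm * 2), ?_, (1 + 2 * Λ) * 2, by positivity,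
    min (δ / 4) (r / 4), by positivity, fun ε hε hε0 k hk hkM hks x hx f hf => ?_⟩
  · exact ENNReal.mul_ne_top (ENNReal.inv_ne_top.2 ha0) (ENNReal.mul_ne_top
      (ENNReal.mul_ne_top ENNReal.ofReal_ne_top hcmt) (by simp))
  have h1 := h.lintegral_parameter_le hL1 hL (ε := 2 * ε) (by positivity)
    (by linarith [hε0.trans (min_le_left _ _)]) (by linarith [hε0.trans (min_le_right _ _)]) hx hf
  set I := ∫⁻ y in Metric.ball x ((1 + 2 * Λ) * 2 * ε), f y with hI
  rw [show (1 + 2 * Λ) * (2 * ε) = (1 + 2 * Λ) * 2 * ε by ring, ← hI] at h1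
  set J := ∫⁻ v in Metric.ball (0 : E) (2 * ε), f (Q (p x + v)) with hJ
  have h2 : ∫⁻ v, f (Q (p x + v)) ∂(kernelMeasure k) ≤
      ENNReal.ofReal (M * (ε ^ m)⁻¹) * J := by
    have hmf : Measurable fun v : E => f (Q (p x + v)) := hf.comp
      (h.contDiff.continuous.comp (continuous_id.prodMk continuous_const)).measurable
    rw [kernelMeasure, lintegral_withDensity_eq_lintegral_mul _ hk.measurable.ennreal_ofReal hmf,
      hJ, ← lintegral_const_mul _ hmf, ← lintegral_indicator Metric.isOpen_ball.measurableSet]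
    refine lintegral_mono fun v => ?_
    by_cases hv : k v = 0
    · simp [hv]
    · have hv' : v ∈ Metric.ball (0 : E) (2 * ε) := by
        rw [mem_ball_zero_iff]; linarith [hks v hv]
      rw [indicator_of_mem hv']
      simp only [Pi.mul_apply]
      gcongr
      exact hkM v
  have v2 : volume (Metric.ball x (2 * ε / L)) = ENNReal.ofReal (ε ^ 2) * a := by
    rw [Measure.addHaar_ball_of_pos _ _ (by positivity), hfr, ha, ← mul_assoc,
      ← ENNReal.ofReal_mul (by positivity)]
    congr 2
    ring
  have vm : volume (Metric.ball (0 : E) (2 * (2 * ε))) =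
      ENNReal.ofReal ((4 * ε) ^ m) * cm := by
    rw [Measure.addHaar_ball_of_pos _ _ (by positivity), ← hm]
    congr 3
    ring
  rw [v2, vm] at h1
  have he0 : ENNReal.ofReal (ε ^ 2) ≠ 0 := by simpa using by positivity
  have het : ENNReal.ofReal (ε ^ 2) ≠ ⊤ := ENNReal.ofReal_ne_top
  have h3 : J ≤ (ENNReal.ofReal (ε ^ 2) * a)⁻¹ *
      (ENNReal.ofReal ((4 * ε) ^ m) * cm * (2 * I)) := by
    rw [← ENNReal.mul_le_iff_le_inv (mul_ne_zero he0 ha0) (ENNReal.mul_ne_top het hat)]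
    exact h1
  refine h2.trans ?_
  calc ENNReal.ofReal (M * (ε ^ m)⁻¹) * J
      ≤ ENNReal.ofReal (M * (ε ^ m)⁻¹) * ((ENNReal.ofReal (ε ^ 2) * a)⁻¹ *
          (ENNReal.ofReal ((4 * ε) ^ m) * cm * (2 * I))) := by gcongr
    _ = (ENNReal.ofReal (M * (ε ^ m)⁻¹) * ENNReal.ofReal ((4 * ε) ^ m)) *
        ((ENNReal.ofReal (ε ^ 2))⁻¹ * a⁻¹ * (cm * (2 * I))) := by
        rw [ENNReal.mul_inv (Or.inl he0) (Or.inl het)]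
        ring
    _ = ENNReal.ofReal (M * 4 ^ m) *
        ((ENNReal.ofReal (ε ^ 2))⁻¹ * a⁻¹ * (cm * (2 * I))) := by
        rw [← ENNReal.ofReal_mul' (by positivity)]
        congr 2
        rw [mul_pow]
        field_simp
    _ = _ := by ring

end LocalParametrization

/-! ### Lower bound for averaged differentials -/

section LowerBound

variable {V : Type*} [NormedAddCommGroup V] [NormedSpace ℝ V] [CompleteSpace V]

/-- On a ball of radius `ρ`, the values of a `W^{1,2}` map deviate from its value at a suitable
point of the ball by at most a constant times the `L²` norm of its derivative on the ball of radius
`3 ρ`, in quadratic mean. The point can be chosen outside any given null set. -/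
theorem HasWeakFDeriv.exists_lintegral_sub_sq_le {A : Plane → V} (hAm : StronglyMeasurable A)
    {A' : Plane → Plane →L[ℝ] V} {x₀ : Plane} {r : ℝ} (hr : 0 < r)
    (hA : HasWeakFDeriv (Metric.ball x₀ (2 * r)) A A')
    (hA2 : MemLp A 2 (volume.restrict (Metric.ball x₀ (2 * r))))
    (hA'2 : MemLp A' 2 (volume.restrict (Metric.ball x₀ (2 * r))))
    {x : Plane} {ρ : ℝ} (hρ : 0 < ρ) (hx : Metric.ball x (3 * ρ) ⊆ Metric.ball x₀ r)
    {P : Plane → Prop} (hP : ∀ᵐ y ∂(volume.restrict (Metric.ball x ρ)), P y) :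
    ∃ y ∈ Metric.ball x ρ, P y ∧ ∫⁻ z in Metric.ball x ρ, ‖A z - A y‖ₑ ^ 2 ≤
      16 * ENNReal.ofReal (ρ ^ 2) * eLpNorm A' 2 (volume.restrict (Metric.ball x (3 * ρ))) ^ 2 := by
  set μ := volume.restrict (Metric.ball x ρ) with hμ
  set S := eLpNorm A' 2 (volume.restrict (Metric.ball x (3 * ρ))) with hS
  have hbm : ∀ (y : Plane) (s : ℝ), MeasurableSet (Metric.ball y s) :=
    fun y s => Metric.isOpen_ball.measurableSet
  have hfin := isFiniteMeasure_restrict_ball x ρ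
  have hvol0 : volume (Metric.ball x ρ) ≠ 0 := (Metric.measure_ball_pos _ _ hρ).ne'
  have hvolt : volume (Metric.ball x ρ) ≠ ⊤ := measure_ball_lt_top.ne
  have hμ0 : μ ≠ 0 := by
    rw [hμ, Ne, Measure.restrict_eq_zero]
    exact hvol0
  have hm2 : Measurable fun z : Plane × Plane => ‖A z.2 - A z.1‖ₑ ^ 2 :=
    (((hAm.comp_measurable measurable_snd).sub
      (hAm.comp_measurable measurable_fst)).enorm).pow_const 2
  have hmf : AEMeasurable (fun y => ∫⁻ z, ‖A z - A y‖ₑ ^ 2 ∂μ) μ :=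
    (hm2.lintegral_prod_right' (ν := μ)).aemeasurable
  have hN : μ {y | ¬ (y ∈ Metric.ball x ρ ∧ P y)} = 0 :=
    ae_iff.1 ((ae_restrict_mem (hbm x ρ)).and hP)
  obtain ⟨y, hy, hyle⟩ := exists_notMem_null_le_laverage hμ0 hmf hN
  rw [mem_ofPred_eq, not_not] at hy
  refine ⟨y, hy.1, hy.2, hyle.trans ?_⟩
  -- the average over the point is estimated by the translation estimate in `W^{1,2}`
  have total : ∫⁻ y, ∫⁻ z, ‖A z - A y‖ₑ ^ 2 ∂μ ∂μ ≤
      volume (Metric.ball (0 : Plane) (2 * ρ)) * (ENNReal.ofReal (2 * ρ) ^ 2 * S ^ 2) := by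
    have hm3 : Measurable fun z : Plane × Plane => ‖A (z.1 + z.2) - A z.1‖ₑ ^ 2 :=
      (((hAm.comp_measurable (measurable_fst.add measurable_snd)).sub
        (hAm.comp_measurable measurable_fst)).enorm).pow_const 2
    calc ∫⁻ y, ∫⁻ z, ‖A z - A y‖ₑ ^ 2 ∂μ ∂μ
        ≤ ∫⁻ y, (∫⁻ c in Metric.ball (0 : Plane) (2 * ρ), ‖A (y + c) - A y‖ₑ ^ 2) ∂μ := by
          refine setLIntegral_mono' (hbm x ρ) fun y hy => ?_
          rw [hμ, ← lintegral_indicator (hbm x ρ), ← lintegral_indicator (hbm _ _),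
            ← lintegral_add_left_eq_self
              ((Metric.ball x ρ).indicator fun z => ‖A z - A y‖ₑ ^ 2) y]
          refine lintegral_mono fun c => ?_
          by_cases hc : y + c ∈ Metric.ball x ρ
          · have hc2 : c ∈ Metric.ball (0 : Plane) (2 * ρ) := by
              rw [mem_ball_zero_iff]
              have := dist_triangle_right (y + c) y x
              rw [Metric.mem_ball] at hc hy
              rw [dist_eq_norm, add_sub_cancel_left] at this
              linarith
            rw [indicator_of_mem hc, indicator_of_mem hc2]
          · rw [indicator_of_notMem hc]
            exact zero_le
      _ = ∫⁻ c in Metric.ball (0 : Plane) (2 * ρ), ∫⁻ y, ‖A (y + c) - A y‖ₑ ^ 2 ∂μ :=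
          lintegral_lintegral_swap hm3.aemeasurable
      _ ≤ ∫⁻ _ in Metric.ball (0 : Plane) (2 * ρ), ENNReal.ofReal (2 * ρ) ^ 2 * S ^ 2 := by
          refine setLIntegral_mono' (hbm _ _) fun c hc => ?_
          rw [mem_ball_zero_iff] at hc
          have h1 := hA.eLpNorm_add_sub_le hr hA2 hA'2 (x := x) (s := ρ) (c := c)
            (t := Metric.ball x (3 * ρ)) (hbm _ _) hx (Metric.ball_subset_ball (by linarith))
          rw [← eLpNorm_two_sq (fun y => A (y + c) - A y), ← mul_pow]
          refine pow_le_pow_left₀ zero_le (h1.trans ?_) 2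
          rw [← ofReal_norm]
          gcongr
      _ = _ := by rw [setLIntegral_const, mul_comm]
  rw [laverage_eq, hμ, Measure.restrict_apply_univ]
  rw [ENNReal.div_le_iff hvol0 hvolt]
  refine total.trans (le_of_eq ?_)
  have hfr : Module.finrank ℝ Plane = 2 := by simp
  rw [Measure.addHaar_ball_of_pos _ _ (by positivity : 0 < 2 * ρ),
    Measure.addHaar_ball_of_pos _ x hρ, hfr, ← ENNReal.ofReal_pow (by positivity), mul_pow,
    ENNReal.ofReal_mul (by positivity), show ENNReal.ofReal (2 ^ 2) = 4 by norm_num]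
  ring

variable {E : Type*} [NormedAddCommGroup E] [NormedSpace ℝ E] [FiniteDimensional ℝ E]
  [MeasureSpace E] [BorelSpace E] [(volume : Measure E).IsAddHaarMeasure]

/-- Averages of the differentials `G (Θ v x) ∘ D(Θ v)(x)` at a small scale inherit a lower bound
from `G ∈ W^{1,2}`, since `G` has vanishing mean oscillation in two dimensions: at scale `ε`, it is
close in the mean to one of its values. -/
theorem IsNearIdentity.exists_le_norm_integral_derivCoeffOne {p : Plane → E} {Q : E → Plane}
    {x₀ : Plane} {r δ Λ : ℝ} (h : IsNearIdentity (fun v x => Q (p x + v)) x₀ r δ Λ)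
    (hp : ContDiff ℝ ∞ p) {G : Plane → Plane →L[ℝ] V} (hGm : StronglyMeasurable G)
    {H : Plane → Plane →L[ℝ] Plane →L[ℝ] V} (hG : HasWeakFDeriv (Metric.ball x₀ (2 * r)) G H)
    (hG2 : MemLp G 2 (volume.restrict (Metric.ball x₀ (2 * r))))
    (hH2 : MemLp H 2 (volume.restrict (Metric.ball x₀ (2 * r)))) {c : ℝ} (hc : 0 < c)
    (hlow : ∀ᵐ x ∂(volume.restrict (Metric.ball x₀ (2 * r))), ∀ e, c * ‖e‖ ≤ ‖G x e‖) (M : ℝ) :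
    ∃ ε₀ > 0, ∀ ε, 0 < ε → ε ≤ ε₀ → ∀ k : E → ℝ, Continuous k → (∀ v, 0 ≤ k v) →
      ∫ v, k v = 1 → (∀ v, k v ≤ M * (ε ^ Module.finrank ℝ E)⁻¹) → (∀ v, k v ≠ 0 → ‖v‖ ≤ ε) →
      ∀ᵐ x ∂(volume.restrict (Metric.ball x₀ (r / 2))), ∀ e, c / 4 * ‖e‖ ≤
        ‖(∫ v, derivCoeffOne (fun _ _ => ContinuousLinearMap.id ℝ V) (fun v x => Q (p x + v)) v x
          (G (Q (p x + v))) ∂(kernelMeasure k)) e‖ := by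
  have := FiniteDimensional.proper ℝ E
  obtain ⟨C, hCt, κ, hκ, ε₁, hε₁, hC⟩ := h.exists_lintegral_kernelMeasure_le hp M
  have hr := h.r_pos
  have hδ := h.δ_pos
  set Θ : E → Plane → Plane := fun v x => Q (p x + v) with hΘ
  have hbm : ∀ (y : Plane) (s : ℝ), MeasurableSet (Metric.ball y s) :=
    fun y s => Metric.isOpen_ball.measurableSet
  -- the energy of `H` on small balls is uniformly small
  have hHsq : ∀ s, eLpNorm H 2 (volume.restrict s) ^ 2 = ∫⁻ z in s, ‖H z‖ₑ ^ 2 := fun s =>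
    eLpNorm_two_sq H _
  have hHfin : ∫⁻ z in Metric.ball x₀ (2 * r), ‖H z‖ₑ ^ 2 ≠ ⊤ := by
    rw [← hHsq]
    exact (ENNReal.pow_lt_top hH2.2).ne
  set K := C * (16 * ENNReal.ofReal (κ ^ 2)) with hK
  have hKt : K ≠ ⊤ := ENNReal.mul_ne_top hCt (ENNReal.mul_ne_top (by simp) ENNReal.ofReal_ne_top)
  set τ := ENNReal.ofReal ((c / 8) ^ 2) / (K + 1) with hτ
  have hτ0 : τ ≠ 0 := (ENNReal.div_pos (by simpa using by positivity) (by simp [hKt])).ne'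
  obtain ⟨θ, hθ, hθle⟩ := exists_pos_setLIntegral_lt_of_measure_lt hHfin hτ0
  have hvol : Tendsto (fun ε : ℝ => volume (Metric.ball (0 : Plane) (3 * (κ * ε)))) (𝓝[>] 0)
      (𝓝 0) := by
    have h1 : Tendsto (fun ε : ℝ => ENNReal.ofReal ((3 * (κ * ε)) ^ 2) *
        volume (Metric.ball (0 : Plane) 1)) (𝓝[>] 0) (𝓝 0) := by
      have h2 : Tendsto (fun ε : ℝ => ENNReal.ofReal ((3 * (κ * ε)) ^ 2)) (𝓝[>] 0) (𝓝 0) := by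
        have : Continuous fun ε : ℝ => ENNReal.ofReal ((3 * (κ * ε)) ^ 2) :=
          ENNReal.continuous_ofReal.comp (by fun_prop)
        have := this.tendsto 0
        simp only [mul_zero, ne_eq, OfNat.ofNat_ne_zero, not_false_eq_true, zero_pow,
          ENNReal.ofReal_zero] at this
        exact this.mono_left nhdsWithin_le_nhds
      simpa using ENNReal.Tendsto.mul_const h2
        (Or.inr (measure_ball_lt_top (μ := (volume : Measure Plane)) (x := 0) (r := 1)).ne)
    refine h1.congr' ?_
    filter_upwards [self_mem_nhdsWithin] with ε hε
    rw [mem_Ioi] at hε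
    rw [Measure.addHaar_ball_of_pos _ (0 : Plane) (by positivity : 0 < 3 * (κ * ε)),
      finrank_euclideanSpace_fin]
  obtain ⟨ε₂, hε₂, hvol2⟩ := (mem_nhdsGT_iff_exists_Ioc_subset).1 (hvol.eventually_lt_const hθ)
  rw [mem_Ioi] at hε₂
  refine ⟨min (min ε₁ ε₂) (min (δ / 2) (r / (6 * κ))), by positivity,
    fun ε hε hε0 k hk hk0 hk1 hkM hks => ?_⟩
  have hεε₁ : ε ≤ ε₁ := hε0.trans ((min_le_left _ _).trans (min_le_left _ _))
  have hεε₂ : ε ≤ ε₂ := hε0.trans ((min_le_left _ _).trans (min_le_right _ _))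
  have hεδ : ε < δ := (hε0.trans ((min_le_right _ _).trans (min_le_left _ _))).trans_lt
    (half_lt_self hδ)
  have hεr : 3 * (κ * ε) ≤ r / 2 := by
    have h1 := hε0.trans ((min_le_right _ _).trans (min_le_right _ _))
    rw [le_div_iff₀ (by positivity)] at h1
    linarith
  have hprob := isProbabilityMeasure_kernelMeasure hk0 hk1
  set ν := kernelMeasure k with hν
  have hνε : ∀ᵐ v ∂ν, ‖v‖ ≤ ε := ae_kernelMeasure hk hks
  have := isFiniteMeasure_restrict_ball x₀ r
  have hid : ContDiff ℝ ∞ (Function.uncurry fun (_ : E) (_ : Plane) =>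
      ContinuousLinearMap.id ℝ V) := contDiff_const
  have i1 := ((h.memLp_uncurry hεδ hνε (a := fun _ _ => ContinuousLinearMap.id ℝ (Plane →L[ℝ] V))
    continuous_const hG2).integrable one_le_two).prod_left_ae
  have i2 := ((h.memLp_uncurry hεδ hνε (contDiff_derivCoeffOne hid h.contDiff).continuous
    hG2).integrable one_le_two).prod_left_ae
  have hrr : Metric.ball x₀ (r / 2) ⊆ Metric.ball x₀ r := Metric.ball_subset_ball (by linarith)
  filter_upwards [ae_restrict_of_ae_restrict_of_subset hrr i1,
    ae_restrict_of_ae_restrict_of_subset hrr i2, ae_restrict_mem (hbm _ _)] with x hx1 hx2 hx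
  have hx1' : Integrable (fun v => G (Θ v x)) ν := hx1
  have hx2' : Integrable (fun v => derivCoeffOne (fun _ _ => ContinuousLinearMap.id ℝ V) Θ v x
    (G (Θ v x))) ν := hx2
  have hxr := hrr hx
  have hsub3 : Metric.ball x (3 * (κ * ε)) ⊆ Metric.ball x₀ r := by
    refine Metric.ball_subset_ball' ?_
    rw [Metric.mem_ball] at hx
    linarith
  have hr2 : Metric.ball x₀ r ⊆ Metric.ball x₀ (2 * r) := Metric.ball_subset_ball (by linarith)
  have hκε : 0 < κ * ε := mul_pos hκ hε
  have hsub1 : Metric.ball x (κ * ε) ⊆ Metric.ball x₀ (2 * r) :=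
    ((Metric.ball_subset_ball (by linarith)).trans hsub3).trans hr2
  obtain ⟨y, hy, hylow, hyle⟩ := hG.exists_lintegral_sub_sq_le hGm hr hG2 hH2 hκε hsub3
    (ae_restrict_of_ae_restrict_of_subset hsub1 hlow)
  set L := G y with hL
  have hω : eLpNorm H 2 (volume.restrict (Metric.ball x (3 * (κ * ε)))) ^ 2 ≤ τ := by
    rw [hHsq]
    have h1 := hθle (Metric.ball x (3 * (κ * ε))) ?_
    · rw [Measure.restrict_restrict (hbm _ _),
        inter_eq_left.2 (hsub3.trans hr2)] at h1
      exact h1.le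
    · have h2 : volume (Metric.ball (0 : Plane) (3 * (κ * ε))) < θ := hvol2 ⟨hε, hεε₂⟩
      refine (Measure.restrict_apply_le _ _).trans_lt ?_
      rwa [Measure.addHaar_ball_center]
  -- mean deviation of the differentials from `L`
  have hdev2 : ∫⁻ v, ‖G (Θ v x) - L‖ₑ ^ 2 ∂ν ≤ ENNReal.ofReal ((c / 8) ^ 2) := by
    have h1 := hC ε hε hεε₁ k hk hkM hks x hx (fun z => ‖G z - L‖ₑ ^ 2)
      ((hGm.sub stronglyMeasurable_const).enorm.pow_const 2)
    have he0 : ENNReal.ofReal (ε ^ 2) ≠ 0 := by simpa using by positivity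
    calc ∫⁻ v, ‖G (Θ v x) - L‖ₑ ^ 2 ∂ν
        ≤ C * (ENNReal.ofReal (ε ^ 2))⁻¹ * (16 * ENNReal.ofReal ((κ * ε) ^ 2) * τ) :=
          h1.trans (by gcongr; exact hyle.trans (by gcongr))
      _ = K * τ * ((ENNReal.ofReal (ε ^ 2))⁻¹ * ENNReal.ofReal (ε ^ 2)) := by
          rw [mul_pow, ENNReal.ofReal_mul (by positivity), hK]
          ring
      _ = K * τ := by rw [ENNReal.inv_mul_cancel he0 ENNReal.ofReal_ne_top, mul_one]
      _ ≤ (K + 1) * τ := by gcongr; exact le_self_add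
      _ ≤ _ := ENNReal.mul_div_le
  have hdev : ∫⁻ v, ‖G (Θ v x) - L‖ₑ ∂ν ≤ ENNReal.ofReal (c / 8) := by
    refine ENNReal.le_of_sq_le_sq ((sq_lintegral_enorm_le ?_).trans ?_)
    · exact (hx1'.sub (integrable_const L)).1
    · rwa [← ENNReal.ofReal_pow (by positivity)]
  intro e
  have hD : ∀ᵐ v ∂ν, ‖fderiv ℝ (Θ v) x - ContinuousLinearMap.id ℝ Plane‖ ≤ 1 / 2 :=
    hνε.mono fun v hv => h.fderiv_close v (hv.trans_lt hεδ) x hxr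
  have hDe : ∀ᵐ v ∂ν, ‖fderiv ℝ (Θ v) x e - e‖ ≤ 1 / 2 * ‖e‖ := by
    filter_upwards [hD] with v hv
    exact (fderiv ℝ (Θ v) x - ContinuousLinearMap.id ℝ Plane).le_of_opNorm_le hv e
  have hDe2 : ∀ᵐ v ∂ν, ‖fderiv ℝ (Θ v) x e‖ ≤ 3 / 2 * ‖e‖ := by
    filter_upwards [hDe] with v hv
    have := norm_le_norm_add_norm_sub' (fderiv ℝ (Θ v) x e) e
    linarith
  have hcont : Continuous fun v => fderiv ℝ (Θ v) x e :=
    ((contDiff_fderiv_uncurry h.contDiff).continuous.comp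
      (continuous_id.prodMk continuous_const)).clm_apply continuous_const
  have iD : Integrable (fun v => fderiv ℝ (Θ v) x e) ν :=
    Integrable.of_bound hcont.aestronglyMeasurable _ hDe2
  set e' := ∫ v, fderiv ℝ (Θ v) x e ∂ν with he'
  have he'e : 1 / 2 * ‖e‖ ≤ ‖e'‖ := by
    have h1 : e' - e = ∫ v, (fderiv ℝ (Θ v) x e - e) ∂ν := by
      rw [integral_sub iD (integrable_const e)]
      simp [he']
    have h2 : ‖e' - e‖ ≤ 1 / 2 * ‖e‖ := by
      rw [h1]
      simpa using norm_integral_le_of_norm_le_const hDe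
    have := norm_le_norm_add_norm_sub e' e
    linarith
  have iGe : Integrable (fun v => G (Θ v x) (fderiv ℝ (Θ v) x e)) ν :=
    (ContinuousLinearMap.apply ℝ V e).integrable_comp hx2'
  have iLe : Integrable (fun v => L (fderiv ℝ (Θ v) x e)) ν := L.integrable_comp iD
  have hval : (∫ v, derivCoeffOne (fun _ _ => ContinuousLinearMap.id ℝ V) Θ v x
      (G (Θ v x)) ∂ν) e
      = L e' + ∫ v, (G (Θ v x) - L) (fderiv ℝ (Θ v) x e) ∂ν := by
    have h1 : (∫ v, derivCoeffOne (fun _ _ => ContinuousLinearMap.id ℝ V) Θ v x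
        (G (Θ v x)) ∂ν) e = ∫ v, G (Θ v x) (fderiv ℝ (Θ v) x e) ∂ν :=
      ((ContinuousLinearMap.apply ℝ V e).integral_comp_comm hx2').symm
    have h2 : L e' = ∫ v, L (fderiv ℝ (Θ v) x e) ∂ν := (L.integral_comp_comm iD).symm
    rw [h1, h2, ← integral_add iLe]
    · simp
    · exact iGe.sub iLe
  have herr : ‖∫ v, (G (Θ v x) - L) (fderiv ℝ (Θ v) x e) ∂ν‖ ≤ 3 / 2 * ‖e‖ * (c / 8) := by
    have h1 : ‖∫ v, (G (Θ v x) - L) (fderiv ℝ (Θ v) x e) ∂ν‖ₑ ≤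
        ENNReal.ofReal (3 / 2 * ‖e‖ * (c / 8)) := by
      calc ‖∫ v, (G (Θ v x) - L) (fderiv ℝ (Θ v) x e) ∂ν‖ₑ
          ≤ ∫⁻ v, ‖(G (Θ v x) - L) (fderiv ℝ (Θ v) x e)‖ₑ ∂ν :=
            enorm_integral_le_lintegral_enorm _
        _ ≤ ∫⁻ v, ENNReal.ofReal (3 / 2 * ‖e‖) * ‖G (Θ v x) - L‖ₑ ∂ν := by
            refine lintegral_mono_ae (hDe2.mono fun v hv => ?_)
            rw [← ofReal_norm, ← ofReal_norm, ← ENNReal.ofReal_mul (by positivity)]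
            refine ENNReal.ofReal_le_ofReal ?_
            rw [mul_comm]
            exact (ContinuousLinearMap.le_opNorm _ _).trans
              (mul_le_mul_of_nonneg_left hv (norm_nonneg _))
        _ ≤ ENNReal.ofReal (3 / 2 * ‖e‖ * (c / 8)) := by
            rw [lintegral_const_mul' _ _ ENNReal.ofReal_ne_top,
              ENNReal.ofReal_mul (p := 3 / 2 * ‖e‖) (by positivity)]
            exact mul_le_mul' le_rfl hdev
    rw [← ofReal_norm] at h1
    exact (ENNReal.ofReal_le_ofReal_iff (by positivity)).1 h1
  rw [hval]
  have h1 := hylow e'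
  have h2 := norm_sub_le_norm_add (L e') (∫ v, (G (Θ v x) - L) (fderiv ℝ (Θ v) x e) ∂ν)
  have h3 := mul_le_mul_of_nonneg_left he'e hc.le
  have h4 : 0 ≤ c * ‖e‖ := by positivity
  linarith

end LowerBound

/-! ### Comparison of metrics in a chart -/

section Metric

/-- In a bundle with a continuous Riemannian metric, the trivialization at a point is locally
bounded with respect to the metric. -/
theorem Bundle.ContinuousRiemannianMetric.exists_norm_trivializationAt_sq_le
    {B F : Type*} [TopologicalSpace B] [NormedAddCommGroup F] [NormedSpace ℝ F]
    {E : B → Type*} [TopologicalSpace (Bundle.TotalSpace F E)]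
    [∀ b, TopologicalSpace (E b)] [∀ b, AddCommGroup (E b)] [∀ b, Module ℝ (E b)]
    [∀ b, IsTopologicalAddGroup (E b)] [∀ b, ContinuousConstSMul ℝ (E b)]
    [FiberBundle F E] [VectorBundle ℝ F E] (g : Bundle.ContinuousRiemannianMetric F E) (b₀ : B) :
    ∃ C > 0, ∀ᶠ b in 𝓝 b₀, ∀ X : E b,
      ‖(trivializationAt F E b₀).continuousLinearMapAt ℝ b X‖ ^ 2 ≤ C * g.inner b X X := by
  let : Bundle.RiemannianBundle E := ⟨g.toRiemannianMetric⟩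
  obtain ⟨C, hC, h⟩ := eventually_norm_trivializationAt_lt F E b₀
  refine ⟨C ^ 2, by positivity, ?_⟩
  filter_upwards [h] with b hb X
  have h1 := ContinuousLinearMap.le_of_opNorm_le _ hb.le X
  have h2 : ‖X‖ ^ 2 = g.inner b X X := (real_inner_self_eq_norm_sq X).symm
  rw [← h2, ← mul_pow]
  exact pow_le_pow_left₀ (norm_nonneg _) h1 2

variable {S : Type*} [TopologicalSpace S] [ChartedSpace Plane S]
  [IsManifold 𝓘(ℝ, Plane) ∞ S]

/-- In a chart, the metric is locally bounded below by a multiple of the Euclidean metric. -/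
theorem exists_mul_sq_norm_le_chartSqNorm (g₀ : SurfaceMetric S)
    {φ : OpenPartialHomeomorph S Plane} (hφ : φ ∈ IsManifold.maximalAtlas 𝓘(ℝ, Plane) ∞ S)
    {x₀ : Plane} (hx₀ : x₀ ∈ φ.target) :
    ∃ κ > 0, ∀ᶠ x in 𝓝 x₀, ∀ v, κ * ‖v‖ ^ 2 ≤ chartSqNorm g₀ φ x v := by
  set p₀ := φ.symm x₀ with hp₀
  have hp₀s : p₀ ∈ φ.source := φ.map_target hx₀
  obtain ⟨C, hC, h⟩ :=
    g₀.toContinuousRiemannianMetric.exists_norm_trivializationAt_sq_le p₀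
  set χ := chartAt Plane p₀ with hχ
  have hχm : χ ∈ IsManifold.maximalAtlas 𝓘(ℝ, Plane) ∞ S := IsManifold.chart_mem_maximalAtlas p₀
  have hχp : p₀ ∈ χ.source := mem_chart_source Plane p₀
  -- the transition map from the preferred chart at `p₀` to `φ`
  set T : Plane → Plane := fun y => φ (χ.symm y) with hT
  set Ω := χ.target ∩ χ.symm ⁻¹' φ.source with hΩ
  have hΩo : IsOpen Ω := χ.isOpen_inter_preimage_symm φ.open_source
  have hTs : ContMDiffOn 𝓘(ℝ, Plane) 𝓘(ℝ, Plane) ∞ T Ω :=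
    (contMDiffOn_of_mem_maximalAtlas hφ).comp
      ((contMDiffOn_symm_of_mem_maximalAtlas hχm).mono inter_subset_left) (fun y hy => hy.2)
  rw [contMDiffOn_iff_contDiffOn] at hTs
  have hχp₀ : χ p₀ ∈ Ω := ⟨χ.map_source hχp, by simpa [χ.left_inv hχp] using hp₀s⟩
  have hcont : ContinuousAt (fderiv ℝ T) (χ p₀) :=
    (hTs.continuousOn_fderiv_of_isOpen hΩo (by simp)).continuousAt (hΩo.mem_nhds hχp₀)
  set D := ‖fderiv ℝ T (χ p₀)‖ + 1 with hD
  have hD0 : 0 < D := by positivity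
  have hev1 : ∀ᶠ y in 𝓝 (χ p₀), ‖fderiv ℝ T y‖ < D :=
    hcont.norm.eventually_lt_const (by rw [hD]; linarith)
  have hφc : ContinuousAt φ.symm x₀ := φ.symm.continuousAt hx₀
  have hχc : ContinuousAt χ p₀ := χ.continuousAt hχp
  have hev2 := hφc.eventually (hχc.eventually (hev1.and (hΩo.mem_nhds hχp₀)))
  have hev3 := hφc.eventually (h.and (χ.open_source.mem_nhds hχp))
  refine ⟨(D ^ 2 * C)⁻¹, by positivity, ?_⟩
  filter_upwards [hev2, hev3, φ.open_target.mem_nhds hx₀] with x hx1 hx2 hx3 v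
  set p := φ.symm x with hp
  have hpχ : p ∈ χ.source := hx2.2
  set X : TangentSpace 𝓘(ℝ, Plane) p := mfderiv 𝓘(ℝ, Plane) 𝓘(ℝ, Plane) φ.symm x v with hX
  have d1 : MDifferentiableAt 𝓘(ℝ, Plane) 𝓘(ℝ, Plane) φ.symm x :=
    (((contMDiffOn_symm_of_mem_maximalAtlas hφ).contMDiffAt
      (φ.open_target.mem_nhds hx3))).mdifferentiableAt (by simp)
  have d2 : MDifferentiableAt 𝓘(ℝ, Plane) 𝓘(ℝ, Plane) χ p :=
    (((contMDiffOn_of_mem_maximalAtlas hχm).contMDiffAt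
      (χ.open_source.mem_nhds hpχ))).mdifferentiableAt (by simp)
  have d3 : DifferentiableAt ℝ T (χ p) :=
    (hTs.differentiableOn (by simp)).differentiableAt (hΩo.mem_nhds hx1.2)
  have e1 : v = fderiv ℝ T (χ p) (mfderiv 𝓘(ℝ, Plane) 𝓘(ℝ, Plane) χ p X) := by
    have c1 : HasMFDerivAt 𝓘(ℝ, Plane) 𝓘(ℝ, Plane) (T ∘ χ ∘ φ.symm) x
        ((fderiv ℝ T (χ p)).comp ((mfderiv 𝓘(ℝ, Plane) 𝓘(ℝ, Plane) χ p).comp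
          (mfderiv 𝓘(ℝ, Plane) 𝓘(ℝ, Plane) φ.symm x))) :=
      (d3.hasFDerivAt.hasMFDerivAt).comp x (d2.hasMFDerivAt.comp x d1.hasMFDerivAt)
    have c2 : T ∘ χ ∘ φ.symm =ᶠ[𝓝 x] id := by
      have hs : ∀ᶠ y in 𝓝 x, φ.symm y ∈ χ.source :=
        (φ.symm.continuousAt hx3).eventually (χ.open_source.mem_nhds hpχ)
      filter_upwards [hs, φ.open_target.mem_nhds hx3] with y hy1 hy2
      simp [hT, χ.left_inv hy1, φ.right_inv hy2]
    have c3 : HasFDerivAt (T ∘ χ ∘ φ.symm) (ContinuousLinearMap.id ℝ Plane) x :=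
      (hasFDerivAt_id x).congr_of_eventuallyEq c2
    have c4 := hasMFDerivAt_unique c1 c3.hasMFDerivAt
    exact (congrArg (fun A : Plane →L[ℝ] Plane => A v) c4).symm
  have e2 : ‖(show Plane from mfderiv 𝓘(ℝ, Plane) 𝓘(ℝ, Plane) χ p X)‖ ^ 2
      ≤ C * g₀.inner p X X := by
    have := hx2.1 X
    rw [TangentBundle.continuousLinearMapAt_trivializationAt hpχ] at this
    exact this
  have e3 : ‖v‖ ≤ D * ‖(show Plane from mfderiv 𝓘(ℝ, Plane) 𝓘(ℝ, Plane) χ p X)‖ := by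
    conv_lhs => rw [e1]
    exact ContinuousLinearMap.le_of_opNorm_le _ hx1.1.le _
  change _ ≤ g₀.inner p X X
  rw [inv_mul_le_iff₀ (by positivity)]
  calc ‖v‖ ^ 2 ≤ (D * ‖(show Plane from mfderiv 𝓘(ℝ, Plane) 𝓘(ℝ, Plane) χ p X)‖) ^ 2 :=
        pow_le_pow_left₀ (norm_nonneg _) e3 2
    _ = D ^ 2 * ‖(show Plane from mfderiv 𝓘(ℝ, Plane) 𝓘(ℝ, Plane) χ p X)‖ ^ 2 := mul_pow _ _ _
    _ ≤ D ^ 2 * (C * g₀.inner p X X) := mul_le_mul_of_nonneg_left e2 (by positivity)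
    _ = _ := by ring

end Metric

/-! ### Extension of smooth maps -/

section Extension

variable {E F : Type*} [NormedAddCommGroup E] [NormedSpace ℝ E] [HasContDiffBump E]
  [NormedAddCommGroup F] [NormedSpace ℝ F]

/-- A smooth map on an open set agrees near each of its points with a globally smooth map. -/
theorem exists_contDiff_eventuallyEq {f : E → F} {s : Set E} (hs : IsOpen s)
    (hf : ContDiffOn ℝ ∞ f s) {x : E} (hx : x ∈ s) :
    ∃ g : E → F, ContDiff ℝ ∞ g ∧ g =ᶠ[𝓝 x] f := by
  obtain ⟨ρ, hρ, hball⟩ := Metric.nhds_basis_closedBall.mem_iff.1 (hs.mem_nhds hx)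
  let φ : ContDiffBump x := ⟨ρ / 2, ρ, half_pos hρ, half_lt_self hρ⟩
  refine ⟨fun y => φ y • f y, contDiff_iff_contDiffAt.2 fun y => ?_, ?_⟩
  · by_cases hy : y ∈ tsupport φ
    · rw [φ.tsupport_eq] at hy
      exact φ.contDiff.contDiffAt.smul (hf.contDiffAt (hs.mem_nhds (hball hy)))
    · have : (fun y => φ y • f y) =ᶠ[𝓝 y] fun _ => 0 := by
        filter_upwards [(notMem_tsupport_iff_eventuallyEq).1 hy] with z hz
        simp [hz]
      exact contDiffAt_const.congr_of_eventuallyEq this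
  · filter_upwards [φ.eventuallyEq_one] with y hy
    simp [hy]

end Extension

/-! ### Integrability near the surface -/

section Integrability

variable {E : Type*} [NormedAddCommGroup E] [NormedSpace ℝ E] [FiniteDimensional ℝ E]
  [MeasureSpace E] [BorelSpace E] [(volume : Measure E).IsAddHaarMeasure]
  {V : Type*} [NormedAddCommGroup V]

/-- The composition of an integrable map with `Q` is integrable near `p x₀`. -/
theorem IsNearIdentity.exists_integrableOn_comp {p : Plane → E} {Q : E → Plane} {x₀ : Plane}
    {r δ Λ : ℝ} (h : IsNearIdentity (fun v x => Q (p x + v)) x₀ r δ Λ) (hp : ContDiff ℝ ∞ p)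
    (hQ : ContDiff ℝ ∞ Q) {f : Plane → V} (hf : IntegrableOn f (Metric.ball x₀ r)) :
    ∃ ε > 0, IntegrableOn (fun y => f (Q y)) (Metric.ball (p x₀) ε) := by
  have hr := h.r_pos
  have hδ := h.δ_pos
  have hΛ := h.Λ_nonneg
  obtain ⟨L, hL1, hL⟩ := exists_dist_le_mul_of_contDiff hp x₀ r
  have hL0 : 0 < L := by linarith
  obtain ⟨ε, hε0, hε1, hε2, hε3⟩ : ∃ ε > 0, 2 * ε ≤ δ ∧ ε ≤ r / 2 ∧ (1 + 2 * Λ) * ε ≤ r := by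
    refine ⟨min (δ / 2) (min (r / 2) (r / (1 + 2 * Λ))), by positivity, ?_, ?_, ?_⟩
    · linarith [min_le_left (δ / 2) (min (r / 2) (r / (1 + 2 * Λ)))]
    · exact (min_le_right _ _).trans (min_le_left _ _)
    · rw [← le_div_iff₀' (by positivity)]
      exact (min_le_right _ _).trans (min_le_right _ _)
  have hx0 : x₀ ∈ Metric.ball x₀ (r / 2) := Metric.mem_ball_self (half_pos hr)
  have hsub : Metric.ball x₀ ((1 + 2 * Λ) * ε) ⊆ Metric.ball x₀ r := Metric.ball_subset_ball hε3
  have hv0 : volume (Metric.ball x₀ (ε / L)) ≠ 0 :=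
    (Metric.measure_ball_pos _ _ (by positivity)).ne'
  have shift : ∀ g : Plane → ℝ≥0∞, ∫⁻ y in Metric.ball (p x₀) ε, g (Q y) =
      ∫⁻ v in Metric.ball (0 : E) ε, g (Q (p x₀ + v)) := by
    intro g
    rw [← lintegral_indicator Metric.isOpen_ball.measurableSet,
      ← lintegral_indicator Metric.isOpen_ball.measurableSet,
      ← lintegral_add_left_eq_self
        ((Metric.ball (p x₀) ε).indicator fun y => g (Q y)) (p x₀)]
    refine lintegral_congr fun v => ?_
    simp [indicator]
  have key : ∀ g : Plane → ℝ≥0∞, Measurable g →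
      volume (Metric.ball x₀ (ε / L)) * ∫⁻ y in Metric.ball (p x₀) ε, g (Q y) ≤
      volume (Metric.ball (0 : E) (2 * ε)) * (2 * ∫⁻ y in Metric.ball x₀ r, g y) := by
    intro g hg
    rw [shift]
    refine (h.lintegral_parameter_le hL1 hL hε0 hε1 hε2 hx0 hg).trans ?_
    gcongr
  have hQm : Measurable Q := hQ.continuous.measurable
  have hqmp : Measure.QuasiMeasurePreserving Q (volume.restrict (Metric.ball (p x₀) ε))
      (volume.restrict (Metric.ball x₀ r)) := by
    refine ⟨hQm, Measure.AbsolutelyContinuous.mk fun s hs h0 => ?_⟩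
    rw [Measure.map_apply hQm hs]
    have h1 := key (s.indicator 1) (measurable_one.indicator hs)
    rw [lintegral_indicator_one hs, h0, mul_zero, mul_zero] at h1
    have e : (fun y => s.indicator (1 : Plane → ℝ≥0∞) (Q y)) = (Q ⁻¹' s).indicator 1 := rfl
    rw [e, lintegral_indicator_one (hQm hs)] at h1
    exact (mul_eq_zero.1 (le_antisymm h1 zero_le)).resolve_left hv0
  refine ⟨ε, hε0, hf.1.comp_quasiMeasurePreserving hqmp, ?_⟩
  obtain ⟨g, hg, hfg⟩ := hf.1
  have h1 := key (fun y => ‖g y‖ₑ) hg.enorm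
  have e1 : ∫⁻ y in Metric.ball (p x₀) ε, ‖f (Q y)‖ₑ = ∫⁻ y in Metric.ball (p x₀) ε, ‖g (Q y)‖ₑ :=
    lintegral_congr_ae ((hqmp.ae_eq_comp hfg).mono fun y hy => by
      simp only [Function.comp] at hy; simp only [hy])
  have e2 : ∫⁻ y in Metric.ball x₀ r, ‖g y‖ₑ = ∫⁻ y in Metric.ball x₀ r, ‖f y‖ₑ :=
    lintegral_congr_ae (hfg.mono fun y hy => by simp only [hy])
  rw [← e1, e2] at h1
  rw [HasFiniteIntegral]
  by_contra htop
  rw [not_lt, top_le_iff] at htop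
  rw [htop, ENNReal.mul_top hv0, top_le_iff] at h1
  have := FiniteDimensional.proper ℝ E
  exact ENNReal.mul_ne_top (measure_ball_lt_top.ne) (ENNReal.mul_ne_top (by simp) hf.2.ne) h1

end Integrability

/-! ### The mollification as an average -/

section Kernel

variable {m : ℕ}

/-- The reflected rescaled kernel `v ↦ ε^{-m} ψ(-v / ε)`. -/
def scaledKernel (ψ : EuclideanSpace ℝ (Fin m) → ℝ) (ε : ℝ) (v : EuclideanSpace ℝ (Fin m)) : ℝ :=
  (ε ^ m)⁻¹ * ψ (ε⁻¹ • (-v))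

theorem IsRadialMollifier.continuous_scaledKernel {ψ : EuclideanSpace ℝ (Fin m) → ℝ}
    (hψ : IsRadialMollifier ψ) (ε : ℝ) : Continuous (scaledKernel ψ ε) :=
  continuous_const.mul (hψ.contDiff.continuous.comp (by fun_prop))

theorem IsRadialMollifier.scaledKernel_nonneg {ψ : EuclideanSpace ℝ (Fin m) → ℝ}
    (hψ : IsRadialMollifier ψ) {ε : ℝ} (hε : 0 < ε) (v : EuclideanSpace ℝ (Fin m)) :
    0 ≤ scaledKernel ψ ε v :=
  mul_nonneg (by positivity) (hψ.nonneg _)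

theorem IsRadialMollifier.integral_scaledKernel {ψ : EuclideanSpace ℝ (Fin m) → ℝ}
    (hψ : IsRadialMollifier ψ) {ε : ℝ} (hε : 0 < ε) : ∫ v, scaledKernel ψ ε v = 1 := by
  simp only [scaledKernel]
  rw [integral_neg_eq_self (fun v => (ε ^ m)⁻¹ * ψ (ε⁻¹ • v)), integral_const_mul,
    Measure.integral_comp_smul, hψ.integral_eq_one, finrank_euclideanSpace_fin, inv_pow, inv_inv,
    abs_of_pos (by positivity), smul_eq_mul, mul_one, inv_mul_cancel₀ (by positivity)]

theorem IsRadialMollifier.scaledKernel_norm_le {ψ : EuclideanSpace ℝ (Fin m) → ℝ}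
    (hψ : IsRadialMollifier ψ) {ε : ℝ} (hε : 0 < ε) (v : EuclideanSpace ℝ (Fin m))
    (hv : scaledKernel ψ ε v ≠ 0) : ‖v‖ ≤ ε := by
  have h1 : ψ (ε⁻¹ • (-v)) ≠ 0 := right_ne_zero_of_mul hv
  have h2 := hψ.tsupport_subset (subset_tsupport _ h1)
  rw [mem_closedBall_zero_iff, norm_smul, norm_neg, norm_inv, Real.norm_of_nonneg hε.le,
    inv_mul_le_iff₀ hε, mul_one] at h2
  exact h2

theorem IsRadialMollifier.hasCompactSupport {ψ : EuclideanSpace ℝ (Fin m) → ℝ}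
    (hψ : IsRadialMollifier ψ) : HasCompactSupport ψ :=
  (isCompact_closedBall _ _).of_isClosed_subset (isClosed_tsupport _) hψ.tsupport_subset

theorem IsRadialMollifier.exists_scaledKernel_le {ψ : EuclideanSpace ℝ (Fin m) → ℝ}
    (hψ : IsRadialMollifier ψ) :
    ∃ M : ℝ, ∀ ε > 0, ∀ v, scaledKernel ψ ε v ≤ M * (ε ^ m)⁻¹ := by
  obtain ⟨M, hM⟩ := hψ.hasCompactSupport.exists_bound_of_continuous hψ.contDiff.continuous
  refine ⟨M, fun ε hε v => ?_⟩
  rw [scaledKernel, mul_comm]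
  exact mul_le_mul_of_nonneg_right ((Real.le_norm_self _).trans (hM _)) (by positivity)

variable {S W : Type*} [NormedAddCommGroup W] [NormedSpace ℝ W]

/-- The mollification at `z` as an average over translations, in terms of any map `g` which
agrees with `F ∘ P` near `z`. -/
theorem IsRadialMollifier.tubularMollification_eq {ψ : EuclideanSpace ℝ (Fin m) → ℝ}
    (hψ : IsRadialMollifier ψ) {U : Set (EuclideanSpace ℝ (Fin m))}
    {P : EuclideanSpace ℝ (Fin m) → S} {F : S → W} (hU : MeasurableSet U) {ε : ℝ} (hε : 0 < ε)
    {z : EuclideanSpace ℝ (Fin m)} {g : EuclideanSpace ℝ (Fin m) → W}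
    (hz : ∀ y, dist y z ≤ ε → y ∈ U ∧ F (P y) = g y) :
    tubularMollification ψ U P F ε z = ∫ v, g (z + v) ∂(kernelMeasure (scaledKernel ψ ε)) := by
  rw [integral_kernelMeasure (hψ.continuous_scaledKernel ε) (hψ.scaledKernel_nonneg hε),
    tubularMollification, ← integral_indicator hU, ← integral_add_left_eq_self _ z]
  refine integral_congr_ae (Eventually.of_forall fun v => ?_)
  by_cases hv : scaledKernel ψ ε v = 0
  · simp only [hv, zero_smul]
    refine indicator_apply_eq_zero.2 fun _ => ?_
    rw [show z - (z + v) = -v by abel]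
    have : (ε ^ m)⁻¹ * ψ (ε⁻¹ • (-v)) = 0 := hv
    rw [this, zero_smul]
  · have h1 := hz (z + v) (by simpa [dist_eq_norm] using hψ.scaledKernel_norm_le hε v hv)
    beta_reduce
    rw [indicator_of_mem h1.1, h1.2, show z - (z + v) = -v by abel]
    rfl

/-- The mollification is smooth near `z₀` for small `ε` if `F ∘ P` is integrable near `z₀`. -/
theorem IsRadialMollifier.contDiffOn_tubularMollification [CompleteSpace W]
    {ψ : EuclideanSpace ℝ (Fin m) → ℝ}
    (hψ : IsRadialMollifier ψ) {U : Set (EuclideanSpace ℝ (Fin m))}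
    {P : EuclideanSpace ℝ (Fin m) → S} {F : S → W} (hU : MeasurableSet U) {ρ ε : ℝ} (hε : 0 < ε)
    (hερ : ε ≤ ρ) {z₀ : EuclideanSpace ℝ (Fin m)} (hzU : Metric.ball z₀ (2 * ρ) ⊆ U)
    (hint : IntegrableOn (fun y => F (P y)) (Metric.ball z₀ (2 * ρ))) :
    ContDiffOn ℝ ∞ (tubularMollification ψ U P F ε) (Metric.ball z₀ ρ) := by
  set g := (Metric.ball z₀ (2 * ρ)).indicator fun y => F (P y) with hg
  have hgi : Integrable g := (integrable_indicator_iff Metric.isOpen_ball.measurableSet).2 hint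
  set k : EuclideanSpace ℝ (Fin m) → ℝ := fun w => (ε ^ m)⁻¹ * ψ (ε⁻¹ • w) with hk
  have hks : ContDiff ℝ ∞ k :=
    contDiff_const.mul (hψ.contDiff.comp (by fun_prop : ContDiff ℝ ∞ fun w => ε⁻¹ • w))
  have hkc : HasCompactSupport k :=
    (hψ.hasCompactSupport.comp_smul (inv_ne_zero hε.ne')).mul_left
  have hconv : ContDiff ℝ ∞ (convolution k g (ContinuousLinearMap.lsmul ℝ ℝ) volume) :=
    hkc.contDiff_convolution_left (n := ⊤) _ hks hgi.locallyIntegrable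
  refine hconv.contDiffOn.congr fun z hz => ?_
  rw [convolution_eq_swap, tubularMollification, ← integral_indicator hU]
  refine integral_congr_ae (Eventually.of_forall fun y => ?_)
  simp only [ContinuousLinearMap.lsmul_apply]
  by_cases hv : k (z - y) = 0
  · rw [hv, zero_smul]
    refine indicator_apply_eq_zero.2 fun _ => ?_
    have : (ε ^ m)⁻¹ * ψ (ε⁻¹ • (z - y)) = 0 := hv
    rw [this, zero_smul]
  · have h1 : ‖y - z‖ ≤ ε := hψ.scaledKernel_norm_le hε _ (by
      rw [scaledKernel, neg_sub]; exact hv)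
    have h2 : y ∈ Metric.ball z₀ (2 * ρ) := by
      rw [Metric.mem_ball] at hz ⊢
      have := dist_triangle y z z₀
      rw [dist_eq_norm y z] at this
      linarith
    rw [hg, indicator_of_mem h2, indicator_of_mem (hzU h2)]

end Kernel

/-! ### Convergence of the derivatives of averages -/

section LocalEstimate

variable {V W : Type*} [NormedAddCommGroup V] [NormedSpace ℝ V]
  [NormedAddCommGroup W] [NormedSpace ℝ W]
  {E : Type*} [NormedAddCommGroup E] [NormedSpace ℝ E]
  {Θ : E → Plane → Plane} {x₀ : Plane} {r δ Λ : ℝ}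

theorem derivCoeffZero_id {E : Type*} (v : E) (x : Plane) :
    derivCoeffZero (fun _ _ => ContinuousLinearMap.id ℝ V) v x = 0 := by
  ext y e
  rw [derivCoeffZero_apply]
  simp

namespace IsNearIdentity

theorem fderiv_zero (h : IsNearIdentity Θ x₀ r δ Λ) {x : Plane} (hx : x ∈ Metric.ball x₀ r) :
    fderiv ℝ (Θ 0) x = ContinuousLinearMap.id ℝ Plane := by
  have : Θ 0 =ᶠ[𝓝 x] id := by
    filter_upwards [Metric.isOpen_ball.mem_nhds hx] with y hy using h.zero y hy
  rw [this.fderiv_eq, fderiv_id]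

theorem derivCoeffOne_zero (h : IsNearIdentity Θ x₀ r δ Λ) {a : E → Plane → V →L[ℝ] V}
    {x : Plane} (hx : x ∈ Metric.ball x₀ r) (ha : a 0 x = ContinuousLinearMap.id ℝ V) :
    derivCoeffOne a Θ 0 x = ContinuousLinearMap.id ℝ _ := by
  ext B e
  rw [derivCoeffOne_apply, ha, h.fderiv_zero hx]
  rfl

variable [FiniteDimensional ℝ E] [MeasurableSpace E] [BorelSpace E]

theorem aestronglyMeasurable_integral_apply_comp_sub (h : IsNearIdentity Θ x₀ r δ Λ) {ν : Measure E}
    [IsProbabilityMeasure ν] {δ' : ℝ} (hδ : δ' < δ) (hν : ∀ᵐ v ∂ν, ‖v‖ ≤ δ')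
    {a : E → Plane → V →L[ℝ] W} (ha : Continuous (Function.uncurry a))
    {A : Plane → V} (hA : MemLp A 2 (volume.restrict (Metric.ball x₀ (2 * r)))) :
    AEStronglyMeasurable (fun x => (∫ v, a v x (A (Θ v x)) ∂ν) - a 0 x (A x))
      (volume.restrict (Metric.ball x₀ r)) := by
  refine ((h.memLp_uncurry hδ hν ha hA).1.prod_swap.integral_prod_right').sub ?_
  exact (isBoundedBilinearMap_apply (𝕜 := ℝ) (E := V) (F := W)).continuous
    |>.comp_aestronglyMeasurable₂
      ((ha.comp (continuous_const.prodMk continuous_id)).aestronglyMeasurable)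
      (hA.1.mono_measure (Measure.restrict_mono
        (Metric.ball_subset_ball (by linarith [h.r_pos])) le_rfl))

variable [CompleteSpace V]

/-- If `u` is smooth and equal to the average of `f ∘ Θ v` over a probability measure concentrated
near `0`, then its derivatives up to order two are close in `L²` to the weak derivatives of `f`, and
its derivative is the average of the derivatives of `f ∘ Θ v`. -/
theorem exists_eLpNorm_fderiv_sub_le (h : IsNearIdentity Θ x₀ r δ Λ) {f : Plane → V}
    {G : Plane → Plane →L[ℝ] V} {H : Plane → Plane →L[ℝ] Plane →L[ℝ] V}
    (hG : HasWeakFDeriv (Metric.ball x₀ (4 * r)) f G)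
    (hH : HasWeakFDeriv (Metric.ball x₀ (4 * r)) G H)
    (hf2 : MemLp f 2 (volume.restrict (Metric.ball x₀ (4 * r))))
    (hG2 : MemLp G 2 (volume.restrict (Metric.ball x₀ (4 * r))))
    (hH2 : MemLp H 2 (volume.restrict (Metric.ball x₀ (4 * r)))) {η : ℝ≥0∞} (hη : 0 < η) :
    ∃ ε₀ > 0, ∀ ν : Measure E, IsProbabilityMeasure ν → (∀ᵐ v ∂ν, ‖v‖ ≤ ε₀) →
      ∀ u : Plane → V, ContDiffOn ℝ ∞ u (Metric.ball x₀ r) →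
      (∀ x ∈ Metric.ball x₀ r, u x = ∫ v, f (Θ v x) ∂ν) →
      eLpNorm (fun x => u x - f x) 2 (volume.restrict (Metric.ball x₀ r)) ≤ η ∧
      eLpNorm (fun x => fderiv ℝ u x - G x) 2 (volume.restrict (Metric.ball x₀ r)) ≤ η ∧
      eLpNorm (fun x => fderiv ℝ (fderiv ℝ u) x - H x) 2
        (volume.restrict (Metric.ball x₀ r)) ≤ η ∧
      fderiv ℝ u =ᵐ[volume.restrict (Metric.ball x₀ r)] fun x =>
        ∫ v, derivCoeffOne (fun _ _ => ContinuousLinearMap.id ℝ V) Θ v x (G (Θ v x)) ∂ν := by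
  have hr := h.r_pos
  have hδ := h.δ_pos
  have hbm : MeasurableSet (Metric.ball x₀ r) := Metric.isOpen_ball.measurableSet
  have hsub : Metric.ball x₀ (2 * r) ⊆ Metric.ball x₀ (4 * r) :=
    Metric.ball_subset_ball (by linarith)
  have mono : ∀ {X : Type _} [NormedAddCommGroup X] {B : Plane → X},
      MemLp B 2 (volume.restrict (Metric.ball x₀ (4 * r))) →
      MemLp B 2 (volume.restrict (Metric.ball x₀ (2 * r))) :=
    fun hB => hB.mono_measure (Measure.restrict_mono hsub le_rfl)
  have hf2' := mono hf2
  have hG2' := mono hG2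
  have hH2' := mono (X := Plane →L[ℝ] Plane →L[ℝ] V) hH2
  set a : E → Plane → V →L[ℝ] V := fun _ _ => ContinuousLinearMap.id ℝ V with ha
  have has : ContDiff ℝ ∞ (Function.uncurry a) := contDiff_const
  set b := derivCoeffOne a Θ with hb
  have hbs : ContDiff ℝ ∞ (Function.uncurry b) := contDiff_derivCoeffOne has h.contDiff
  have hzs := contDiff_derivCoeffZero hbs
  have hos := contDiff_derivCoeffOne hbs h.contDiff
  have hη2 : 0 < η / 2 := ENNReal.half_pos hη.ne'
  obtain ⟨ε₁, hε₁, h1⟩ := h.exists_eLpNorm_integral_sub_le has.continuous hf2' hη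
  obtain ⟨ε₂, hε₂, h2⟩ := h.exists_eLpNorm_integral_sub_le hbs.continuous hG2' hη
  obtain ⟨ε₃, hε₃, h3⟩ := h.exists_eLpNorm_integral_sub_le hzs.continuous hG2' hη2
  obtain ⟨ε₄, hε₄, h4⟩ := h.exists_eLpNorm_integral_sub_le hos.continuous hH2' hη2
  have hb0 : ∀ x ∈ Metric.ball x₀ r, b 0 x = ContinuousLinearMap.id ℝ _ := fun x hx =>
    h.derivCoeffOne_zero hx rfl
  have hz0 : ∀ x ∈ Metric.ball x₀ r, derivCoeffZero b 0 x = 0 := by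
    intro x hx
    have : b 0 =ᶠ[𝓝 x] fun _ => ContinuousLinearMap.id ℝ _ := by
      filter_upwards [Metric.isOpen_ball.mem_nhds hx] with y hy using hb0 y hy
    ext y e
    rw [derivCoeffZero_apply, this.fderiv_eq]
    simp
  have ho0 : ∀ x ∈ Metric.ball x₀ r, derivCoeffOne b Θ 0 x = ContinuousLinearMap.id ℝ _ :=
    fun x hx => h.derivCoeffOne_zero hx (hb0 x hx)
  refine ⟨min (min ε₁ ε₂) (min (min ε₃ ε₄) (δ / 2)), by positivity, fun ν _ hν u hu hue => ?_⟩
  have hν1 : ∀ᵐ v ∂ν, ‖v‖ ≤ ε₁ := hν.mono fun v hv => by simp only [le_min_iff] at hv; tauto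
  have hν2 : ∀ᵐ v ∂ν, ‖v‖ ≤ ε₂ := hν.mono fun v hv => by simp only [le_min_iff] at hv; tauto
  have hν3 : ∀ᵐ v ∂ν, ‖v‖ ≤ ε₃ := hν.mono fun v hv => by simp only [le_min_iff] at hv; tauto
  have hν4 : ∀ᵐ v ∂ν, ‖v‖ ≤ ε₄ := hν.mono fun v hv => by simp only [le_min_iff] at hv; tauto
  have hν5 : ∀ᵐ v ∂ν, ‖v‖ ≤ δ / 2 := hν.mono fun v hv => by simp only [le_min_iff] at hv; tauto
  have hδ2 : δ / 2 < δ := half_lt_self hδ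
  have hue' : u =ᵐ[volume.restrict (Metric.ball x₀ r)] fun x => ∫ v, a v x (f (Θ v x)) ∂ν := by
    filter_upwards [ae_restrict_mem hbm] with x hx using hue x hx
  have w1 := h.hasWeakFDeriv_integral_apply_comp hδ2 hν5 has hG hf2 hG2
  have w1' : HasWeakFDeriv (Metric.ball x₀ r) u (fun x => ∫ v, b v x (G (Θ v x)) ∂ν) := by
    refine w1.congr hbm hue'.symm (Eventually.of_forall fun x => ?_)
    simp only [ha, derivCoeffZero_id, zero_apply, integral_zero, zero_add]
    rfl
  have d1 : fderiv ℝ u =ᵐ[volume.restrict (Metric.ball x₀ r)]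
      fun x => ∫ v, b v x (G (Θ v x)) ∂ν :=
    (hasWeakFDeriv_of_contDiffOn Metric.isOpen_ball (hu.of_le (by simp))).ae_eq
      Metric.isOpen_ball w1'
  have w2 := h.hasWeakFDeriv_integral_apply_comp hδ2 hν5 hbs hH hG2 hH2
  have w2' := w2.congr hbm d1.symm ae_eq_rfl
  have d2 := (hasWeakFDeriv_of_contDiffOn Metric.isOpen_ball
    ((hu.fderiv_of_isOpen Metric.isOpen_ball (m := ∞) (by simp)).of_le (by simp))).ae_eq
    Metric.isOpen_ball w2'
  refine ⟨?_, ?_, ?_, d1⟩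
  · refine le_trans (le_of_eq (eLpNorm_congr_ae ?_)) (h1 ν inferInstance hν1)
    filter_upwards [hue'] with x hx
    rw [hx]
    rfl
  · refine le_trans (le_of_eq (eLpNorm_congr_ae ?_)) (h2 ν inferInstance hν2)
    filter_upwards [d1, ae_restrict_mem hbm] with x hx hxb
    rw [hx, hb0 x hxb]
    rfl
  · have e : (fun x => fderiv ℝ (fderiv ℝ u) x - H x) =ᵐ[volume.restrict (Metric.ball x₀ r)]
        (fun x => (∫ v, derivCoeffZero b v x (G (Θ v x)) ∂ν) - derivCoeffZero b 0 x (G x)) +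
        fun x => (∫ v, derivCoeffOne b Θ v x (H (Θ v x)) ∂ν) - derivCoeffOne b Θ 0 x (H x) := by
      filter_upwards [d2, ae_restrict_mem hbm] with x hx hxb
      rw [Pi.add_apply, hx, hz0 x hxb, ho0 x hxb, zero_apply, sub_zero,
        ContinuousLinearMap.id_apply, add_sub_assoc]
    rw [eLpNorm_congr_ae e, ← ENNReal.add_halves η]
    exact (eLpNorm_add_le
      (h.aestronglyMeasurable_integral_apply_comp_sub hδ2 hν5 hzs.continuous hG2')
      (h.aestronglyMeasurable_integral_apply_comp_sub hδ2 hν5 hos.continuous hH2')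
      one_le_two).trans (add_le_add (h3 ν inferInstance hν3) (h4 ν inferInstance hν4))

end IsNearIdentity
end LocalEstimate

/-! ### The mollification in a chart -/

section LocalMollification

variable {S : Type*} [TopologicalSpace S] [ChartedSpace Plane S]

theorem IsTubularNeighborhood.projection_apply {V : Type*} [NormedAddCommGroup V] [NormedSpace ℝ V]
    {j : S → V} {U : Set V} {P : V → S} (hU : IsTubularNeighborhood j U P) (s : S) :
    P (j s) = s := by
  by_contra h
  have := hU.nearest (j s) (hU.range_subset (mem_range_self s)) s (Ne.symm h)
  rw [dist_self] at this
  exact absurd this (not_lt.2 dist_nonneg)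

/-- In a chart, the embedding and the nearest point projection are given locally by globally
defined smooth maps `p` and `Q`. -/
theorem IsTubularNeighborhood.exists_contDiff_representatives {V : Type*} [NormedAddCommGroup V]
    [NormedSpace ℝ V] [HasContDiffBump V]
    {j : S → V} (hj : ContMDiff 𝓘(ℝ, Plane) 𝓘(ℝ, V) ∞ j)
    {U : Set V} {P : V → S} (hU : IsTubularNeighborhood j U P)
    {φ : OpenPartialHomeomorph S Plane} (hφ : φ ∈ IsManifold.maximalAtlas 𝓘(ℝ, Plane) ∞ S)
    {x₀ : Plane} (hx₀ : x₀ ∈ φ.target) :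
    ∃ (p : Plane → V) (Q : V → Plane), ContDiff ℝ ∞ p ∧ ContDiff ℝ ∞ Q ∧
      p x₀ = j (φ.symm x₀) ∧ (∀ᶠ x in 𝓝 x₀, p x = j (φ.symm x)) ∧
      (∀ᶠ y in 𝓝 (p x₀), y ∈ U ∧ P y ∈ φ.source ∧ Q y = φ (P y)) ∧
      ∀ᶠ x in 𝓝 x₀, Q (p x) = x := by
  have h1 : ContDiffOn ℝ ∞ (fun x => j (φ.symm x)) φ.target :=
    contMDiffOn_iff_contDiffOn.1
      (hj.comp_contMDiffOn (contMDiffOn_symm_of_mem_maximalAtlas hφ))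
  obtain ⟨p, hp, hpe⟩ := exists_contDiff_eventuallyEq φ.open_target h1 hx₀
  have hO : IsOpen (U ∩ P ⁻¹' φ.source) :=
    hU.contMDiffOn.continuousOn.isOpen_inter_preimage hU.isOpen φ.open_source
  have h2 : ContDiffOn ℝ ∞ (fun y => φ (P y)) (U ∩ P ⁻¹' φ.source) :=
    contMDiffOn_iff_contDiffOn.1
      ((contMDiffOn_of_mem_maximalAtlas hφ).comp (hU.contMDiffOn.mono inter_subset_left)
        fun y hy => hy.2)
  have hz : j (φ.symm x₀) ∈ U ∩ P ⁻¹' φ.source := by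
    refine ⟨hU.range_subset (mem_range_self _), ?_⟩
    rw [mem_preimage, hU.projection_apply]
    exact φ.map_target hx₀
  obtain ⟨Q, hQ, hQe⟩ := exists_contDiff_eventuallyEq hO h2 hz
  have hp0 : p x₀ = j (φ.symm x₀) := hpe.self_of_nhds
  rw [← hp0] at hQe hz
  have hgood : ∀ᶠ y in 𝓝 (p x₀), y ∈ U ∧ P y ∈ φ.source ∧ Q y = φ (P y) := by
    filter_upwards [hQe, hO.mem_nhds hz] with y hy1 hy2 using ⟨hy2.1, hy2.2, hy1⟩
  refine ⟨p, Q, hp, hQ, hp0, hpe, hgood, ?_⟩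
  filter_upwards [hpe, hp.continuous.continuousAt.eventually hgood,
    φ.open_target.mem_nhds hx₀] with x hx1 hx2 hx3
  rw [hx2.2.2, hx1, hU.projection_apply, φ.right_inv hx3]

theorem HasWeakFDeriv.exists_stronglyMeasurable_congr {W : Type*} [NormedAddCommGroup W]
    [NormedSpace ℝ W] {Ω : Set Plane} (hΩ : MeasurableSet Ω) {u : Plane → W}
    {G : Plane → Plane →L[ℝ] W} {H : Plane → Plane →L[ℝ] Plane →L[ℝ] W}
    (hG : HasWeakFDeriv Ω u G) (hH : HasWeakFDeriv Ω G H)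
    (hGm : AEStronglyMeasurable G (volume.restrict Ω)) :
    ∃ G', StronglyMeasurable G' ∧ G =ᵐ[volume.restrict Ω] G' ∧ HasWeakFDeriv Ω u G' ∧
      HasWeakFDeriv Ω G' H := by
  obtain ⟨G', hG', h⟩ := hGm
  exact ⟨G', hG', h, hG.congr hΩ ae_eq_rfl h, hH.congr hΩ h ae_eq_rfl⟩

/-- A pointwise lower bound on a continuous family of operators which holds almost everywhere
on an open set holds everywhere. -/
theorem le_norm_apply_of_ae {W : Type*} [NormedAddCommGroup W] [NormedSpace ℝ W] {Ω : Set Plane}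
    (hΩ : IsOpen Ω) {A : Plane → Plane →L[ℝ] W} (hA : ContinuousOn A Ω) {c : ℝ}
    (h : ∀ᵐ x ∂(volume.restrict Ω), ∀ e, c * ‖e‖ ≤ ‖A x e‖) {x : Plane} (hx : x ∈ Ω) (e : Plane) :
    c * ‖e‖ ≤ ‖A x e‖ := by
  by_contra hlt
  rw [not_le] at hlt
  have hc : ContinuousOn (fun y => ‖A y e‖) Ω := (hA.clm_apply continuousOn_const).norm
  have hO : IsOpen (Ω ∩ (fun y => ‖A y e‖) ⁻¹' Iio (c * ‖e‖)) :=
    hc.isOpen_inter_preimage hΩ isOpen_Iio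
  have h0 : volume (Ω ∩ (fun y => ‖A y e‖) ⁻¹' Iio (c * ‖e‖)) = 0 := by
    rw [ae_restrict_iff' hΩ.measurableSet] at h
    refine measure_mono_null (fun y hy => ?_) (ae_iff.1 h)
    rw [mem_ofPred_eq]
    exact fun hy' => absurd (hy' hy.1 e) (not_le.2 hy.2)
  exact (hO.measure_pos volume ⟨x, hx, hlt⟩).ne' h0

variable {W : Type*} [NormedAddCommGroup W] [NormedSpace ℝ W] [CompleteSpace W] {m : ℕ}

/-- The mollified map in a chart, near a given point: it is smooth with injective differential for
small `ε`, and its derivatives up to order two converge in `L²` to the weak derivatives of `F`. -/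
theorem IsTubularNeighborhood.exists_mem_nhds_tubularMollification
    {j : S → EuclideanSpace ℝ (Fin m)}
    (hj : ContMDiff 𝓘(ℝ, Plane) 𝓘(ℝ, EuclideanSpace ℝ (Fin m)) ∞ j)
    {U : Set (EuclideanSpace ℝ (Fin m))} {P : EuclideanSpace ℝ (Fin m) → S}
    (hU : IsTubularNeighborhood j U P) {ψ : EuclideanSpace ℝ (Fin m) → ℝ}
    (hψ : IsRadialMollifier ψ) {F : S → W}
    {φ : OpenPartialHomeomorph S Plane} (hφ : φ ∈ IsManifold.maximalAtlas 𝓘(ℝ, Plane) ∞ S)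
    {x₀ : Plane} (hx₀ : x₀ ∈ φ.target) {G : Plane → Plane →L[ℝ] W}
    {H : Plane → Plane →L[ℝ] Plane →L[ℝ] W} (hG : HasWeakFDeriv φ.target (F ∘ φ.symm) G)
    (hH : HasWeakFDeriv φ.target G H)
    (hL2 : ∀ K : Set Plane, IsCompact K → K ⊆ φ.target →
      MemLp (F ∘ φ.symm) 2 (volume.restrict K) ∧ MemLp G 2 (volume.restrict K) ∧
        MemLp H 2 (volume.restrict K))
    {c : ℝ} (hc : 0 < c) {N : Set Plane} (hN : N ∈ 𝓝 x₀)
    (hlow : ∀ᵐ x ∂(volume.restrict N), ∀ e, c * ‖e‖ ≤ ‖G x e‖) :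
    ∃ ρ > 0, Metric.ball x₀ ρ ⊆ φ.target ∧
      (∀ᶠ ε in 𝓝[>] (0 : ℝ),
        ContDiffOn ℝ ∞ (fun x => tubularMollification ψ U P F ε (j (φ.symm x)))
          (Metric.ball x₀ ρ) ∧
        ∀ x ∈ Metric.ball x₀ ρ, ∀ e, c / 4 * ‖e‖ ≤
          ‖fderiv ℝ (fun x => tubularMollification ψ U P F ε (j (φ.symm x))) x e‖) ∧
      ∀ η > (0 : ℝ≥0∞), ∀ᶠ ε in 𝓝[>] (0 : ℝ),
        eLpNorm (fun x => tubularMollification ψ U P F ε (j (φ.symm x)) - F (φ.symm x)) 2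
          (volume.restrict (Metric.ball x₀ ρ)) ≤ η ∧
        eLpNorm (fun x =>
          fderiv ℝ (fun x => tubularMollification ψ U P F ε (j (φ.symm x))) x - G x) 2
          (volume.restrict (Metric.ball x₀ ρ)) ≤ η ∧
        eLpNorm (fun x =>
          fderiv ℝ (fderiv ℝ fun x => tubularMollification ψ U P F ε (j (φ.symm x))) x - H x) 2
          (volume.restrict (Metric.ball x₀ ρ)) ≤ η := by
  obtain ⟨p, Q, hp, hQ, hp0, hpe, hgood, hQp⟩ := hU.exists_contDiff_representatives hj hφ hx₀
  have hΘ : ContDiff ℝ ∞ (Function.uncurry fun v x => Q (p x + v)) :=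
    hQ.comp ((hp.comp contDiff_snd).add contDiff_fst)
  obtain ⟨r₀, hr₀, Λ, hnear⟩ := exists_isNearIdentity hΘ (x₀ := x₀) (by simpa using hQp)
  obtain ⟨t, ht, htb⟩ := Metric.nhds_basis_closedBall.mem_iff.1
    (inter_mem (inter_mem (φ.open_target.mem_nhds hx₀) hN) hpe)
  obtain ⟨σ, hσ, hσb⟩ := Metric.nhds_basis_ball.mem_iff.1 hgood
  -- integrability of `F ∘ P` near `p x₀`
  set r₁ := min r₀ t with hr₁
  obtain ⟨δ₁, h₁⟩ := hnear r₁ (by positivity) (min_le_left _ _)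
  have hfi : IntegrableOn (F ∘ φ.symm) (Metric.ball x₀ r₁) := by
    have := isFiniteMeasure_restrict_ball x₀ r₁
    refine MemLp.integrable one_le_two ((hL2 _ (isCompact_closedBall x₀ t)
      fun x hx => (htb hx).1.1).1.mono_measure (Measure.restrict_mono ?_ le_rfl))
    exact (Metric.ball_subset_ball (min_le_right _ _)).trans Metric.ball_subset_closedBall
  obtain ⟨ε₁, hε₁, hint⟩ := h₁.exists_integrableOn_comp hp hQ hfi
  set τ := min ε₁ σ / 2 with hτ
  have hτ0 : 0 < τ := by positivity
  have hτσ : Metric.ball (p x₀) (2 * τ) ⊆ Metric.ball (p x₀) σ :=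
    Metric.ball_subset_ball (by rw [hτ]; linarith [min_le_right ε₁ σ])
  have hFP : ∀ y ∈ Metric.ball (p x₀) (2 * τ), y ∈ U ∧ F (P y) = (F ∘ φ.symm) (Q y) := by
    intro y hy
    obtain ⟨h1, h2, h3⟩ := hσb (hτσ hy)
    exact ⟨h1, by rw [Function.comp, h3, φ.left_inv h2]⟩
  have hintP : IntegrableOn (fun y => F (P y)) (Metric.ball (p x₀) (2 * τ)) :=
    (hint.mono_set (Metric.ball_subset_ball (by rw [hτ]; linarith [min_le_left ε₁ σ]))).congr_fun
      (fun y hy => (hFP y hy).2.symm) Metric.isOpen_ball.measurableSet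
  -- the ball on which the estimates are made
  obtain ⟨t', ht', htb'⟩ := Metric.nhds_basis_ball.mem_iff.1
    (hp.continuous.continuousAt.preimage_mem_nhds (Metric.ball_mem_nhds (p x₀) hτ0))
  set r := min r₀ (min (t / 4) t') with hr
  have hr0 : 0 < r := by positivity
  have hrt : 4 * r ≤ t := by
    have := (min_le_right r₀ (min (t / 4) t')).trans (min_le_left _ _)
    rw [← hr] at this
    linarith
  have hrt' : r ≤ t' := (min_le_right _ _).trans (min_le_right _ _)
  obtain ⟨δ, h⟩ := hnear r hr0 (min_le_left _ _)
  have h4 : Metric.ball x₀ (4 * r) ⊆ Metric.closedBall x₀ t :=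
    Metric.ball_subset_closedBall.trans (Metric.closedBall_subset_closedBall hrt)
  have h4t : Metric.ball x₀ (4 * r) ⊆ φ.target := fun x hx => (htb (h4 hx)).1.1
  have h14 : Metric.ball x₀ r ⊆ Metric.ball x₀ (4 * r) := Metric.ball_subset_ball (by linarith)
  have h24 : Metric.ball x₀ (2 * r) ⊆ Metric.ball x₀ (4 * r) :=
    Metric.ball_subset_ball (by linarith)
  have hhalf : Metric.ball x₀ (r / 2) ⊆ Metric.ball x₀ r := Metric.ball_subset_ball (by linarith)
  have mono : ∀ {X : Type _} [NormedAddCommGroup X] {B : Plane → X},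
      MemLp B 2 (volume.restrict (Metric.closedBall x₀ t)) →
      MemLp B 2 (volume.restrict (Metric.ball x₀ (4 * r))) :=
    fun hB => hB.mono_measure (Measure.restrict_mono h4 le_rfl)
  have mono2 : ∀ {X : Type _} [NormedAddCommGroup X] {B : Plane → X},
      MemLp B 2 (volume.restrict (Metric.ball x₀ (4 * r))) →
      MemLp B 2 (volume.restrict (Metric.ball x₀ (2 * r))) :=
    fun hB => hB.mono_measure (Measure.restrict_mono h24 le_rfl)
  obtain ⟨hf2, hG2, hH2⟩ := hL2 _ (isCompact_closedBall x₀ t) fun x hx => (htb hx).1.1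
  replace hf2 := mono hf2
  replace hG2 := mono hG2
  replace hH2 := mono (X := Plane →L[ℝ] Plane →L[ℝ] W) hH2
  -- the lower bound evaluates `G` along `Q`, which requires a strongly measurable representative
  obtain ⟨G', hG'm, hGG', hG', hH'⟩ := (hG.mono h4t).exists_stronglyMeasurable_congr
    Metric.isOpen_ball.measurableSet (hH.mono h4t) hG2.1
  have hG'2 := (memLp_congr_ae hGG').1 hG2
  have hlow' : ∀ᵐ x ∂(volume.restrict (Metric.ball x₀ (2 * r))), ∀ e, c * ‖e‖ ≤ ‖G' x e‖ := by
    have h1 := ae_restrict_of_ae_restrict_of_subset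
      (h24.trans fun x hx => (htb (h4 hx)).1.2) hlow
    filter_upwards [h1, ae_restrict_of_ae_restrict_of_subset h24 hGG'] with x hx hx' e
    rw [← hx']
    exact hx e
  obtain ⟨M, hM⟩ := hψ.exists_scaledKernel_le
  obtain ⟨ε₂, hε₂, hbound⟩ := h.exists_le_norm_integral_derivCoeffOne hp hG'm (hH'.mono h24)
    (mono2 hG'2) (mono2 (X := Plane →L[ℝ] Plane →L[ℝ] W) hH2) hc hlow' M
  have hsmooth : ∀ ε, 0 < ε → ε ≤ τ → ContDiffOn ℝ ∞
      (fun x => tubularMollification ψ U P F ε (j (φ.symm x))) (Metric.ball x₀ r) := by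
    intro ε hε hετ
    refine ContDiffOn.congr (f := fun x => tubularMollification ψ U P F ε (p x)) ?_ fun x hx => ?_
    · exact (hψ.contDiffOn_tubularMollification hU.isOpen.measurableSet hε hετ
        (fun y hy => (hFP y hy).1) hintP).comp hp.contDiffOn
        fun x hx => htb' (Metric.ball_subset_ball hrt' hx)
    · have : p x = j (φ.symm x) := (htb (h4 (h14 hx))).2
      rw [this]
  have havg : ∀ ε, 0 < ε → ε ≤ τ → ∀ x ∈ Metric.ball x₀ r,
      tubularMollification ψ U P F ε (j (φ.symm x)) =
        ∫ v, (F ∘ φ.symm) (Q (p x + v)) ∂(kernelMeasure (scaledKernel ψ ε)) := by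
    intro ε hε hετ x hx
    have hpx : p x = j (φ.symm x) := (htb (h4 (h14 hx))).2
    rw [← hpx]
    refine hψ.tubularMollification_eq (g := fun y => (F ∘ φ.symm) (Q y))
      hU.isOpen.measurableSet hε fun y hy => hFP y ?_
    have h1 : dist (p x) (p x₀) < τ := htb' (Metric.ball_subset_ball hrt' hx)
    have h2 := dist_triangle y (p x) (p x₀)
    rw [Metric.mem_ball]
    linarith
  have small : ∀ b > (0 : ℝ), ∀ᶠ ε in 𝓝[>] (0 : ℝ), 0 < ε ∧ ε ≤ b := fun b hb =>
    Ioc_mem_nhdsGT hb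
  have hprob : ∀ ε, 0 < ε → IsProbabilityMeasure (kernelMeasure (scaledKernel ψ ε)) :=
    fun ε hε => isProbabilityMeasure_kernelMeasure (hψ.scaledKernel_nonneg hε)
      (hψ.integral_scaledKernel hε)
  have hsupp : ∀ ε, 0 < ε → ∀ b, ε ≤ b → ∀ᵐ v ∂(kernelMeasure (scaledKernel ψ ε)), ‖v‖ ≤ b :=
    fun ε hε b hb => ae_kernelMeasure (hψ.continuous_scaledKernel ε)
      fun v hv => (hψ.scaledKernel_norm_le hε v hv).trans hb
  refine ⟨r / 2, by positivity, hhalf.trans (h14.trans h4t), ?_, fun η hη => ?_⟩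
  · obtain ⟨ε₃, hε₃, hclose⟩ := h.exists_eLpNorm_fderiv_sub_le hG' hH' hf2 hG'2 hH2
      (η := 1) one_pos
    filter_upwards [small τ hτ0, small ε₂ hε₂, small ε₃ hε₃] with ε h1 h2 h3
    have hsm := hsmooth ε h1.1 h1.2
    refine ⟨hsm.mono hhalf, fun x hx e => ?_⟩
    have hd := (hclose _ (hprob ε h1.1) (hsupp ε h1.1 _ h3.2) _ hsm (havg ε h1.1 h1.2)).2.2.2
    refine le_norm_apply_of_ae Metric.isOpen_ball ((hsm.continuousOn_fderiv_of_isOpen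
      Metric.isOpen_ball (by simp)).mono hhalf) ?_ hx e
    filter_upwards [hbound ε h1.1 h2.2 _ (hψ.continuous_scaledKernel ε)
      (hψ.scaledKernel_nonneg h1.1) (hψ.integral_scaledKernel h1.1)
      (by simpa only [finrank_euclideanSpace_fin] using hM ε h1.1)
      (hψ.scaledKernel_norm_le h1.1), ae_restrict_of_ae_restrict_of_subset hhalf hd] with y hy1 hy2
    rw [hy2]
    exact hy1
  · obtain ⟨ε₃, hε₃, hclose⟩ := h.exists_eLpNorm_fderiv_sub_le hG' hH' hf2 hG'2 hH2 hη
    filter_upwards [small τ hτ0, small ε₃ hε₃] with ε h1 h3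
    obtain ⟨e1, e2, e3, -⟩ := hclose _ (hprob ε h1.1) (hsupp ε h1.1 _ h3.2) _
      (hsmooth ε h1.1 h1.2) (havg ε h1.1 h1.2)
    have hm := Measure.restrict_mono (μ := (volume : Measure Plane)) hhalf le_rfl
    refine ⟨(eLpNorm_mono_measure _ hm).trans e1, ?_, (eLpNorm_mono_measure _ hm).trans e3⟩
    refine le_trans (eLpNorm_mono_measure _ hm) (le_trans (le_of_eq (eLpNorm_congr_ae ?_)) e2)
    filter_upwards [ae_restrict_of_ae_restrict_of_subset h14 hGG'] with x hx
    rw [hx]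

end LocalMollification

/-! ### Differentials in a chart -/

section Immersion

variable {S : Type*} [TopologicalSpace S] [ChartedSpace Plane S]
  {W : Type*} [NormedAddCommGroup W] [NormedSpace ℝ W]

theorem contMDiffAt_and_injective_mfderiv_of_comp_symm [IsManifold 𝓘(ℝ, Plane) ∞ S] {f : S → W}
    {s₀ s : S} (hs : s ∈ (chartAt Plane s₀).source)
    (hu : ContDiffAt ℝ ∞ (f ∘ (chartAt Plane s₀).symm) (chartAt Plane s₀ s))
    (hinj : Function.Injective (fderiv ℝ (f ∘ (chartAt Plane s₀).symm) (chartAt Plane s₀ s))) :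
    ContMDiffAt 𝓘(ℝ, Plane) 𝓘(ℝ, W) ∞ f s ∧
      Function.Injective (mfderiv 𝓘(ℝ, Plane) 𝓘(ℝ, W) f s) := by
  have : IsManifold 𝓘(ℝ, Plane) 1 S := .of_le (n := ∞) (by simp)
  set φ := chartAt Plane s₀ with hφ
  set u := f ∘ φ.symm with hu'
  have he : f =ᶠ[𝓝 s] u ∘ φ := by
    filter_upwards [φ.open_source.mem_nhds hs] with t ht
    simp only [hu', Function.comp, φ.left_inv ht]
  have hφs : ContMDiffAt 𝓘(ℝ, Plane) 𝓘(ℝ, Plane) ∞ φ s :=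
    (contMDiffOn_of_mem_maximalAtlas (IsManifold.chart_mem_maximalAtlas s₀)).contMDiffAt
      (φ.open_source.mem_nhds hs)
  have hum : ContMDiffAt 𝓘(ℝ, Plane) 𝓘(ℝ, W) ∞ u (φ s) := hu.contMDiffAt
  refine ⟨(hum.comp s hφs).congr_of_eventuallyEq he, ?_⟩
  rw [he.mfderiv_eq, mfderiv_comp s (hum.mdifferentiableAt (by simp))
    (hφs.mdifferentiableAt (by simp)), mfderiv_eq_fderiv]
  exact hinj.comp ((mdifferentiable_chart (I := 𝓘(ℝ, Plane)) s₀).mfderiv_injective hs)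

end Immersion

/-! ### Convergence on compact subsets of a chart -/

section Convergence

theorem eLpNorm_two_restrict_union_le {α V : Type*} [MeasurableSpace α] {μ : Measure α}
    [NormedAddCommGroup V] {f : α → V} {s t : Set α} {a : ℝ≥0∞}
    (hs : eLpNorm f 2 (μ.restrict s) ≤ a) (ht : eLpNorm f 2 (μ.restrict t) ≤ a) :
    eLpNorm f 2 (μ.restrict (s ∪ t)) ≤ 2 * a := by
  refine (eLpNorm_mono_measure f (Measure.restrict_union_le s t)).trans
    (ENNReal.le_of_sq_le_sq ?_)
  have hs2 : eLpNorm f 2 (μ.restrict s) ^ 2 ≤ a ^ 2 := by gcongr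
  have ht2 : eLpNorm f 2 (μ.restrict t) ^ 2 ≤ a ^ 2 := by gcongr
  rw [eLpNorm_two_sq] at hs2 ht2
  rw [eLpNorm_two_sq, lintegral_add_measure]
  calc _ ≤ a ^ 2 + a ^ 2 := add_le_add hs2 ht2
    _ = 2 * a ^ 2 := (two_mul _).symm
    _ ≤ (2 * a) ^ 2 := by
      rw [mul_pow]
      gcongr
      norm_num

/-- Local `L²` convergence near each point of a compact set implies `L²` convergence on it. -/
theorem IsCompact.eventually_eLpNorm_two_le {ι X V : Type*} [TopologicalSpace X]
    [MeasurableSpace X] {μ : Measure X} [NormedAddCommGroup V] {l : Filter ι} {f : ι → X → V}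
    {K : Set X} (hK : IsCompact K)
    (h : ∀ x ∈ K, ∃ s ∈ 𝓝 x, ∀ η > 0, ∀ᶠ i in l, eLpNorm (f i) 2 (μ.restrict s) ≤ η) :
    ∀ η > 0, ∀ᶠ i in l, eLpNorm (f i) 2 (μ.restrict K) ≤ η := by
  refine hK.induction_on (p := fun s => ∀ η > 0, ∀ᶠ i in l, eLpNorm (f i) 2 (μ.restrict s) ≤ η)
    ?_ ?_ ?_ ?_
  · simp
  · intro s t hst ht η hη
    filter_upwards [ht η hη] with i hi
    exact (eLpNorm_mono_measure _ (Measure.restrict_mono hst le_rfl)).trans hi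
  · intro s t hs ht η hη
    filter_upwards [hs (η / 2) (ENNReal.half_pos hη.ne'), ht (η / 2) (ENNReal.half_pos hη.ne')]
      with i hi hi'
    exact (eLpNorm_two_restrict_union_le hi hi').trans
      (ENNReal.mul_div_cancel (by simp) (by simp)).le
  · intro x hx
    obtain ⟨s, hs, h⟩ := h x hx
    exact ⟨s, mem_nhdsWithin_of_mem_nhds hs, h⟩

variable {V : Type*} [NormedAddCommGroup V] [NormedSpace ℝ V]

theorem w22Seminorm_sub_le {Ω K : Set Plane} (hΩ : IsOpen Ω) {u f : Plane → V}
    (hu : ContDiffOn ℝ ∞ u Ω) {G : Plane → Plane →L[ℝ] V} {H : Plane → Plane →L[ℝ] Plane →L[ℝ] V}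
    (hG : HasWeakFDeriv Ω f G) (hH : HasWeakFDeriv Ω G H) :
    w22Seminorm Ω K (fun x => u x - f x) ≤
      eLpNorm (fun x => u x - f x) 2 (volume.restrict K) +
      eLpNorm (fun x => fderiv ℝ u x - G x) 2 (volume.restrict K) +
      eLpNorm (fun x => fderiv ℝ (fderiv ℝ u) x - H x) 2 (volume.restrict K) :=
  iInf_le_of_le (fun x => fderiv ℝ u x - G x) <|
    iInf_le_of_le (fun x => fderiv ℝ (fderiv ℝ u) x - H x) <| iInf_le_of_le
      ⟨(hasWeakFDeriv_of_contDiffOn hΩ (hu.of_le (by simp))).sub hG,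
        (hasWeakFDeriv_of_contDiffOn hΩ
          ((hu.fderiv_of_isOpen hΩ (m := ∞) (by simp)).of_le (by simp))).sub hH⟩ le_rfl

variable {S : Type*} [TopologicalSpace S] [ChartedSpace Plane S] [IsManifold 𝓘(ℝ, Plane) ∞ S]

/-- The lower bound for the weak differential in a chart, with respect to the Euclidean norm. -/
theorem IsW22LipschitzImmersion.exists_le_norm_apply {g₀ : SurfaceMetric S} {F : S → V}
    (hF : IsW22LipschitzImmersion g₀ F)
    {φ : OpenPartialHomeomorph S Plane} (hφ : φ ∈ IsManifold.maximalAtlas 𝓘(ℝ, Plane) ∞ S)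
    {G : Plane → Plane →L[ℝ] V} (hG : HasWeakFDeriv φ.target (F ∘ φ.symm) G)
    {x₀ : Plane} (hx₀ : x₀ ∈ φ.target) :
    ∃ c > 0, ∃ N ∈ 𝓝 x₀, ∀ᵐ x ∂(volume.restrict N), ∀ e, c * ‖e‖ ≤ ‖G x e‖ := by
  obtain ⟨c, hc, h⟩ := hF.lower_bound
  obtain ⟨κ, hκ, hnear⟩ := exists_mul_sq_norm_le_chartSqNorm g₀ hφ hx₀
  obtain ⟨ρ, hρ, hρN⟩ := Metric.nhds_basis_ball.mem_iff.1
    (inter_mem hnear (φ.open_target.mem_nhds hx₀))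
  refine ⟨√(c * κ), by positivity, _, Metric.ball_mem_nhds x₀ hρ, ?_⟩
  filter_upwards [ae_restrict_mem Metric.isOpen_ball.measurableSet,
    ae_restrict_of_ae_restrict_of_subset (hρN.trans inter_subset_right) (h φ hφ G hG)]
    with x hx hx' e
  have h1 := mul_le_mul_of_nonneg_left ((hρN hx).1 e) hc.le
  refine le_of_sq_le_sq ?_ (norm_nonneg _)
  rw [mul_pow, Real.sq_sqrt (by positivity), mul_assoc]
  exact h1.trans (hx' e)

end Convergence

end

/-! ### Smooth approximation by immersions -/

theorem lemma5p5 {S : Type*} [TopologicalSpace S] [T2Space S] [CompactSpace S]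
    [ChartedSpace Plane S] [IsManifold 𝓘(ℝ, Plane) ∞ S] (g₀ : SurfaceMetric S)
    {m n : ℕ} (hm : 3 ≤ m)
    (j : S → EuclideanSpace ℝ (Fin m)) (hj : IsSmoothSurfaceEmbedding j)
    (U : Set (EuclideanSpace ℝ (Fin m))) (P : EuclideanSpace ℝ (Fin m) → S)
    (hU : IsTubularNeighborhood j U P)
    (ψ : EuclideanSpace ℝ (Fin m) → ℝ) (hψ : IsRadialMollifier ψ)
    (F : S → EuclideanSpace ℝ (Fin n)) (hF : IsW22LipschitzImmersion g₀ F) :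
    (∀ᶠ ε in 𝓝[>] (0 : ℝ),
      IsSmoothImmersion (fun p : S => tubularMollification ψ U P F ε (j p))) ∧
    TendstoW22 (fun (ε : ℝ) (p : S) => tubularMollification ψ U P F ε (j p)) (𝓝[>] 0) F := by
  -- near each point the chart representative has injective differential for small `ε`; by
  -- compactness, one threshold for `ε` suffices
  have himm : ∀ᶠ ε in 𝓝[>] (0 : ℝ),
      IsSmoothImmersion (fun p : S => tubularMollification ψ U P F ε (j p)) := by
    have key : ∀ᶠ ε in 𝓝[>] (0 : ℝ), ∀ s ∈ (univ : Set S),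
        ContMDiffAt 𝓘(ℝ, Plane) 𝓘(ℝ, EuclideanSpace ℝ (Fin n)) ∞
          (fun p : S => tubularMollification ψ U P F ε (j p)) s ∧
        Function.Injective (mfderiv 𝓘(ℝ, Plane) 𝓘(ℝ, EuclideanSpace ℝ (Fin n))
          (fun p : S => tubularMollification ψ U P F ε (j p)) s) := by
      refine isCompact_univ.induction_on (p := fun A => ∀ᶠ ε in 𝓝[>] (0 : ℝ), ∀ s ∈ A,
        ContMDiffAt 𝓘(ℝ, Plane) 𝓘(ℝ, EuclideanSpace ℝ (Fin n)) ∞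
          (fun p : S => tubularMollification ψ U P F ε (j p)) s ∧
        Function.Injective (mfderiv 𝓘(ℝ, Plane) 𝓘(ℝ, EuclideanSpace ℝ (Fin n))
          (fun p : S => tubularMollification ψ U P F ε (j p)) s)) (by simp) ?_ ?_ ?_
      · exact fun A B hAB hB => hB.mono fun ε h s hs => h s (hAB hs)
      · intro A B hA hB
        filter_upwards [hA, hB] with ε h1 h2 s hs using hs.elim (h1 s) (h2 s)
      · intro s₀ _
        have hφ := IsManifold.chart_mem_maximalAtlas (I := 𝓘(ℝ, Plane)) (n := ∞) s₀
        set φ := chartAt Plane s₀ with hφdef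
        obtain ⟨G, H, hG, hH, hL2⟩ := hF.memW22 φ hφ
        have hx₀ : φ s₀ ∈ φ.target := φ.map_source (mem_chart_source Plane s₀)
        obtain ⟨c, hc, N, hN, hlow⟩ := hF.exists_le_norm_apply hφ hG hx₀
        obtain ⟨ρ, hρ, -, hev, -⟩ := hU.exists_mem_nhds_tubularMollification hj.contMDiff hψ hφ hx₀
          hG hH hL2 hc hN hlow
        refine ⟨φ.source ∩ φ ⁻¹' Metric.ball (φ s₀) ρ, ?_, ?_⟩
        · exact mem_nhdsWithin_of_mem_nhds ((φ.isOpen_inter_preimage Metric.isOpen_ball).mem_nhds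
            ⟨mem_chart_source Plane s₀, Metric.mem_ball_self hρ⟩)
        · filter_upwards [hev] with ε hε s hs
          refine contMDiffAt_and_injective_mfderiv_of_comp_symm hs.1
            (hε.1.contDiffAt (Metric.isOpen_ball.mem_nhds hs.2)) ?_
          refine (injective_iff_map_eq_zero _).2 fun e he => ?_
          have h1 : c / 4 * ‖e‖ ≤ ‖fderiv ℝ (fun x => tubularMollification ψ U P F ε
            (j (φ.symm x))) (φ s) e‖ := hε.2 _ hs.2 e
          have h2 : fderiv ℝ (fun x => tubularMollification ψ U P F ε
            (j (φ.symm x))) (φ s) e = 0 := he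
          rw [h2, norm_zero] at h1
          exact norm_le_zero_iff.1 (nonpos_of_mul_nonpos_right h1 (by positivity))
    filter_upwards [key] with ε hε
    exact ⟨fun s => (hε s (mem_univ s)).1, fun s => (hε s (mem_univ s)).2⟩
  refine ⟨himm, fun φ hφ K hK hKφ => ?_⟩
  obtain ⟨G, H, hG, hH, hL2⟩ := hF.memW22 φ hφ
  have hloc : ∀ x₀ ∈ K, ∃ s ∈ 𝓝 x₀, ∀ η > (0 : ℝ≥0∞), ∀ᶠ ε in 𝓝[>] (0 : ℝ),
      eLpNorm (fun x => tubularMollification ψ U P F ε (j (φ.symm x)) - F (φ.symm x)) 2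
        (volume.restrict s) ≤ η ∧
      eLpNorm (fun x =>
        fderiv ℝ (fun x => tubularMollification ψ U P F ε (j (φ.symm x))) x - G x) 2
        (volume.restrict s) ≤ η ∧
      eLpNorm (fun x =>
        fderiv ℝ (fderiv ℝ fun x => tubularMollification ψ U P F ε (j (φ.symm x))) x - H x) 2
        (volume.restrict s) ≤ η := by
    intro x₀ hx₀
    obtain ⟨c, hc, N, hN, hlow⟩ := hF.exists_le_norm_apply hφ hG (hKφ hx₀)
    obtain ⟨ρ, hρ, -, -, hev⟩ := hU.exists_mem_nhds_tubularMollification hj.contMDiff hψ hφ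
      (hKφ hx₀) hG hH hL2 hc hN hlow
    exact ⟨_, Metric.ball_mem_nhds x₀ hρ, hev⟩
  have l0 := hK.eventually_eLpNorm_two_le fun x hx => (hloc x hx).imp fun s hs =>
    ⟨hs.1, fun η hη => (hs.2 η hη).mono fun ε h => h.1⟩
  have l1 := hK.eventually_eLpNorm_two_le fun x hx => (hloc x hx).imp fun s hs =>
    ⟨hs.1, fun η hη => (hs.2 η hη).mono fun ε h => h.2.1⟩
  have l2 := hK.eventually_eLpNorm_two_le
    (V := Plane →L[ℝ] Plane →L[ℝ] EuclideanSpace ℝ (Fin n)) fun x hx => (hloc x hx).imp fun s hs =>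
    ⟨hs.1, fun η hη => (hs.2 η hη).mono fun ε h => h.2.2⟩
  have l : Tendsto (fun ε : ℝ =>
      eLpNorm (fun x => tubularMollification ψ U P F ε (j (φ.symm x)) - F (φ.symm x)) 2
        (volume.restrict K) +
      eLpNorm (fun x =>
        fderiv ℝ (fun x => tubularMollification ψ U P F ε (j (φ.symm x))) x - G x) 2
        (volume.restrict K) +
      eLpNorm (fun x =>
        fderiv ℝ (fderiv ℝ fun x => tubularMollification ψ U P F ε (j (φ.symm x))) x - H x) 2
        (volume.restrict K)) (𝓝[>] 0) (𝓝 0) := by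
    have := ((ENNReal.tendsto_nhds_zero.2 l0).add (ENNReal.tendsto_nhds_zero.2 l1)).add
      (ENNReal.tendsto_nhds_zero.2 l2)
    simpa only [add_zero] using this
  refine tendsto_of_tendsto_of_tendsto_of_le_of_le' tendsto_const_nhds l
    (Eventually.of_forall fun _ => zero_le) ?_
  -- for small `ε` the mollified map is smooth on the whole image of the chart, so that its
  -- classical derivatives are admissible in the definition of the seminorm
  filter_upwards [himm] with ε hε
  exact w22Seminorm_sub_le φ.open_target (contMDiffOn_iff_contDiffOn.1
    (hε.contMDiff.comp_contMDiffOn (contMDiffOn_symm_of_mem_maximalAtlas hφ))) hG hH
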